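/- **Setting.** Let $\mathcal S,\mathcal Z,\mathcal A$ be compact subsets of Euclidean spaces and consider the CMDP with augmented states $x=(s,z)\in\mathcal S\times\mathcal Z$, actions $a\in\mathcal A$, transition law $P_{\rm T}(s',z'\mid s,z,a)=P^{z}(s'\mid s,a)\,P_{\rm shift}(z'\mid z)$, costs $C'_k(s,a)$ and reshaped costs $\dot C'_k(x,a,x')=C'_k(s,a)+V_k(x')-V_k(x)$, $k=0,\dots,K$, with fixed potentials $V_k$. Policies $\pi_\theta(a\mid x)$, $\theta\in\Theta\subset\mathbb R^{n}$, have positive densities with respect to a fixed reference measure on $\mathcal A$. Let $\dot f_k(\theta)=\lim_{T\to\infty}\frac1T\mathbb E_{\pi_\theta}\sum_{t<T}\dot C'_k(x_t,a_t,x_{t+1})$; gradients in $\theta$ are taken within $\Theta$. **Assumption 1.** $\dot C'_k$ is bounded; $\Theta$ is compact and convex with nonempty interior; $\theta\mapsto\log\pi_\theta(a\mid x)$ is differentiable and Lipschitz on $\Theta$ with Lipschitz gradient, uniformly in $(x,a)$; $\dot f_k$ is differentiable on $\Theta$ with bounded Lipschitz gradient; there are $\lambda>0$, $\rho\in(0,1)$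 such that for every $\theta\in\Theta$ the state chain under $\pi_\theta$ has a stationary law $\mathbf P_{\pi_\theta}$ with $\sup_x d_{\rm TV}(P(x_t\in\cdot\mid x_0=x),\mathbf P_{\pi_\theta})\le\lambda\rho^t$ for all $t\ge0$, where $d_{\rm TV}(\alpha,\beta)=\int|\alpha(\mathrm dx)-\beta(\mathrm dx)|$. **Assumption 2.** The step sizes $\mu_i\in(0,1]$ and $\eta_i>0$ are deterministic and non-increasing, $\mu_i\to0$, $\sum\mu_i=\infty$, $\sum\mu_i^2<\infty$, $\eta_i\to0$, $1/\eta_i=O(i^{\varrho})$ for some $\varrho\in(0,1)$, $\sum\eta_i^2<\infty$, $\mu_i/\eta_i\to0$. **Algorithm.** Iteration $i$ uses the batch $\varepsilon_i$ of $B\ge 1$ consecutive time slots $t=Bi,\dots,Bi+B-1$ of one trajectory, in which, given the past, $a_t\sim\pi_{\theta_i}(\cdot\mid x_t)$ and $x_{t+1}\sim P_{\rm T}(\cdot\mid x_t,a_t)$. With $\hat{\mathbb E}_{\varepsilon_i}$ the batch average, $$\hat f_{k,i+1}=(1-\eta_{i+1})\hat f_{k,i}+\eta_i\hat{\mathbb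 E}_{\varepsilon_i}[\dot C'_k],\qquad \hat g_{k,i+1}=(1-\eta_{i+1})\hat g_{k,i}+\eta_i\hat{\mathbb E}_{\varepsilon_i}[Q_{\omega_{k,i}}(x,a)\nabla_\theta\log\pi_{\theta_i}(a\mid x)],$$ $$\theta_{i+1}=(1-\mu_i)\theta_i+\mu_i\bar\theta_i,\qquad \theta_0\in\Theta,\ \bar\theta_i\in\Theta .$$ The actor targets $\bar\theta_i$ and the Q-network weights $\omega_{k,i}$ are arbitrary random variables determined by the information available at the end of iteration $i$; the initial estimates and the outputs of the Q-networks along the run are bounded by a constant $b$. The surrogate Q-function is $$\hat Q_{k,i}(x,a)=\mathbb E_{\pi_{\theta_i}}\Bigl[\sum_{l=0}^{T_i-1}\bigl(\dot C'_{k,l}-\hat f_{k,i}\bigr)\Bigm| x_0=x,\,a_0=a\Bigr]$$ (expectation with $\theta_i,\hat f_{k,i}$ frozen), where the deterministic horizons $T_i$ are any with $\rho^{T_i}=O(\eta_{i+1})$. Put $$\epsilon_f(i)=\frac1{1+i}\sum_{i'=0}^i\mathbb E\bigl[(\hat f_{k,i'}-\dot f_k(\theta_{i'}))^2\bigr],\qquad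 \epsilon_g(i)=\frac1{1+i}\sum_{i'=0}^i\mathbb E\bigl[\|\hat g_{k,i'}-\nabla\dot f_k(\theta_{i'})\|_2^2\bigr],$$ $$\epsilon_Q(i)=\frac1{1+i}\sum_{i'=0}^i\mathbb E\Bigl[\sup_{x,a}\bigl|Q_{\omega_{k,i'}}(x,a)-\hat Q_{k,i'}(x,a)\bigr|\Bigr].$$ **Lemma 1 (Convergence rate of the surrogate functions).** Under Assumptions 1 and 2, all these expectations are finite, and there is a constant $C>0$, depending only on the CMDP, the policy class, $\Theta$, the step sizes, $B$, the Q-network architecture, the horizons $T_i$, and $b$ (not on the run, in particular not on the actor targets or on the Q-network weights), such that for every run, every $k$ and every $i\ge1$ $$\epsilon_f(i)\le\frac{C}{(1+i)\eta_{i+1}}+\frac{C}{1+i}\sum_{i'=0}^i\Bigl(\mu_{i'}\log^2 i+\frac{\mu_{i'}^2}{\eta_{i'+1}^2}+\frac{\mu_{i'}^2}{\eta_{i'+1}}+\eta_{i'+1}\log i\Bigr),$$ $$\epsilon_g(i)\le\frac{C}{(1+i)\eta_{i+1}}+\frac{C}{1+i}\sum_{i'=0}^i\Bigl(\mu_{i'}\log^2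 i+\frac{\mu_{i'}^2}{\eta_{i'+1}^2}+\frac{\mu_{i'}^2}{\eta_{i'+1}}+\eta_{i'+1}\Bigr)+C\,\epsilon_Q(i)+\sqrt{\epsilon_f(i)} .$$ Moreover $\lim_{i\to\infty}\epsilon_f(i)=0$, and $\epsilon_g(i)$ converges to zero up to the critic error: $\limsup_{i\to\infty}\bigl(\epsilon_g(i)-C\epsilon_Q(i)\bigr)\le0$. -/

import Mathlib

open MeasureTheory ProbabilityTheory Filter Topology
open scoped ENNReal NNReal

noncomputable section

namespace CACRL

/-- The parameter space `ℝⁿ`, with the Euclidean norm. -/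
abbrev Euc (n : ℕ) : Type := EuclideanSpace ℝ (Fin n)

/-- The augmented state space `𝒮 × 𝒵`. -/
abbrev AugState {nS nZ : ℕ} (S : Set (Euc nS)) (Z : Set (Euc nZ)) : Type := ↥S × ↥Z

/-- Total variation distance `∫ |α(dx) - β(dx)|` of two finite measures. -/
def tvDist {X : Type*} [MeasurableSpace X] (α β : Measure X)
    [IsFiniteMeasure α] [IsFiniteMeasure β] : ℝ :=
  ((α.toSignedMeasure - β.toSignedMeasure).totalVariation Set.univ).toReal

/-- A constrained Markov decision process whose transition function is driven by a latent Markov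
process: `cost k` is the per-step cost `C'ₖ` (`k = 0` the objective, `k = 1, …, K` the
constraints), `potential k` is the potential used to reshape it, `init` the law of the initial
augmented state. -/
structure CMDP {nS nZ nA : ℕ} (S : Set (Euc nS)) (Z : Set (Euc nZ)) (A : Set (Euc nA))
    (K : ℕ) where
  /-- `P^z(s' | s, a)`. -/
  trans : Kernel (AugState S Z × ↥A) ↥S
  trans_markov : IsMarkovKernel trans
  /-- `P_shift(z' | z)`. -/
  shift : Kernel ↥Z ↥Z
  shift_markov : IsMarkovKernel shift
  cost : Fin (K + 1) → ↥S → ↥A → ℝ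
  cost_measurable : ∀ k, Measurable fun p : ↥S × ↥A => cost k p.1 p.2
  potential : Fin (K + 1) → AugState S Z → ℝ
  potential_measurable : ∀ k, Measurable (potential k)
  init : Measure (AugState S Z)
  init_prob : IsProbabilityMeasure init

/-- A parameterized stochastic policy: `dens θ x a` is the density `π_θ(a | x)` with respect to
a reference measure on the action space. -/
structure Policy {nS nZ nA : ℕ} (S : Set (Euc nS)) (Z : Set (Euc nZ)) (A : Set (Euc nA))
    (n : ℕ) where
  ref : Measure ↥A
  ref_sigmaFinite : SigmaFinite ref
  dens : Euc n → AugState S Z → ↥A → ℝ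
  dens_measurable :
    Measurable fun p : Euc n × AugState S Z × ↥A => dens p.1 p.2.1 p.2.2
  dens_pos : ∀ θ x a, 0 < dens θ x a
  dens_norm : ∀ θ x, ∫⁻ a, ENNReal.ofReal (dens θ x a) ∂ref = 1

variable {nS nZ nA K n : ℕ} {S : Set (Euc nS)} {Z : Set (Euc nZ)} {A : Set (Euc nA)}

namespace Policy

/-- The policy `π_θ` as a kernel from augmented states to actions. -/
def kernel (π : Policy S Z A n) (θ : Euc n) : Kernel (AugState S Z) ↥A :=
  haveI := π.ref_sigmaFinite
  Kernel.withDensity (Kernel.const (AugState S Z) π.ref)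
    (fun x a => ENNReal.ofReal (π.dens θ x a))

instance (π : Policy S Z A n) (θ : Euc n) : IsMarkovKernel (π.kernel θ) := by
  have := π.ref_sigmaFinite
  have hm : Measurable (Function.uncurry fun x a => ENNReal.ofReal (π.dens θ x a)) :=
    ENNReal.measurable_ofReal.comp
      (π.dens_measurable.comp (measurable_const.prodMk measurable_id))
  refine ⟨fun x => ⟨?_⟩⟩
  rw [kernel, Kernel.withDensity_apply' _ hm, setLIntegral_univ, Kernel.const_apply]
  exact π.dens_norm θ x

/-- The score `∇_θ log π_θ(a | x)`; the gradient is taken within the parameter set `Θ`. -/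
def score (π : Policy S Z A n) (Θ : Set (Euc n)) (θ : Euc n) (x : AugState S Z) (a : ↥A) :
    Euc n :=
  gradientWithin (fun θ' => Real.log (π.dens θ' x a)) Θ θ

end Policy

namespace CMDP

/-- `P_T((s', z') | (s, z), a) = P^z(s' | s, a) P_shift(z' | z)`. -/
def augTrans (M : CMDP S Z A K) : Kernel (AugState S Z × ↥A) (AugState S Z) :=
  M.trans ×ₖ (M.shift.comap (fun p : AugState S Z × ↥A => p.1.2)
    (measurable_snd.comp measurable_fst))

instance (M : CMDP S Z A K) : IsMarkovKernel M.augTrans := by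
  have := M.trans_markov
  have := M.shift_markov
  unfold augTrans
  infer_instance

/-- The reshaped cost `C'ₖ(s, a) + Vₖ(x') - Vₖ(x)`, where `x = (s, z)`. -/
def reshapedCost (M : CMDP S Z A K) (k : Fin (K + 1)) (x : AugState S Z) (a : ↥A)
    (x' : AugState S Z) : ℝ :=
  M.cost k x.1 a + (M.potential k x' - M.potential k x)

/-- One step under the policy `π_θ`: the law of (action, next augmented state) given the current
augmented state. -/
def stepKernel (M : CMDP S Z A K) (π : Policy S Z A n) (θ : Euc n) :
    Kernel (AugState S Z) (↥A × AugState S Z) :=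
  (π.kernel θ) ⊗ₖ M.augTrans

instance (M : CMDP S Z A K) (π : Policy S Z A n) (θ : Euc n) :
    IsMarkovKernel (M.stepKernel π θ) := by
  unfold stepKernel
  infer_instance

/-- The transition kernel of the augmented state under the policy `π_θ`. -/
def stateKernel (M : CMDP S Z A K) (π : Policy S Z A n) (θ : Euc n) :
    Kernel (AugState S Z) (AugState S Z) :=
  (M.stepKernel π θ).snd

instance (M : CMDP S Z A K) (π : Policy S Z A n) (θ : Euc n) :
    IsMarkovKernel (M.stateKernel π θ) := by
  unfold stateKernel
  infer_instance

/-- The `t`-step transition kernel under the policy `π_θ`. -/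
def iterKernel (M : CMDP S Z A K) (π : Policy S Z A n) (θ : Euc n) :
    ℕ → Kernel (AugState S Z) (AugState S Z)
  | 0 => Kernel.id
  | t + 1 => (M.stateKernel π θ) ∘ₖ (iterKernel M π θ t)

instance (M : CMDP S Z A K) (π : Policy S Z A n) (θ : Euc n) (t : ℕ) :
    IsMarkovKernel (M.iterKernel π θ t) := by
  induction t with
  | zero => unfold iterKernel; infer_instance
  | succ t ih => unfold iterKernel; infer_instance

/-- Expected reshaped cost of one step from the augmented state `x` under `π_θ`. -/
def meanCost (M : CMDP S Z A K) (π : Policy S Z A n) (θ : Euc n) (k : Fin (K + 1))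
    (x : AugState S Z) : ℝ :=
  ∫ p, M.reshapedCost k x p.1 p.2 ∂(M.stepKernel π θ x)

/-- The reshaped objective (`k = 0`) and constraint (`k ≥ 1`) functions: the long-run average
`lim_{T → ∞} (1/T) 𝔼 ∑_{t < T} Ċ'ₖ(xₜ, aₜ, xₜ₊₁)` under the fixed policy `π_θ`. -/
def objective (M : CMDP S Z A K) (π : Policy S Z A n) (k : Fin (K + 1)) (θ : Euc n) : ℝ :=
  limUnder atTop fun T : ℕ =>
    (1 / (T : ℝ)) * ∑ t ∈ Finset.range T,
      ∫ x, M.meanCost π θ k x ∂(M.init.bind (M.iterKernel π θ t))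

/-- The gradient of the reshaped function `k`, taken within the parameter set `Θ`. -/
def gradObjective (M : CMDP S Z A K) (π : Policy S Z A n) (Θ : Set (Euc n)) (k : Fin (K + 1))
    (θ : Euc n) : Euc n :=
  gradientWithin (M.objective π k) Θ θ

/-- `𝔼[Ċ'ₖ(x_l, a_l, x_{l+1}) | x₀ = x, a₀ = a]` under the policy `π_θ`. -/
def expCost (M : CMDP S Z A K) (π : Policy S Z A n) (θ : Euc n) (k : Fin (K + 1)) (l : ℕ)
    (x : AugState S Z) (a : ↥A) : ℝ :=
  match l with
  | 0 => ∫ x', M.reshapedCost k x a x' ∂(M.augTrans (x, a))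
  | l + 1 => ∫ y, M.meanCost π θ k y ∂((M.iterKernel π θ l ∘ₖ M.augTrans) (x, a))

/-- The surrogate Q-function `𝔼[∑_{l < T} (Ċ'ₖ(x_l, a_l, x_{l+1}) - y) | x₀ = x, a₀ = a]` under
`π_θ`, where the estimate `y` replaces the long-run average. -/
def surrogateQ (M : CMDP S Z A K) (π : Policy S Z A n) (θ : Euc n) (k : Fin (K + 1)) (y : ℝ)
    (T : ℕ) (x : AugState S Z) (a : ↥A) : ℝ :=
  ∑ l ∈ Finset.range T, (M.expCost π θ k l x a - y)

end CMDP

/-- Assumptions on the problem structure; `lam` and `ρ` are the constants of the uniform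
geometric ergodicity. -/
structure ProblemAssumptions (M : CMDP S Z A K) (π : Policy S Z A n) (Θ : Set (Euc n))
    (lam ρ : ℝ) : Prop where
  compact_S : IsCompact S
  compact_Z : IsCompact Z
  compact_A : IsCompact A
  cost_bounded : ∃ c : ℝ, ∀ k x a x', |M.reshapedCost k x a x'| ≤ c
  compact_Θ : IsCompact Θ
  convex_Θ : Convex ℝ Θ
  /-- Gradients with respect to `θ ∈ Θ` are well defined. -/
  interior_Θ : (interior Θ).Nonempty
  policy_differentiable : ∀ x a, DifferentiableOn ℝ (fun θ => Real.log (π.dens θ x a)) Θ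
  policy_lipschitz : ∃ L : ℝ≥0, ∀ x a, LipschitzOnWith L (fun θ => Real.log (π.dens θ x a)) Θ
  score_lipschitz : ∃ L : ℝ≥0, ∀ x a, LipschitzOnWith L (fun θ => π.score Θ θ x a) Θ
  score_measurable :
    Measurable fun p : Euc n × AugState S Z × ↥A => π.score Θ p.1 p.2.1 p.2.2
  objective_differentiable : ∀ k, DifferentiableOn ℝ (M.objective π k) Θ
  gradient_bounded : ∃ c : ℝ, ∀ k, ∀ θ ∈ Θ, ‖M.gradObjective π Θ k θ‖ ≤ c
  gradient_lipschitz : ∃ L : ℝ≥0, ∀ k, LipschitzOnWith L (M.gradObjective π Θ k) Θ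
  lam_pos : 0 < lam
  ρ_pos : 0 < ρ
  ρ_lt_one : ρ < 1
  /-- Uniform ergodicity: the stationary law under `π_θ` is approached geometrically. -/
  ergodic : ∀ θ ∈ Θ, ∃ m : ProbabilityMeasure (AugState S Z),
    Kernel.Invariant (M.stateKernel π θ) (m : Measure (AugState S Z)) ∧
      ∀ x t, tvDist (M.iterKernel π θ t x) (m : Measure (AugState S Z)) ≤ lam * ρ ^ t

/-- Assumptions on the step sizes of the policy (`μ`) and of the estimates (`η`). -/
structure StepSizes (μ η : ℕ → ℝ) : Prop where
  μ_pos : ∀ i, 0 < μ i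
  μ_le_one : ∀ i, μ i ≤ 1
  η_pos : ∀ i, 0 < η i
  μ_antitone : Antitone μ
  η_antitone : Antitone η
  μ_tendsto : Tendsto μ atTop (𝓝 0)
  μ_sum : Tendsto (fun N => ∑ i ∈ Finset.range N, μ i) atTop atTop
  μ_sq : Summable fun i => μ i ^ 2
  η_tendsto : Tendsto η atTop (𝓝 0)
  η_inv : ∃ r : ℝ, 0 < r ∧ r < 1 ∧
    (fun i : ℕ => 1 / η i) =O[atTop] (fun i : ℕ => (i : ℝ) ^ r)
  η_sq : Summable fun i => η i ^ 2
  ratio : Tendsto (fun i => μ i / η i) atTop (𝓝 0)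

/-- A run of the actor-critic recursion on a probability space. Iteration `i` uses the `B` time
slots `B i, …, B i + B - 1`, in which actions are drawn from `π_{θᵢ}`. `𝓕 t` is the information
available just before the action of slot `t` is drawn. `Qnet k w` is the Q-network with weights
`w`; the weights `w k i` and the actor's target `θbar i` are arbitrary functions of the information
available after iteration `i`. -/
structure Run (M : CMDP S Z A K) (π : Policy S Z A n) (Θ : Set (Euc n)) {q : ℕ}
    (Qnet : Fin (K + 1) → Euc q → AugState S Z → ↥A → ℝ) (μ η : ℕ → ℝ) (B : ℕ)
    {Ω : Type*} [mΩ : MeasurableSpace Ω] (P : Measure Ω) where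
  𝓕 : Filtration ℕ mΩ
  /-- Augmented states. -/
  s : ℕ → Ω → AugState S Z
  /-- Actions. -/
  a : ℕ → Ω → ↥A
  /-- Policy parameters. -/
  θ : ℕ → Ω → Euc n
  θbar : ℕ → Ω → Euc n
  /-- Q-network weights. -/
  w : Fin (K + 1) → ℕ → Ω → Euc q
  /-- Estimates of the function values. -/
  fhat : Fin (K + 1) → ℕ → Ω → ℝ
  /-- Estimates of the gradients. -/
  ghat : Fin (K + 1) → ℕ → Ω → Euc n
  s_measurable : ∀ t, Measurable[𝓕 t] (s t)
  a_measurable : ∀ t, Measurable[𝓕 (t + 1)] (a t)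
  s_init : P.map (s 0) = M.init
  /-- Given the past, the action is drawn from the current policy and the next augmented state
  from the transition function. -/
  law : ∀ (t : ℕ) (U : Set (↥A × AugState S Z)), MeasurableSet U →
    P[((fun ω => (a t ω, s (t + 1) ω)) ⁻¹' U).indicator (fun _ => (1 : ℝ)) | 𝓕 t]
      =ᵐ[P] fun ω => (M.stepKernel π (θ (t / B) ω) (s t ω)).real U
  θ_init_measurable : Measurable[𝓕 0] (θ 0)
  θ_init_mem : ∀ ω, θ 0 ω ∈ Θ
  θbar_measurable : ∀ i, Measurable[𝓕 (B * (i + 1))] (θbar i)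
  θbar_mem : ∀ i ω, θbar i ω ∈ Θ
  w_measurable : ∀ k i, Measurable[𝓕 (B * (i + 1))] (w k i)
  fhat_init_measurable : ∀ k, Measurable[𝓕 0] (fhat k 0)
  ghat_init_measurable : ∀ k, Measurable[𝓕 0] (ghat k 0)
  θ_succ : ∀ i ω, θ (i + 1) ω = (1 - μ i) • θ i ω + μ i • θbar i ω
  /-- `f̂ᵢ₊₁ = (1 - ηᵢ₊₁) f̂ᵢ + ηᵢ f̃ᵢ` with `f̃ᵢ` the batch average of the reshaped costs. -/
  fhat_succ : ∀ k i ω, fhat k (i + 1) ω =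
    (1 - η (i + 1)) * fhat k i ω + η i * ((1 / (B : ℝ)) * ∑ j ∈ Finset.range B,
      M.reshapedCost k (s (B * i + j) ω) (a (B * i + j) ω) (s (B * i + j + 1) ω))
  /-- `ĝᵢ₊₁ = (1 - ηᵢ₊₁) ĝᵢ + ηᵢ g̃ᵢ` with `g̃ᵢ` the batch average of the Q-network output times
  the score. -/
  ghat_succ : ∀ k i ω, ghat k (i + 1) ω =
    (1 - η (i + 1)) • ghat k i ω + η i • ((1 / (B : ℝ)) • ∑ j ∈ Finset.range B,
      Qnet k (w k i ω) (s (B * i + j) ω) (a (B * i + j) ω) •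
        π.score Θ (θ i ω) (s (B * i + j) ω) (a (B * i + j) ω))

namespace Run

variable {M : CMDP S Z A K} {π : Policy S Z A n} {Θ : Set (Euc n)} {q : ℕ}
  {Qnet : Fin (K + 1) → Euc q → AugState S Z → ↥A → ℝ} {μ η : ℕ → ℝ} {B : ℕ}
  {Ω : Type*} [mΩ : MeasurableSpace Ω] {P : Measure Ω}

/-- The initial estimates and the outputs of the Q-networks along the run are bounded by `b`. -/
structure BoundedBy (R : Run M π Θ Qnet μ η B P) (b : ℝ) : Prop where
  fhat_init : ∀ k ω, |R.fhat k 0 ω| ≤ b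
  ghat_init : ∀ k ω, ‖R.ghat k 0 ω‖ ≤ b
  critic : ∀ k i ω x a, |Qnet k (R.w k i ω) x a| ≤ b

/-- Squared error of the value estimate at iteration `i`. -/
def sqErrF (R : Run M π Θ Qnet μ η B P) (k : Fin (K + 1)) (i : ℕ) (ω : Ω) : ℝ :=
  (R.fhat k i ω - M.objective π k (R.θ i ω)) ^ 2

/-- Squared error of the gradient estimate at iteration `i`. -/
def sqErrG (R : Run M π Θ Qnet μ η B P) (k : Fin (K + 1)) (i : ℕ) (ω : Ω) : ℝ :=
  ‖R.ghat k i ω - M.gradObjective π Θ k (R.θ i ω)‖ ^ 2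

/-- `ε_f(i)`. -/
def epsF (R : Run M π Θ Qnet μ η B P) (k : Fin (K + 1)) (i : ℕ) : ℝ :=
  (1 / (1 + (i : ℝ))) * ∑ j ∈ Finset.range (i + 1), ∫ ω, R.sqErrF k j ω ∂P

/-- `ε_g(i)`. -/
def epsG (R : Run M π Θ Qnet μ η B P) (k : Fin (K + 1)) (i : ℕ) : ℝ :=
  (1 / (1 + (i : ℝ))) * ∑ j ∈ Finset.range (i + 1), ∫ ω, R.sqErrG k j ω ∂P

/-- Expectation of the largest gap, over all augmented states and actions, between the Q-network
and the surrogate Q-function (with horizon `T`) at iteration `i`. -/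
def criticErr (R : Run M π Θ Qnet μ η B P) (k : Fin (K + 1)) (T : ℕ) (i : ℕ) : ℝ≥0∞ :=
  ∫⁻ ω, ⨆ (x : AugState S Z) (a : ↥A), ENNReal.ofReal
    |Qnet k (R.w k i ω) x a - M.surrogateQ π (R.θ i ω) k (R.fhat k i ω) T x a| ∂P

/-- Average over the iterations `0, …, i` of the error of the Q-networks. -/
def epsQ (R : Run M π Θ Qnet μ η B P) (k : Fin (K + 1)) (T : ℕ → ℕ) (i : ℕ) : ℝ :=
  (1 / (1 + (i : ℝ))) * ∑ j ∈ Finset.range (i + 1), (R.criticErr k (T j) j).toReal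

end Run

end CACRL

end

/-
Geometric ergodicity yields, for every frozen policy, a solution of the Poisson equation which is
bounded and Lipschitz in the policy parameter. Along the run it turns the bias of a batch average
into a martingale difference plus a telescoping difference, whose mismatch is of the order of the
parameter drift `μ`. Each tracking error thus obeys a linear recursion with contraction `1 - η` and
source terms whose average is controlled by a single sum of step-size expressions.

For the gradients the target is written through the policy gradient theorem. Replacing the action
value by the surrogate costs only the truncation error `ρ ^ T`, since subtracting any function of
the state known before the action is drawn leaves the conditional mean of the score term unchanged.
-/

noncomputable section

namespace CACRL

section BoundedMeasurable

variable {X Y E : Type*} [MeasurableSpace X] [MeasurableSpace Y] [NormedAddCommGroup E]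

/-- Strongly measurable functions bounded in norm by `C`: the test functions of the whole argument.
The constant is part of the notion because every estimate has to be uniform over all runs. -/
structure BddMeas (φ : X → E) (C : ℝ) : Prop where
  meas : StronglyMeasurable φ
  bound : ∀ x, ‖φ x‖ ≤ C

namespace BddMeas

variable {φ ψ : X → E} {C D : ℝ}

theorem integrable (h : BddMeas φ C) (ν : Measure X) [IsFiniteMeasure ν] : Integrable φ ν :=
  Integrable.of_bound h.meas.aestronglyMeasurable C (ae_of_all _ h.bound)

theorem mono (h : BddMeas φ C) (hCD : C ≤ D) : BddMeas φ D :=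
  ⟨h.meas, fun x => (h.bound x).trans hCD⟩

theorem add (h : BddMeas φ C) (h' : BddMeas ψ D) : BddMeas (fun x => φ x + ψ x) (C + D) :=
  ⟨h.meas.add h'.meas, fun x => (norm_add_le _ _).trans (add_le_add (h.bound x) (h'.bound x))⟩

theorem sub (h : BddMeas φ C) (h' : BddMeas ψ D) : BddMeas (fun x => φ x - ψ x) (C + D) :=
  ⟨h.meas.sub h'.meas, fun x => (norm_sub_le _ _).trans (add_le_add (h.bound x) (h'.bound x))⟩

theorem const (v : E) : BddMeas (fun _ : X => v) ‖v‖ :=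
  ⟨stronglyMeasurable_const, fun _ => le_rfl⟩

theorem comp (h : BddMeas φ C) {g : Y → X} (hg : Measurable g) : BddMeas (fun y => φ (g y)) C :=
  ⟨h.meas.comp_measurable hg, fun y => h.bound (g y)⟩

variable [NormedSpace ℝ E]

theorem smul {c : X → ℝ} (hc : BddMeas c D) (h : BddMeas φ C) :
    BddMeas (fun x => c x • φ x) (D * C) where
  meas := hc.meas.smul h.meas
  bound x := by
    rw [norm_smul]
    exact mul_le_mul (hc.bound x) (h.bound x) (norm_nonneg _) ((norm_nonneg _).trans (hc.bound x))

theorem inner {F : Type*} [NormedAddCommGroup F] [InnerProductSpace ℝ F] {φ ψ : X → F}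
    (h : BddMeas φ C) (h' : BddMeas ψ D) :
    BddMeas (fun x => (Inner.inner ℝ (φ x) (ψ x) : ℝ)) (C * D) :=
  ⟨h.meas.inner h'.meas, fun x => (norm_inner_le_norm _ _).trans
    (mul_le_mul (h.bound x) (h'.bound x) (norm_nonneg _) ((norm_nonneg _).trans (h.bound x)))⟩

theorem norm_integral_le_mul (h : BddMeas φ C) (ν : Measure X) [IsFiniteMeasure ν] :
    ‖∫ x, φ x ∂ν‖ ≤ C * ν.real Set.univ :=
  norm_integral_le_of_norm_le_const (ae_of_all _ h.bound)

theorem norm_integral_le (h : BddMeas φ C) (ν : Measure X) [IsProbabilityMeasure ν] :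
    ‖∫ x, φ x ∂ν‖ ≤ C := by
  simpa using h.norm_integral_le_mul ν

theorem integral_sub_const [CompleteSpace E] (h : BddMeas φ C) (c : E) (ν : Measure X)
    [IsProbabilityMeasure ν] : ∫ x, (φ x - c) ∂ν = ∫ x, φ x ∂ν - c := by
  rw [integral_sub (h.integrable ν) (integrable_const c), integral_const, probReal_univ, one_smul]

theorem kernel (h : BddMeas φ C) (κ : Kernel Y X) [IsMarkovKernel κ] :
    BddMeas (fun y => ∫ x, φ x ∂(κ y)) C :=
  ⟨h.meas.integral_kernel, fun y => h.norm_integral_le (κ y)⟩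

theorem integral_bind (h : BddMeas φ C) (ν : Measure Y) [IsFiniteMeasure ν]
    (κ : Kernel Y X) [IsMarkovKernel κ] :
    ∫ x, φ x ∂(ν.bind κ) = ∫ y, ∫ x, φ x ∂(κ y) ∂ν := by
  simpa only [Kernel.comp_const, Kernel.const_apply] using
    Kernel.integral_comp (η := κ) (κ := Kernel.const Unit ν) (a := ()) (h.integrable _)

end BddMeas

end BoundedMeasurable

section TotalVariation

variable {X E : Type*} [MeasurableSpace X] [NormedAddCommGroup E] [NormedSpace ℝ E]
  (α β : Measure X) [IsFiniteMeasure α] [IsFiniteMeasure β]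

theorem exists_mutuallySingular_tvDist_eq : ∃ p q : Measure X, IsFiniteMeasure p ∧
    IsFiniteMeasure q ∧ p ⟂ₘ q ∧ α + q = β + p ∧
      tvDist α β = p.real Set.univ + q.real Set.univ := by
  set j := (α.toSignedMeasure - β.toSignedMeasure).toJordanDecomposition with hj
  refine ⟨j.posPart, j.negPart, inferInstance, inferInstance, j.mutuallySingular, ?_, ?_⟩
  · have hdecomp : j.posPart.toSignedMeasure - j.negPart.toSignedMeasure =
        α.toSignedMeasure - β.toSignedMeasure :=
      SignedMeasure.toSignedMeasure_toJordanDecomposition _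
    rw [← Measure.toSignedMeasure_eq_toSignedMeasure_iff, Measure.toSignedMeasure_add,
      Measure.toSignedMeasure_add, add_comm β.toSignedMeasure]
    exact (sub_eq_sub_iff_add_eq_add.1 hdecomp).symm
  · rw [tvDist, SignedMeasure.totalVariation, ← hj, ← measureReal_def, measureReal_add_apply]

variable {α β} in
theorem BddMeas.integral_sub_integral_eq {φ : X → E} {C : ℝ} (h : BddMeas φ C) {p q : Measure X}
    [IsFiniteMeasure p] [IsFiniteMeasure q] (hsum : α + q = β + p) :
    ∫ x, φ x ∂α - ∫ x, φ x ∂β = ∫ x, φ x ∂p - ∫ x, φ x ∂q := by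
  rw [sub_eq_sub_iff_add_eq_add, ← integral_add_measure (h.integrable α) (h.integrable q),
    hsum, integral_add_measure (h.integrable β) (h.integrable p), add_comm]

theorem BddMeas.norm_integral_sub_le_tvDist {φ : X → E} {C : ℝ} (h : BddMeas φ C) :
    ‖∫ x, φ x ∂α - ∫ x, φ x ∂β‖ ≤ C * tvDist α β := by
  obtain ⟨p, q, _, _, -, hsum, htv⟩ := exists_mutuallySingular_tvDist_eq α β
  rw [h.integral_sub_integral_eq hsum, htv, mul_add]
  exact (norm_sub_le _ _).trans (add_le_add (h.norm_integral_le_mul p) (h.norm_integral_le_mul q))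

variable {α β} in
theorem tvDist_le_of_forall_abs_integral_sub_le {c : ℝ}
    (hc : ∀ ψ : X → ℝ, BddMeas ψ 1 → |∫ x, ψ x ∂α - ∫ x, ψ x ∂β| ≤ c) : tvDist α β ≤ c := by
  classical
  obtain ⟨p, q, _, _, ⟨U, hU, hpU, hqU⟩, hsum, htv⟩ := exists_mutuallySingular_tvDist_eq α β
  let ψ : X → ℝ := U.piecewise (fun _ => -1) (fun _ => 1)
  have hψ : BddMeas ψ 1 :=
    ⟨stronglyMeasurable_const.piecewise hU stronglyMeasurable_const, fun x => by
      by_cases hx : x ∈ U <;> simp [ψ, hx]⟩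
  have hψp : ∫ x, ψ x ∂p = p.real Set.univ := by
    have : ψ =ᵐ[p] fun _ => 1 := by
      filter_upwards [measure_eq_zero_iff_ae_notMem.1 hpU] with x hx using
        Set.piecewise_eq_of_notMem _ _ _ hx
    simp [integral_congr_ae this]
  have hψq : ∫ x, ψ x ∂q = -q.real Set.univ := by
    have : ψ =ᵐ[q] fun _ => -1 := by
      filter_upwards [measure_eq_zero_iff_ae_notMem.1 hqU] with x hx using
        Set.piecewise_eq_of_mem _ _ _ (not_not.1 hx)
    simp [integral_congr_ae this]
  have hbound := hc ψ hψ
  rw [hψ.integral_sub_integral_eq hsum, hψp, hψq, sub_neg_eq_add, ← htv] at hbound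
  exact (le_abs_self _).trans hbound

end TotalVariation

section Poisson

variable {X E : Type*} [MeasurableSpace X] [NormedAddCommGroup E] [NormedSpace ℝ E]

instance (κ : Kernel X X) [IsMarkovKernel κ] (t : ℕ) : IsMarkovKernel (κ ^ t) := by
  induction t with
  | zero => exact inferInstanceAs (IsMarkovKernel Kernel.id)
  | succ t ih => rw [pow_succ]; exact inferInstanceAs (IsMarkovKernel ((κ ^ t) ∘ₖ κ))

/-- A kernel that converges geometrically fast in total variation, uniformly in the initial state,
to its invariant law `m`. -/
structure GeomErgodic (κ : Kernel X X) [IsMarkovKernel κ] (m : Measure X) [IsProbabilityMeasure m]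
    (D ρ : ℝ) : Prop where
  invariant : κ.Invariant m
  mix : ∀ x t, tvDist ((κ ^ t) x) m ≤ D * ρ ^ t
  ρ_nonneg : 0 ≤ ρ
  ρ_lt_one : ρ < 1

/-- The solution `∑ₜ (κᵗ φ - m φ)` of Poisson's equation `u - κ u = φ - m φ`. -/
def poisson (κ : Kernel X X) (m : Measure X) (φ : X → E) (x : X) : E :=
  ∑' t, (∫ y, φ y ∂((κ ^ t) x) - ∫ y, φ y ∂m)

namespace BddMeas

variable {φ : X → E} {C : ℝ} (h : BddMeas φ C)
include h

theorem integral_pow_add (κ : Kernel X X) [IsMarkovKernel κ] (s t : ℕ) (x : X) :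
    ∫ y, φ y ∂((κ ^ (s + t)) x) = ∫ z, ∫ y, φ y ∂((κ ^ s) z) ∂((κ ^ t) x) := by
  rw [pow_add, show κ ^ s * κ ^ t = (κ ^ s) ∘ₖ (κ ^ t) from rfl,
    Kernel.integral_comp (h.integrable _)]

variable [CompleteSpace E]

theorem integral_pow_zero (κ : Kernel X X) (x : X) : ∫ y, φ y ∂((κ ^ 0) x) = φ x := by
  rw [pow_zero, show (1 : Kernel X X) = Kernel.id from rfl, Kernel.id_apply,
    integral_dirac' _ _ h.meas]

variable (κ : Kernel X X) [IsMarkovKernel κ]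

theorem sum_integral_pow_sub (N : ℕ) (x : X) :
    ∑ t ∈ Finset.range N, ∫ z, (φ z - ∫ y, φ y ∂(κ z)) ∂((κ ^ t) x) =
      φ x - ∫ y, φ y ∂((κ ^ N) x) := by
  have hterm (t : ℕ) : ∫ z, (φ z - ∫ y, φ y ∂(κ z)) ∂((κ ^ t) x) =
      ∫ y, φ y ∂((κ ^ t) x) - ∫ y, φ y ∂((κ ^ (t + 1)) x) := by
    rw [integral_sub (h.integrable _) ((h.kernel κ).integrable _), add_comm t 1,
      h.integral_pow_add, pow_one]
  simp only [hterm]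
  rw [Finset.sum_range_sub', h.integral_pow_zero]

end BddMeas

namespace GeomErgodic

variable {κ κ' : Kernel X X} [IsMarkovKernel κ] [IsMarkovKernel κ'] {m m' : Measure X}
  [IsProbabilityMeasure m] [IsProbabilityMeasure m'] {D D' ρ ρ' : ℝ}

theorem norm_integral_pow_sub_le (g : GeomErgodic κ m D ρ) {φ : X → E} {C : ℝ} (h : BddMeas φ C)
    (x : X) (t : ℕ) : ‖∫ y, φ y ∂((κ ^ t) x) - ∫ y, φ y ∂m‖ ≤ C * D * ρ ^ t := by
  have hC : 0 ≤ C := (norm_nonneg _).trans (h.bound x)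
  rw [mul_assoc]
  exact (h.norm_integral_sub_le_tvDist _ _).trans (mul_le_mul_of_nonneg_left (g.mix x t) hC)

theorem hasSum_mul_pow (g : GeomErgodic κ m D ρ) (C : ℝ) :
    HasSum (fun t : ℕ => C * D * ρ ^ t) (C * D / (1 - ρ)) := by
  rw [div_eq_mul_inv]
  exact (hasSum_geometric_of_lt_one g.ρ_nonneg g.ρ_lt_one).mul_left _

theorem tendsto_integral_pow (g : GeomErgodic κ m D ρ) {φ : X → E} {C : ℝ} (h : BddMeas φ C)
    (x : X) : Tendsto (fun t => ∫ y, φ y ∂((κ ^ t) x)) atTop (𝓝 (∫ y, φ y ∂m)) :=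
  tendsto_iff_norm_sub_tendsto_zero.2 <|
    squeeze_zero (fun _ => norm_nonneg _) (g.norm_integral_pow_sub_le h x)
      (g.hasSum_mul_pow C).summable.tendsto_atTop_zero

theorem integral_integral (g : GeomErgodic κ m D ρ) {φ : X → E} {C : ℝ}
    (h : BddMeas φ C) : ∫ x, ∫ y, φ y ∂(κ x) ∂m = ∫ x, φ x ∂m := by
  rw [← h.integral_bind, g.invariant.def]

variable [CompleteSpace E] {φ : X → E} {C : ℝ}

theorem tendsto_integral_bind_pow (g : GeomErgodic κ m D ρ) (h : BddMeas φ C) (ν : Measure X)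
    [IsProbabilityMeasure ν] :
    Tendsto (fun t : ℕ => ∫ y, φ y ∂(ν.bind (κ ^ t))) atTop (𝓝 (∫ y, φ y ∂m)) := by
  simp only [h.integral_bind]
  simpa using tendsto_integral_of_dominated_convergence (μ := ν) (fun _ => C)
    (fun t => (h.kernel (κ ^ t)).meas.aestronglyMeasurable) (integrable_const C)
    (fun t => ae_of_all _ fun x => (h.kernel (κ ^ t)).bound x)
    (ae_of_all _ fun x => g.tendsto_integral_pow h x)

theorem summable_integral_pow_sub (g : GeomErgodic κ m D ρ) (h : BddMeas φ C) (x : X) :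
    Summable fun t => ∫ y, φ y ∂((κ ^ t) x) - ∫ y, φ y ∂m :=
  .of_norm_bounded (g.hasSum_mul_pow C).summable (g.norm_integral_pow_sub_le h x)

theorem tendsto_sum_poisson (g : GeomErgodic κ m D ρ) (h : BddMeas φ C) (x : X) :
    Tendsto (fun N => ∑ t ∈ Finset.range N, (∫ y, φ y ∂((κ ^ t) x) - ∫ y, φ y ∂m)) atTop
      (𝓝 (poisson κ m φ x)) :=
  (g.summable_integral_pow_sub h x).hasSum.tendsto_sum_nat

theorem bddMeas_poisson (g : GeomErgodic κ m D ρ) (h : BddMeas φ C) :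
    BddMeas (poisson κ m φ) (C * D / (1 - ρ)) where
  meas := stronglyMeasurable_of_tendsto (u := atTop)
    (fun _ => Finset.stronglyMeasurable_fun_sum _ fun t _ =>
      (h.kernel (κ ^ t)).meas.sub stronglyMeasurable_const)
    (tendsto_pi_nhds.2 (g.tendsto_sum_poisson h))
  bound x := tsum_of_norm_bounded (g.hasSum_mul_pow C) (g.norm_integral_pow_sub_le h x)

theorem integral_poisson_kernel (g : GeomErgodic κ m D ρ) (h : BddMeas φ C) (x : X) :
    ∫ y, poisson κ m φ y ∂(κ x) = ∑' t, (∫ y, φ y ∂((κ ^ (t + 1)) x) - ∫ y, φ y ∂m) := by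
  have hbdd (t : ℕ) : BddMeas (fun z => ∫ y, φ y ∂((κ ^ t) z) - ∫ y, φ y ∂m) (C * D * ρ ^ t) :=
    ⟨(h.kernel _).meas.sub stronglyMeasurable_const, fun z => g.norm_integral_pow_sub_le h z t⟩
  have hnorm (t : ℕ) : ‖∫ z, ‖∫ y, φ y ∂((κ ^ t) z) - ∫ y, φ y ∂m‖ ∂(κ x)‖ ≤ C * D * ρ ^ t :=
    BddMeas.norm_integral_le ⟨(hbdd t).meas.norm, fun z => by
      rw [norm_norm]; exact (hbdd t).bound z⟩ _
  unfold poisson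
  rw [← integral_tsum_of_summable_integral_norm (fun t => (hbdd t).integrable _)
    (.of_norm_bounded (g.hasSum_mul_pow C).summable hnorm)]
  refine tsum_congr fun t => ?_
  rw [(h.kernel _).integral_sub_const, h.integral_pow_add, pow_one]

theorem poisson_sub (g : GeomErgodic κ m D ρ) (h : BddMeas φ C) (x : X) :
    poisson κ m φ x - ∫ y, poisson κ m φ y ∂(κ x) = φ x - ∫ y, φ y ∂m := by
  rw [g.integral_poisson_kernel h, poisson, (g.summable_integral_pow_sub h x).tsum_eq_zero_add,
    h.integral_pow_zero, add_sub_cancel_right]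

theorem poisson_sub_integral_pow (g : GeomErgodic κ m D ρ) (h : BddMeas φ C) (x : X) (N : ℕ) :
    poisson κ m φ x - ∫ y, poisson κ m φ y ∂((κ ^ N) x) =
      ∑ t ∈ Finset.range N, (∫ y, φ y ∂((κ ^ t) x) - ∫ y, φ y ∂m) := by
  rw [← (g.bddMeas_poisson h).sum_integral_pow_sub]
  refine Finset.sum_congr rfl fun t _ => ?_
  simp only [g.poisson_sub h]
  rw [h.integral_sub_const]

theorem poisson_sub_integral_kernel (g : GeomErgodic κ m D ρ) (h : BddMeas φ C) (x : X) :
    poisson κ m (fun z => φ z - ∫ y, φ y ∂(κ z)) x = φ x - ∫ y, φ y ∂m := by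
  have hmean : ∫ z, (φ z - ∫ y, φ y ∂(κ z)) ∂m = 0 := by
    rw [integral_sub (h.integrable _) ((h.kernel κ).integrable _), g.integral_integral h, sub_self]
  have hsum := g.tendsto_sum_poisson (h.sub (h.kernel κ)) x
  simp only [hmean, sub_zero, h.sum_integral_pow_sub] at hsum
  exact tendsto_nhds_unique hsum ((g.tendsto_integral_pow h x).const_sub _)

theorem poisson_sub_const (h : BddMeas φ C) (c : E) (x : X) :
    poisson κ m (fun z => φ z - c) x = poisson κ m φ x := by
  refine tsum_congr fun t => ?_
  simp only [h.integral_sub_const, sub_sub_sub_cancel_right]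

theorem integral_poisson (g : GeomErgodic κ m D ρ) (h : BddMeas φ C) :
    ∫ x, poisson κ m φ x ∂m = 0 := by
  obtain ⟨x⟩ := nonempty_of_isProbabilityMeasure m
  have hinv := g.poisson_sub_integral_kernel (g.bddMeas_poisson h) x
  simp only [g.poisson_sub h] at hinv
  rwa [poisson_sub_const h, eq_comm, sub_eq_self] at hinv

theorem norm_integral_pow_poisson_le (g : GeomErgodic κ m D ρ) (h : BddMeas φ C) (x : X) (t : ℕ) :
    ‖∫ y, poisson κ m φ y ∂((κ ^ t) x)‖ ≤ C * D / (1 - ρ) * D * ρ ^ t := by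
  simpa only [g.integral_poisson h, sub_zero] using
    g.norm_integral_pow_sub_le (g.bddMeas_poisson h) x t

theorem norm_sub_integral_le_of_nearly_harmonic (g : GeomErgodic κ m D ρ) (h : BddMeas φ C) {δ : ℝ}
    (hδ : ∀ x, ‖φ x - ∫ y, φ y ∂(κ x)‖ ≤ δ) (x : X) :
    ‖φ x - ∫ y, φ y ∂m‖ ≤ δ * D / (1 - ρ) := by
  rw [← g.poisson_sub_integral_kernel h]
  exact (g.bddMeas_poisson ⟨h.meas.sub (h.kernel κ).meas, hδ⟩).bound x

theorem integral_sub_integral_eq (g : GeomErgodic κ m D ρ) (g' : GeomErgodic κ' m' D' ρ')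
    (h : BddMeas φ C) :
    ∫ x, φ x ∂m' - ∫ x, φ x ∂m =
      ∫ x, (∫ y, poisson κ m φ y ∂(κ' x) - ∫ y, poisson κ m φ y ∂(κ x)) ∂m' := by
  have hu := g.bddMeas_poisson h
  have hpoisson : ∫ x, (poisson κ m φ x - ∫ y, poisson κ m φ y ∂(κ x)) ∂m' =
      ∫ x, φ x ∂m' - ∫ x, φ x ∂m := by
    simp only [g.poisson_sub h]
    rw [h.integral_sub_const]
  rw [← hpoisson, integral_sub (hu.integrable _) ((hu.kernel κ).integrable _),
    integral_sub ((hu.kernel κ').integrable _) ((hu.kernel κ).integrable _),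
    g'.integral_integral hu]

variable {φ' : X → E} {δ δ' : ℝ}

theorem norm_integral_sub_le (g : GeomErgodic κ m D ρ) (g' : GeomErgodic κ' m' D' ρ')
    (hδ : ∀ x, tvDist (κ' x) (κ x) ≤ δ) (h : BddMeas φ C) :
    ‖∫ x, φ x ∂m' - ∫ x, φ x ∂m‖ ≤ C * D / (1 - ρ) * δ := by
  obtain ⟨x⟩ := nonempty_of_isProbabilityMeasure m
  have hu := g.bddMeas_poisson h
  have hC := (norm_nonneg _).trans (hu.bound x)
  rw [g.integral_sub_integral_eq g' h]
  exact BddMeas.norm_integral_le ⟨(hu.kernel κ').meas.sub (hu.kernel κ).meas, fun x =>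
    (hu.norm_integral_sub_le_tvDist _ _).trans (mul_le_mul_of_nonneg_left (hδ x) hC)⟩ _

theorem norm_mean_sub_le (g : GeomErgodic κ m D ρ) (g' : GeomErgodic κ' m' D' ρ')
    (hδ : ∀ x, tvDist (κ' x) (κ x) ≤ δ) (h : BddMeas φ C) (h' : BddMeas φ' C)
    (hφ : ∀ x, ‖φ' x - φ x‖ ≤ δ') :
    ‖∫ x, φ' x ∂m' - ∫ x, φ x ∂m‖ ≤ δ' + C * D / (1 - ρ) * δ := by
  rw [← sub_add_sub_cancel _ (∫ x, φ x ∂m'), ← integral_sub (h'.integrable _) (h.integrable _)]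
  exact norm_add_le_of_le (BddMeas.norm_integral_le ⟨h'.meas.sub h.meas, hφ⟩ m')
    (g.norm_integral_sub_le g' hδ h)

theorem norm_poisson_sub_sub_integral_le (g : GeomErgodic κ m D ρ) (g' : GeomErgodic κ' m' D' ρ')
    (hδ : ∀ x, tvDist (κ' x) (κ x) ≤ δ) (h : BddMeas φ C) (h' : BddMeas φ' C)
    (hφ : ∀ x, ‖φ' x - φ x‖ ≤ δ') (x : X) :
    ‖(poisson κ' m' φ' x - poisson κ m φ x) -
        ∫ y, (poisson κ' m' φ' y - poisson κ m φ y) ∂(κ' x)‖ ≤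
      2 * δ' + 2 * (C * D / (1 - ρ)) * δ := by
  have hu := g.bddMeas_poisson h
  have hu' := g'.bddMeas_poisson h'
  have hdecomp : (poisson κ' m' φ' x - poisson κ m φ x) -
      ∫ y, (poisson κ' m' φ' y - poisson κ m φ y) ∂(κ' x) =
      (φ' x - φ x) - (∫ y, φ' y ∂m' - ∫ y, φ y ∂m) +
        (∫ y, poisson κ m φ y ∂(κ' x) - ∫ y, poisson κ m φ y ∂(κ x)) := by
    rw [integral_sub (hu'.integrable _) (hu.integrable _), sub_sub_sub_comm,
      sub_sub_sub_comm (φ' x), ← g.poisson_sub h, ← g'.poisson_sub h']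
    abel
  have hkernel : ‖∫ y, poisson κ m φ y ∂(κ' x) - ∫ y, poisson κ m φ y ∂(κ x)‖ ≤
      C * D / (1 - ρ) * δ :=
    (hu.norm_integral_sub_le_tvDist _ _).trans
      (mul_le_mul_of_nonneg_left (hδ x) ((norm_nonneg _).trans (hu.bound x)))
  rw [hdecomp]
  refine (norm_add_le_of_le
    (norm_sub_le_of_le (hφ x) (g.norm_mean_sub_le g' hδ h h' hφ)) hkernel).trans_eq ?_
  ring

theorem norm_poisson_sub_le (g : GeomErgodic κ m D ρ) (g' : GeomErgodic κ' m' D' ρ')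
    (hδ : ∀ x, tvDist (κ' x) (κ x) ≤ δ) (h : BddMeas φ C) (h' : BddMeas φ' C)
    (hφ : ∀ x, ‖φ' x - φ x‖ ≤ δ') (x : X) :
    ‖poisson κ' m' φ' x - poisson κ m φ x‖ ≤
      (2 * δ' + 2 * (C * D / (1 - ρ)) * δ) * D' / (1 - ρ') +
        C * D / (1 - ρ) * D / (1 - ρ) * δ := by
  have hu := g.bddMeas_poisson h
  have hu' := g'.bddMeas_poisson h'
  have hmean : ‖∫ x, (poisson κ' m' φ' x - poisson κ m φ x) ∂m'‖ ≤
      C * D / (1 - ρ) * D / (1 - ρ) * δ := by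
    rw [integral_sub (hu'.integrable _) (hu.integrable _), g'.integral_poisson h', zero_sub,
      norm_neg]
    simpa only [g.integral_poisson h, sub_zero] using g.norm_integral_sub_le g' hδ hu
  rw [← sub_add_cancel (poisson κ' m' φ' x - poisson κ m φ x)
    (∫ x, (poisson κ' m' φ' x - poisson κ m φ x) ∂m')]
  exact norm_add_le_of_le (g'.norm_sub_integral_le_of_nearly_harmonic (hu'.sub hu)
    (g.norm_poisson_sub_sub_integral_le g' hδ h h' hφ) x) hmean

end GeomErgodic

end Poisson

section Calculus

theorem abs_exp_sub_exp_le (a b : ℝ) :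
    |Real.exp a - Real.exp b| ≤ |a - b| * (Real.exp a + Real.exp b) := by
  have key (a b : ℝ) : Real.exp a - Real.exp b ≤ |a - b| * (Real.exp a + Real.exp b) := by
    have htangent : (b - a + 1) * Real.exp a ≤ Real.exp b := by
      rw [← sub_add_cancel b a, Real.exp_add, add_sub_cancel_right]
      exact mul_le_mul_of_nonneg_right (Real.add_one_le_exp _) (Real.exp_pos a).le
    calc Real.exp a - Real.exp b ≤ (a - b) * Real.exp a := by linarith
      _ ≤ |a - b| * (Real.exp a + Real.exp b) := by
        gcongr
        · exact le_abs_self _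
        · exact le_add_of_nonneg_right (Real.exp_pos b).le
  refine abs_sub_le_iff.2 ⟨key a b, ?_⟩
  rw [abs_sub_comm, add_comm]
  exact key b a

theorem abs_exp_sub_one_sub_le (y : ℝ) :
    |Real.exp y - 1 - y| ≤ y ^ 2 * (Real.exp y + 1) := by
  have htangent : (-y + 1) * Real.exp y ≤ 1 := by
    simpa [← Real.exp_add] using
      mul_le_mul_of_nonneg_right (Real.add_one_le_exp (-y)) (Real.exp_pos y).le
  rw [abs_of_nonneg (by linarith [Real.add_one_le_exp y])]
  calc Real.exp y - 1 - y ≤ y * (Real.exp y - 1) := by linarith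
    _ ≤ |y| * |Real.exp y - Real.exp 0| := by
      rw [Real.exp_zero, ← abs_mul]; exact le_abs_self _
    _ ≤ |y| * (|y - 0| * (Real.exp y + Real.exp 0)) := by gcongr; exact abs_exp_sub_exp_le y 0
    _ = y ^ 2 * (Real.exp y + 1) := by
      rw [Real.exp_zero, sub_zero, ← mul_assoc, abs_mul_abs_self, sq]

variable {F : Type*} [NormedAddCommGroup F] [InnerProductSpace ℝ F] [CompleteSpace F] {Θ : Set F}
  {f : F → ℝ}

theorem hasGradientWithinAt_of_quadratic {θ v : F} {R : ℝ}
    (h : ∀ θ' ∈ Θ, |f θ' - f θ - inner ℝ v (θ' - θ)| ≤ R * ‖θ' - θ‖ ^ 2) :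
    HasGradientWithinAt f v Θ θ := by
  rw [hasGradientWithinAt_iff_isLittleO]
  have hbigO : (fun θ' => f θ' - f θ - inner ℝ v (θ' - θ)) =O[𝓝[Θ] θ]
      fun θ' => ‖θ' - θ‖ ^ 2 := by
    refine .of_bound R ?_
    filter_upwards [self_mem_nhdsWithin] with θ' hθ'
    simpa using h θ' hθ'
  have hsub : Tendsto (fun θ' => θ' - θ) (𝓝[Θ] θ) (𝓝 0) :=
    tendsto_sub_nhds_zero_iff.2 nhdsWithin_le_nhds
  exact hbigO.trans_isLittleO
    ((Asymptotics.isLittleO_norm_pow_id one_lt_two).comp_tendsto hsub)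

theorem gradientWithin_eq_of_hasGradientWithinAt {θ v : F} (hΘ : UniqueDiffWithinAt ℝ Θ θ)
    (h : HasGradientWithinAt f v Θ θ) : gradientWithin f Θ θ = v := by
  rw [gradientWithin, h.hasFDerivWithinAt.fderivWithin hΘ, LinearIsometryEquiv.symm_apply_apply]

theorem abs_sub_sub_inner_gradientWithin_le (hΘ : Convex ℝ Θ)
    (hf : DifferentiableOn ℝ f Θ) {L : ℝ≥0} (hL : LipschitzOnWith L (gradientWithin f Θ) Θ)
    {θ θ' : F} (hθ : θ ∈ Θ) (hθ' : θ' ∈ Θ) :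
    |f θ' - f θ - inner ℝ (gradientWithin f Θ θ) (θ' - θ)| ≤ L * ‖θ' - θ‖ ^ 2 := by
  have hseg : segment ℝ θ θ' ⊆ Θ := hΘ.segment_subset hθ hθ'
  have hderiv (z) (hz : z ∈ segment ℝ θ θ') : HasFDerivWithinAt f
      (InnerProductSpace.toDual ℝ F (gradientWithin f Θ z)) (segment ℝ θ θ') z :=
    (hf z (hseg hz)).hasGradientWithinAt.hasFDerivWithinAt.mono hseg
  have hbound (z) (hz : z ∈ segment ℝ θ θ') :
      ‖InnerProductSpace.toDual ℝ F (gradientWithin f Θ z) -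
        InnerProductSpace.toDual ℝ F (gradientWithin f Θ θ)‖ ≤ L * ‖θ' - θ‖ := by
    rw [← map_sub, LinearIsometryEquiv.norm_map]
    refine (hL.norm_sub_le (hseg hz) hθ).trans ?_
    gcongr
    exact norm_sub_le_of_mem_segment hz
  have := (convex_segment θ θ').norm_image_sub_le_of_norm_hasFDerivWithin_le' hderiv hbound
    (left_mem_segment ℝ θ θ') (right_mem_segment ℝ θ θ')
  simpa [sq, mul_assoc] using this

theorem norm_gradientWithin_le_of_lipschitzOn {C : ℝ≥0} (hf : LipschitzOnWith C f Θ)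
    (hcont : ContinuousOn (gradientWithin f Θ) Θ) (hΘ : Θ ⊆ closure (interior Θ)) {θ : F}
    (hθ : θ ∈ Θ) : ‖gradientWithin f Θ θ‖ ≤ C := by
  have hinterior : ∀ θ' ∈ interior Θ, ‖gradientWithin f Θ θ'‖ ≤ C := fun θ' hθ' => by
    have hnhds : Θ ∈ 𝓝 θ' := mem_interior_iff_mem_nhds.1 hθ'
    rw [gradientWithin, LinearIsometryEquiv.norm_map, fderivWithin_of_mem_nhds hnhds]
    exact norm_fderiv_le_of_lipschitzOn ℝ hnhds hf
  have : (𝓝[interior Θ] θ).NeBot := mem_closure_iff_nhdsWithin_neBot.1 (hΘ hθ)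
  exact le_of_tendsto ((hcont θ hθ).mono interior_subset).norm
    (eventually_of_mem self_mem_nhdsWithin hinterior)

end Calculus

section Policy

variable {nS nZ nA n : ℕ} {S : Set (Euc nS)} {Z : Set (Euc nZ)} {A : Set (Euc nA)}
  {E : Type*} [NormedAddCommGroup E] [NormedSpace ℝ E]

namespace Policy

variable (π : Policy S Z A n) (θ : Euc n) (x : AugState S Z)

theorem measurable_dens : Measurable (π.dens θ x) :=
  π.dens_measurable.comp (measurable_const.prodMk measurable_prodMk_left)

theorem integrable_dens : Integrable (π.dens θ x) π.ref := by
  refine ⟨(π.measurable_dens θ x).aestronglyMeasurable, ?_⟩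
  rw [hasFiniteIntegral_iff_ofReal (ae_of_all _ fun a => (π.dens_pos θ x a).le), π.dens_norm]
  exact ENNReal.one_lt_top

theorem integral_dens : ∫ a, π.dens θ x a ∂π.ref = 1 := by
  rw [integral_eq_lintegral_of_nonneg_ae (ae_of_all _ fun a => (π.dens_pos θ x a).le)
    (π.measurable_dens θ x).aestronglyMeasurable, π.dens_norm, ENNReal.toReal_one]

theorem integral_kernel (ψ : ↥A → E) :
    ∫ a, ψ a ∂(π.kernel θ x) = ∫ a, π.dens θ x a • ψ a ∂π.ref := by
  have := π.ref_sigmaFinite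
  have hmeas : Measurable (Function.uncurry fun x a => ENNReal.ofReal (π.dens θ x a)) :=
    ENNReal.measurable_ofReal.comp (π.dens_measurable.comp measurable_prodMk_left)
  rw [kernel, Kernel.withDensity_apply _ hmeas, Kernel.const_apply,
    integral_withDensity_eq_integral_toReal_smul (π.measurable_dens θ x).ennreal_ofReal
      (ae_of_all _ fun _ => ENNReal.ofReal_lt_top)]
  simp only [ENNReal.toReal_ofReal (π.dens_pos θ x _).le]

theorem integrable_dens_smul {ψ : ↥A → E} {C : ℝ} (h : BddMeas ψ C) :
    Integrable (fun a => π.dens θ x a • ψ a) π.ref :=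
  (π.integrable_dens θ x).smul_bdd C h.meas.aestronglyMeasurable (ae_of_all _ h.bound)

theorem integral_kernel_sub {θ' : Euc n} {ψ : ↥A → E} {C : ℝ} (h : BddMeas ψ C) :
    ∫ a, ψ a ∂(π.kernel θ' x) - ∫ a, ψ a ∂(π.kernel θ x) =
      ∫ a, (π.dens θ' x a - π.dens θ x a) • ψ a ∂π.ref := by
  simp only [π.integral_kernel, sub_smul]
  rw [integral_sub (π.integrable_dens_smul θ' x h) (π.integrable_dens_smul θ x h)]

variable {π θ x} {Θ : Set (Euc n)} {L L' : ℝ≥0} {θ' : Euc n}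

theorem abs_dens_sub_le (hL : ∀ x a, LipschitzOnWith L (fun θ => Real.log (π.dens θ x a)) Θ)
    (hθ : θ ∈ Θ) (hθ' : θ' ∈ Θ) (a : ↥A) :
    |π.dens θ' x a - π.dens θ x a| ≤ L * ‖θ' - θ‖ * (π.dens θ' x a + π.dens θ x a) := by
  have hexp := abs_exp_sub_exp_le (Real.log (π.dens θ' x a)) (Real.log (π.dens θ x a))
  rw [Real.exp_log (π.dens_pos _ _ _), Real.exp_log (π.dens_pos _ _ _)] at hexp
  exact hexp.trans (mul_le_mul_of_nonneg_right ((hL x a).norm_sub_le hθ' hθ)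
    (add_pos (π.dens_pos _ _ _) (π.dens_pos _ _ _)).le)

theorem tvDist_kernel_le (hL : ∀ x a, LipschitzOnWith L (fun θ => Real.log (π.dens θ x a)) Θ)
    (hθ : θ ∈ Θ) (hθ' : θ' ∈ Θ) (x : AugState S Z) :
    tvDist (π.kernel θ' x) (π.kernel θ x) ≤ 2 * L * ‖θ' - θ‖ := by
  refine tvDist_le_of_forall_abs_integral_sub_le fun ψ hψ => ?_
  have hdens := π.integrable_dens θ x
  have hdens' := π.integrable_dens θ' x
  rw [π.integral_kernel_sub θ x hψ, ← Real.norm_eq_abs]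
  refine (norm_integral_le_of_norm_le ((hdens'.add hdens).const_mul (L * ‖θ' - θ‖))
    (ae_of_all _ fun a => ?_)).trans_eq ?_
  · rw [norm_smul]
    exact (mul_le_of_le_one_right (norm_nonneg _) (hψ.bound a)).trans
      (abs_dens_sub_le hL hθ hθ' a)
  · rw [integral_const_mul]
    simp only [Pi.add_apply]
    rw [integral_add hdens' hdens, π.integral_dens, π.integral_dens]
    ring

/-- The log-densities of the policy class are Lipschitz on `Θ` with constant `L`, and so are the
scores with constant `L'`. The conditions on `Θ` make gradients within `Θ` unique. -/
structure IsSmooth (π : Policy S Z A n) (Θ : Set (Euc n)) (L L' : ℝ≥0) : Prop where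
  convex : Convex ℝ Θ
  interior_nonempty : (interior Θ).Nonempty
  differentiable : ∀ x a, DifferentiableOn ℝ (fun θ => Real.log (π.dens θ x a)) Θ
  lipschitz : ∀ x a, LipschitzOnWith L (fun θ => Real.log (π.dens θ x a)) Θ
  score_lipschitz : ∀ x a, LipschitzOnWith L' (fun θ => π.score Θ θ x a) Θ
  score_measurable : ∀ θ ∈ Θ, Measurable fun p : AugState S Z × ↥A => π.score Θ θ p.1 p.2

namespace IsSmooth

variable (h : π.IsSmooth Θ L L')
include h

theorem uniqueDiffWithinAt (hθ : θ ∈ Θ) : UniqueDiffWithinAt ℝ Θ θ :=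
  uniqueDiffOn_convex h.convex h.interior_nonempty θ hθ

theorem bddMeas_score (hθ : θ ∈ Θ) :
    BddMeas (fun p : AugState S Z × ↥A => π.score Θ θ p.1 p.2) L where
  meas := (h.score_measurable θ hθ).stronglyMeasurable
  bound p := by
    refine norm_gradientWithin_le_of_lipschitzOn (h.lipschitz p.1 p.2)
      (h.score_lipschitz p.1 p.2).continuousOn ?_ hθ
    rw [h.convex.closure_interior_eq_closure_of_nonempty_interior h.interior_nonempty]
    exact subset_closure

theorem abs_dens_sub_sub_inner_score_le (hθ : θ ∈ Θ) (hθ' : θ' ∈ Θ) (a : ↥A) :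
    |π.dens θ' x a - π.dens θ x a - π.dens θ x a * inner ℝ (π.score Θ θ x a) (θ' - θ)| ≤
      (L ^ 2 * (π.dens θ' x a + π.dens θ x a) + L' * π.dens θ x a) * ‖θ' - θ‖ ^ 2 := by
  have hpos := π.dens_pos θ x a
  set y := Real.log (π.dens θ' x a) - Real.log (π.dens θ x a) with hy
  have hexp : π.dens θ' x a = π.dens θ x a * Real.exp y := by
    rw [hy, Real.exp_sub, Real.exp_log hpos, Real.exp_log (π.dens_pos θ' x a),
      mul_div_cancel₀ _ hpos.ne']
  have hfirst : |y| ≤ L * ‖θ' - θ‖ := (h.lipschitz x a).norm_sub_le hθ' hθ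
  have hsecond : |y - inner ℝ (π.score Θ θ x a) (θ' - θ)| ≤ L' * ‖θ' - θ‖ ^ 2 :=
    abs_sub_sub_inner_gradientWithin_le h.convex (h.differentiable x a) (h.score_lipschitz x a)
      hθ hθ'
  calc |π.dens θ' x a - π.dens θ x a - π.dens θ x a * inner ℝ (π.score Θ θ x a) (θ' - θ)|
      = π.dens θ x a *
          |(Real.exp y - 1 - y) + (y - inner ℝ (π.score Θ θ x a) (θ' - θ))| := by
        rw [← abs_of_pos hpos, ← abs_mul, abs_of_pos hpos, hexp]
        ring_nf
    _ ≤ π.dens θ x a * ((L * ‖θ' - θ‖) ^ 2 * (Real.exp y + 1) + L' * ‖θ' - θ‖ ^ 2) := by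
        gcongr
        refine (abs_add_le _ _).trans (add_le_add ((abs_exp_sub_one_sub_le y).trans ?_) hsecond)
        rw [← sq_abs]
        gcongr
    _ = _ := by rw [hexp]; ring

theorem integral_dens_mul_inner_score (hθ : θ ∈ Θ) {ψ : ↥A → ℝ} {C : ℝ} (hψ : BddMeas ψ C)
    (v : Euc n) :
    Integrable (fun a => π.dens θ x a * inner ℝ (π.score Θ θ x a) v * ψ a) π.ref ∧
      ∫ a, π.dens θ x a * inner ℝ (π.score Θ θ x a) v * ψ a ∂π.ref =
        inner ℝ (∫ a, ψ a • π.score Θ θ x a ∂(π.kernel θ x)) v := by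
  have hint := π.integrable_dens_smul θ x
    (hψ.smul ((h.bddMeas_score hθ).comp (measurable_prodMk_left (x := x))))
  have hpt (a : ↥A) : π.dens θ x a * inner ℝ (π.score Θ θ x a) v * ψ a =
      inner ℝ v (π.dens θ x a • ψ a • π.score Θ θ x a) := by
    rw [inner_smul_right, inner_smul_right, real_inner_comm]
    ring
  simp only [hpt]
  exact ⟨hint.const_inner v, by rw [π.integral_kernel, real_inner_comm, ← integral_inner hint]⟩

theorem abs_integral_kernel_sub_sub_inner_le (hθ : θ ∈ Θ) (hθ' : θ' ∈ Θ) (x : AugState S Z)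
    {ψ : ↥A → ℝ} {C : ℝ} (hψ : BddMeas ψ C) :
    |∫ a, ψ a ∂(π.kernel θ' x) - ∫ a, ψ a ∂(π.kernel θ x) -
      inner ℝ (∫ a, ψ a • π.score Θ θ x a ∂(π.kernel θ x)) (θ' - θ)| ≤
      C * (2 * (L : ℝ) ^ 2 + L') * ‖θ' - θ‖ ^ 2 := by
  obtain ⟨hint, hinner⟩ := h.integral_dens_mul_inner_score (x := x) hθ hψ (θ' - θ)
  have hdens := π.integrable_dens θ x
  have hdens' := π.integrable_dens θ' x
  have hsum : Integrable (fun a => L ^ 2 * (π.dens θ' x a + π.dens θ x a)) π.ref :=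
    (hdens'.add hdens).const_mul _
  have hdiff : Integrable (fun a => (π.dens θ' x a - π.dens θ x a) • ψ a) π.ref := by
    simp only [sub_smul]
    exact (π.integrable_dens_smul θ' x hψ).sub (π.integrable_dens_smul θ x hψ)
  rw [← hinner, π.integral_kernel_sub θ x hψ, ← integral_sub hdiff hint, ← Real.norm_eq_abs]
  refine (norm_integral_le_of_norm_le
    (((hsum.add (hdens.const_mul L')).mul_const (‖θ' - θ‖ ^ 2)).mul_const C)
    (ae_of_all _ fun a => ?_)).trans_eq ?_
  · rw [smul_eq_mul, ← sub_mul, norm_mul]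
    have hle := h.abs_dens_sub_sub_inner_score_le (x := x) hθ hθ' a
    exact mul_le_mul hle (hψ.bound a) (norm_nonneg _) ((abs_nonneg _).trans hle)
  · rw [integral_mul_const, integral_mul_const]
    simp only [Pi.add_apply]
    rw [integral_add hsum (hdens.const_mul _), integral_const_mul,
      integral_const_mul, integral_add hdens' hdens, π.integral_dens, π.integral_dens]
    ring

theorem integral_score (hθ : θ ∈ Θ) (x : AugState S Z) :
    ∫ a, π.score Θ θ x a ∂(π.kernel θ x) = 0 := by
  -- it is the gradient of the total mass of the policy, which is constant
  have hgrad : HasGradientWithinAt (fun _ => (1 : ℝ))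
      (∫ a, π.score Θ θ x a ∂(π.kernel θ x)) Θ θ :=
    hasGradientWithinAt_of_quadratic fun θ' hθ' => by
      simpa using h.abs_integral_kernel_sub_sub_inner_le hθ hθ' x (BddMeas.const (1 : ℝ))
  rw [← gradientWithin_eq_of_hasGradientWithinAt (h.uniqueDiffWithinAt hθ) hgrad]
  exact gradientWithin_eq_of_hasGradientWithinAt (h.uniqueDiffWithinAt hθ)
    (hasGradientWithinAt_const _ _ _)

end IsSmooth

end Policy

namespace CMDP

variable {K : ℕ} (M : CMDP S Z A K) (π : Policy S Z A n) (θ : Euc n)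

theorem iterKernel_eq (t : ℕ) : M.iterKernel π θ t = M.stateKernel π θ ^ t := by
  induction t with
  | zero => rfl
  | succ t ih => rw [iterKernel, ih, pow_succ']; rfl

theorem integral_stepKernel (x : AugState S Z) {φ : ↥A × AugState S Z → E} {C : ℝ}
    (h : BddMeas φ C) :
    ∫ p, φ p ∂(M.stepKernel π θ x) =
      ∫ a, ∫ x', φ (a, x') ∂(M.augTrans (x, a)) ∂(π.kernel θ x) := by
  rw [stepKernel, ProbabilityTheory.integral_compProd (h.integrable _)]

theorem integral_stepKernel_fst [CompleteSpace E] (x : AugState S Z) {ψ : ↥A → E} {C : ℝ}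
    (h : BddMeas ψ C) :
    ∫ p, ψ p.1 ∂(M.stepKernel π θ x) = ∫ a, ψ a ∂(π.kernel θ x) := by
  rw [M.integral_stepKernel π θ x (h.comp measurable_fst)]
  simp only [integral_const, probReal_univ, one_smul]

theorem integral_stateKernel (x : AugState S Z) {φ : AugState S Z → E} {C : ℝ}
    (h : BddMeas φ C) :
    ∫ y, φ y ∂(M.stateKernel π θ x) = ∫ p, φ p.2 ∂(M.stepKernel π θ x) := by
  rw [stateKernel, Kernel.snd_apply, integral_map measurable_snd.aemeasurable
    h.meas.aestronglyMeasurable]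

theorem bddMeas_augTrans {φ : ↥A × AugState S Z → E} {C : ℝ} (h : BddMeas φ C)
    (x : AugState S Z) : BddMeas (fun a => ∫ x', φ (a, x') ∂(M.augTrans (x, a))) C where
  meas := by
    have hφ : StronglyMeasurable fun q : (AugState S Z × ↥A) × AugState S Z => φ (q.1.2, q.2) :=
      h.meas.comp_measurable (by fun_prop)
    exact (hφ.integral_kernel_prod_right' (κ := M.augTrans)).comp_measurable
      measurable_prodMk_left
  bound _ := (h.comp measurable_prodMk_left).norm_integral_le _

variable {π θ} {Θ : Set (Euc n)} {L : ℝ≥0} {θ' : Euc n}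

theorem tvDist_stepKernel_le
    (hL : ∀ x a, LipschitzOnWith L (fun θ => Real.log (π.dens θ x a)) Θ)
    (hθ : θ ∈ Θ) (hθ' : θ' ∈ Θ) (x : AugState S Z) :
    tvDist (M.stepKernel π θ' x) (M.stepKernel π θ x) ≤ 2 * L * ‖θ' - θ‖ := by
  refine tvDist_le_of_forall_abs_integral_sub_le fun ψ hψ => ?_
  rw [M.integral_stepKernel π θ' x hψ, M.integral_stepKernel π θ x hψ]
  exact ((M.bddMeas_augTrans hψ x).norm_integral_sub_le_tvDist _ _).trans
    ((one_mul _).trans_le (Policy.tvDist_kernel_le hL hθ hθ' x))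

theorem tvDist_stateKernel_le
    (hL : ∀ x a, LipschitzOnWith L (fun θ => Real.log (π.dens θ x a)) Θ)
    (hθ : θ ∈ Θ) (hθ' : θ' ∈ Θ) (x : AugState S Z) :
    tvDist (M.stateKernel π θ' x) (M.stateKernel π θ x) ≤ 2 * L * ‖θ' - θ‖ := by
  refine tvDist_le_of_forall_abs_integral_sub_le fun ψ hψ => ?_
  rw [M.integral_stateKernel π θ' x hψ, M.integral_stateKernel π θ x hψ]
  exact ((hψ.comp measurable_snd).norm_integral_sub_le_tvDist _ _).trans
    ((one_mul _).trans_le (M.tvDist_stepKernel_le hL hθ hθ' x))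

end CMDP

end Policy

section LipFamily

/-- Families of measurable functions that are bounded and Lipschitz in the parameter, both uniformly
in the argument. All quantities attached to a policy (mean cost, value function, gradient, …) have
this form, as functions of the policy parameter. -/
structure LipFamily {T X E : Type*} [PseudoMetricSpace T] [MeasurableSpace X] [NormedAddCommGroup E]
    (φ : T → X → E) : Prop where
  bdd : ∃ C : ℝ≥0, ∀ θ, BddMeas (φ θ) C
  lip : ∃ D : ℝ≥0, ∀ x, LipschitzWith D fun θ => φ θ x

namespace LipFamily

variable {T X Y E : Type*} [MeasurableSpace X] [MeasurableSpace Y] [NormedAddCommGroup E]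

section PseudoMetric

variable [PseudoMetricSpace T] {φ ψ : T → X → E}

theorem of_bound {C D : ℝ} (hC : ∀ θ, BddMeas (φ θ) C)
    (hD : ∀ θ θ' x, ‖φ θ' x - φ θ x‖ ≤ D * dist θ' θ) : LipFamily φ where
  bdd := ⟨C.toNNReal, fun θ => (hC θ).mono (Real.le_coe_toNNReal C)⟩
  lip := ⟨D.toNNReal, fun x => .of_dist_le_mul fun θ' θ => by
    rw [dist_eq_norm]
    exact (hD θ θ' x).trans (mul_le_mul_of_nonneg_right (Real.le_coe_toNNReal D) dist_nonneg)⟩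

omit [MeasurableSpace X] in
theorem norm_sub_le {D : ℝ≥0} (hD : ∀ x, LipschitzWith D fun θ => φ θ x) (θ θ' : T) (x : X) :
    ‖φ θ' x - φ θ x‖ ≤ D * dist θ' θ := by
  rw [← dist_eq_norm]
  exact (hD x).dist_le_mul θ' θ

theorem const {f : X → E} {C : ℝ} (h : BddMeas f C) : LipFamily (fun _ : T => f) :=
  .of_bound (D := 0) (fun _ => h) (by simp)

theorem add (h : LipFamily φ) (h' : LipFamily ψ) : LipFamily (fun θ x => φ θ x + ψ θ x) := by
  obtain ⟨⟨C, hC⟩, ⟨D, hD⟩⟩ := h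
  obtain ⟨⟨C', hC'⟩, ⟨D', hD'⟩⟩ := h'
  exact ⟨⟨C + C', fun θ => (hC θ).add (hC' θ)⟩, ⟨D + D', fun x => (hD x).add (hD' x)⟩⟩

theorem sub (h : LipFamily φ) (h' : LipFamily ψ) : LipFamily (fun θ x => φ θ x - ψ θ x) := by
  obtain ⟨⟨C, hC⟩, ⟨D, hD⟩⟩ := h
  obtain ⟨⟨C', hC'⟩, ⟨D', hD'⟩⟩ := h'
  exact ⟨⟨C + C', fun θ => (hC θ).sub (hC' θ)⟩, ⟨D + D', fun x => (hD x).sub (hD' x)⟩⟩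

theorem comp (h : LipFamily φ) {g : Y → X} (hg : Measurable g) :
    LipFamily (fun θ y => φ θ (g y)) :=
  ⟨h.bdd.imp fun _ hC θ => (hC θ).comp hg, h.lip.imp fun _ hD y => hD (g y)⟩

variable [NormedSpace ℝ E]

theorem smul {c : T → X → ℝ} (hc : LipFamily c) (h : LipFamily φ) :
    LipFamily (fun θ x => c θ x • φ θ x) := by
  obtain ⟨⟨C, hC⟩, ⟨D, hD⟩⟩ := hc
  obtain ⟨⟨C', hC'⟩, ⟨D', hD'⟩⟩ := h
  refine .of_bound (C := C * C') (D := D * C' + C * D') (fun θ => (hC θ).smul (hC' θ))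
    fun θ θ' x => ?_
  calc ‖c θ' x • φ θ' x - c θ x • φ θ x‖
      = ‖(c θ' x - c θ x) • φ θ' x + c θ x • (φ θ' x - φ θ x)‖ := by
        rw [sub_smul, smul_sub, sub_add_sub_cancel]
    _ ≤ ‖c θ' x - c θ x‖ * ‖φ θ' x‖ + ‖c θ x‖ * ‖φ θ' x - φ θ x‖ := by
        rw [← norm_smul, ← norm_smul]
        exact norm_add_le _ _
    _ ≤ D * dist θ' θ * C' + C * (D' * dist θ' θ) := by
        gcongr
        exacts [norm_sub_le hD θ θ' x, (hC' θ').bound x, (hC θ).bound x, norm_sub_le hD' θ θ' x]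
    _ = (D * C' + C * D') * dist θ' θ := by ring

theorem kernel (h : LipFamily φ) (κ : Kernel Y X) [IsMarkovKernel κ] :
    LipFamily (fun θ y => ∫ x, φ θ x ∂(κ y)) := by
  obtain ⟨⟨C, hC⟩, ⟨D, hD⟩⟩ := h
  refine .of_bound (D := D) (fun θ => (hC θ).kernel κ) fun θ θ' y => ?_
  rw [← integral_sub ((hC θ').integrable _) ((hC θ).integrable _)]
  exact BddMeas.norm_integral_le ⟨(hC θ').meas.sub (hC θ).meas, norm_sub_le hD θ θ'⟩ _

end PseudoMetric

theorem stronglyMeasurable_uncurry [MetricSpace T] [SecondCountableTopology T] [MeasurableSpace T]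
    [OpensMeasurableSpace T] {φ : T → X → E} (h : LipFamily φ) :
    StronglyMeasurable (Function.uncurry φ) := by
  obtain ⟨⟨C, hC⟩, ⟨D, hD⟩⟩ := h
  exact stronglyMeasurable_uncurry_of_continuous_of_stronglyMeasurable
    (fun x => (hD x).continuous) fun θ => (hC θ).meas

end LipFamily

end LipFamily

section RegularModel

variable {nS nZ nA K n : ℕ} {S : Set (Euc nS)} {Z : Set (Euc nZ)} {A : Set (Euc nA)}

/-- A model with bounded costs, a bounded parameter set, a smooth policy class, and uniform
geometric ergodicity with stationary laws `m θ`. The parameters of `m` form the subtype `↥Θ`, since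
policies with parameters outside `Θ` may have no stationary law. -/
structure RegularModel (M : CMDP S Z A K) (π : Policy S Z A n) (Θ : Set (Euc n))
    (m : ↥Θ → ProbabilityMeasure (AugState S Z)) (L L' : ℝ≥0) (lam ρ : ℝ) : Prop where
  cost_bounded : ∃ c : ℝ, ∀ k x a x', |M.reshapedCost k x a x'| ≤ c
  isBounded : Bornology.IsBounded Θ
  smooth : π.IsSmooth Θ L L'
  ergodic : ∀ θ : ↥Θ, GeomErgodic (M.stateKernel π θ) (m θ) lam ρ
  ρ_pos : 0 < ρ

variable {M : CMDP S Z A K} {π : Policy S Z A n} {Θ : Set (Euc n)} {lam ρ : ℝ}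

theorem ProblemAssumptions.exists_regularModel (h : ProblemAssumptions M π Θ lam ρ) :
    ∃ m L L', RegularModel M π Θ m L L' lam ρ := by
  obtain ⟨L, hL⟩ := h.policy_lipschitz
  obtain ⟨L', hL'⟩ := h.score_lipschitz
  choose m hinvariant hmix using fun θ : ↥Θ => h.ergodic θ θ.2
  refine ⟨m, L, L', h.cost_bounded, h.compact_Θ.isBounded,
    ⟨h.convex_Θ, h.interior_Θ, h.policy_differentiable, hL, hL', fun θ _ =>
      h.score_measurable.comp measurable_prodMk_left⟩,
    fun θ => ⟨hinvariant θ, fun x t => ?_, h.ρ_pos.le, h.ρ_lt_one⟩, h.ρ_pos⟩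
  simpa only [M.iterKernel_eq] using hmix θ x t

namespace RegularModel

variable {m : ↥Θ → ProbabilityMeasure (AugState S Z)} {L L' : ℝ≥0}
  (h : RegularModel M π Θ m L L' lam ρ) {E : Type*} [NormedAddCommGroup E]
include h

theorem lipFamily_score :
    LipFamily (fun (θ : ↥Θ) (p : AugState S Z × ↥A) => π.score Θ θ p.1 p.2) :=
  ⟨⟨L, fun θ => h.smooth.bddMeas_score θ.2⟩,
    ⟨L', fun p => (h.smooth.score_lipschitz p.1 p.2).to_restrict⟩⟩

theorem tvDist_policy_le (θ θ' : ↥Θ) (x : AugState S Z) :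
    tvDist (π.kernel θ' x) (π.kernel θ x) ≤ 2 * L * dist θ' θ := by
  rw [Subtype.dist_eq, dist_eq_norm]
  exact Policy.tvDist_kernel_le h.smooth.lipschitz θ.2 θ'.2 x

theorem tvDist_stateKernel_le (θ θ' : ↥Θ) (x : AugState S Z) :
    tvDist (M.stateKernel π θ' x) (M.stateKernel π θ x) ≤ 2 * L * dist θ' θ := by
  rw [Subtype.dist_eq, dist_eq_norm]
  exact M.tvDist_stateKernel_le h.smooth.lipschitz θ.2 θ'.2 x

variable [NormedSpace ℝ E]

theorem lipFamily_policy {φ : ↥Θ → AugState S Z × ↥A → E} (hφ : LipFamily φ) :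
    LipFamily (fun (θ : ↥Θ) x => ∫ a, φ θ (x, a) ∂(π.kernel θ x)) := by
  obtain ⟨⟨C, hC⟩, ⟨D, hD⟩⟩ := hφ
  have hslice (θ : ↥Θ) (x) : BddMeas (fun a => φ θ (x, a)) C := (hC θ).comp measurable_prodMk_left
  refine .of_bound (C := C) (D := D + C * (2 * L)) (fun θ =>
    ⟨(hC θ).meas.integral_kernel_prod_right' (κ := π.kernel θ),
      fun x => (hslice θ x).norm_integral_le _⟩) fun θ θ' x => ?_
  calc ‖∫ a, φ θ' (x, a) ∂(π.kernel θ' x) - ∫ a, φ θ (x, a) ∂(π.kernel θ x)‖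
      = ‖∫ a, (φ θ' (x, a) - φ θ (x, a)) ∂(π.kernel θ' x) +
          (∫ a, φ θ (x, a) ∂(π.kernel θ' x) - ∫ a, φ θ (x, a) ∂(π.kernel θ x))‖ := by
        rw [integral_sub ((hslice θ' x).integrable _) ((hslice θ x).integrable _),
          sub_add_sub_cancel]
    _ ≤ D * dist θ' θ + C * (2 * L * dist θ' θ) :=
        norm_add_le_of_le
          (BddMeas.norm_integral_le ⟨(hslice θ' x).meas.sub (hslice θ x).meas,
            fun a => LipFamily.norm_sub_le hD θ θ' (x, a)⟩ _)
          (((hslice θ x).norm_integral_sub_le_tvDist _ _).trans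
            (mul_le_mul_of_nonneg_left (h.tvDist_policy_le θ θ' x) C.2))
    _ = (D + C * (2 * L)) * dist θ' θ := by ring

variable [CompleteSpace E] {φ : ↥Θ → AugState S Z → E}

theorem lipFamily_poisson (hφ : LipFamily φ) :
    LipFamily (fun θ : ↥Θ => poisson (M.stateKernel π θ) (m θ) (φ θ)) := by
  obtain ⟨⟨C, hC⟩, ⟨D, hD⟩⟩ := hφ
  refine .of_bound (C := C * lam / (1 - ρ))
    (D := (2 * D + 2 * (C * lam / (1 - ρ)) * (2 * L)) * lam / (1 - ρ) +
      C * lam / (1 - ρ) * lam / (1 - ρ) * (2 * L))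
    (fun θ => (h.ergodic θ).bddMeas_poisson (hC θ)) fun θ θ' x => ?_
  refine ((h.ergodic θ).norm_poisson_sub_le (h.ergodic θ') (h.tvDist_stateKernel_le θ θ')
    (hC θ) (hC θ') (LipFamily.norm_sub_le hD θ θ') x).trans_eq ?_
  ring

theorem lipFamily_mean (hφ : LipFamily φ) {Y : Type*} [MeasurableSpace Y] :
    LipFamily (fun (θ : ↥Θ) (_ : Y) => ∫ x, φ θ x ∂(m θ : Measure (AugState S Z))) := by
  obtain ⟨⟨C, hC⟩, ⟨D, hD⟩⟩ := hφ
  refine .of_bound (C := C) (D := D + C * lam / (1 - ρ) * (2 * L))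
    (fun θ => ⟨stronglyMeasurable_const, fun _ => (hC θ).norm_integral_le _⟩) fun θ θ' _ => ?_
  refine ((h.ergodic θ).norm_mean_sub_le (h.ergodic θ') (h.tvDist_stateKernel_le θ θ')
    (hC θ) (hC θ') (LipFamily.norm_sub_le hD θ θ')).trans_eq ?_
  ring

end RegularModel

end RegularModel

section Values

variable {nS nZ nA K n : ℕ} {S : Set (Euc nS)} {Z : Set (Euc nZ)} {A : Set (Euc nA)}

namespace CMDP

variable (M : CMDP S Z A K) (π : Policy S Z A n) {Θ : Set (Euc n)}
  (m : ↥Θ → ProbabilityMeasure (AugState S Z)) (k : Fin (K + 1)) (θ : ↥Θ)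

/-- Expected reshaped cost of taking an action in an augmented state. -/
def actionCost (p : AugState S Z × ↥A) : ℝ :=
  ∫ x', M.reshapedCost k p.1 p.2 x' ∂(M.augTrans p)

/-- Average of the reshaped cost under the stationary law. -/
def avgCost : ℝ := ∫ x, M.meanCost π θ k x ∂(m θ : Measure (AugState S Z))

/-- Differential value function: the solution of Poisson's equation for the mean cost. -/
def value : AugState S Z → ℝ :=
  poisson (M.stateKernel π θ) (m θ) (M.meanCost π θ k)

/-- Differential action-value function. -/
def qValue (p : AugState S Z × ↥A) : ℝ :=
  M.actionCost k p - M.avgCost π m k θ + ∫ x', M.value π m k θ x' ∂(M.augTrans p)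

/-- Conditional mean, given the augmented state, of the action value times the score; its
stationary mean is the policy gradient. -/
def gradTerm (x : AugState S Z) : Euc n :=
  ∫ a, M.qValue π m k θ (x, a) • π.score Θ θ x a ∂(π.kernel θ x)

/-- The analogue of `value` for the policy gradient: the solution of Poisson's equation for
`gradTerm`. -/
def gradValue : AugState S Z → Euc n :=
  poisson (M.stateKernel π θ) (m θ) (M.gradTerm π m k θ)

end CMDP

namespace RegularModel

variable {M : CMDP S Z A K} {π : Policy S Z A n} {Θ : Set (Euc n)}
  {m : ↥Θ → ProbabilityMeasure (AugState S Z)} {L L' : ℝ≥0} {lam ρ : ℝ}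
  (h : RegularModel M π Θ m L L' lam ρ) (k : Fin (K + 1))
include h

theorem exists_bddMeas_reshapedCost : ∃ C, BddMeas
    (fun p : (AugState S Z × ↥A) × AugState S Z => M.reshapedCost k p.1.1 p.1.2 p.2) C := by
  obtain ⟨c, hc⟩ := h.cost_bounded
  have hcost : Measurable fun p : (AugState S Z × ↥A) × AugState S Z => M.cost k p.1.1.1 p.1.2 :=
    (M.cost_measurable k).comp
      (f := fun p : (AugState S Z × ↥A) × AugState S Z => (p.1.1.1, p.1.2)) (by fun_prop)
  have hpotential : Measurable fun p : (AugState S Z × ↥A) × AugState S Z =>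
      M.potential k p.2 - M.potential k p.1.1 :=
    ((M.potential_measurable k).comp measurable_snd).sub
      ((M.potential_measurable k).comp (measurable_fst.comp measurable_fst))
  exact ⟨c, (hcost.add hpotential).stronglyMeasurable, fun p => hc k _ _ _⟩

theorem exists_bddMeas_actionCost : ∃ C, BddMeas (M.actionCost k) C := by
  obtain ⟨C, hC⟩ := h.exists_bddMeas_reshapedCost k
  exact ⟨C, hC.meas.integral_kernel_prod_right' (κ := M.augTrans), fun _ =>
    (hC.comp measurable_prodMk_left).norm_integral_le _⟩

theorem meanCost_eq (θ : Euc n) (x : AugState S Z) :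
    M.meanCost π θ k x = ∫ a, M.actionCost k (x, a) ∂(π.kernel θ x) := by
  obtain ⟨C, hC⟩ := h.exists_bddMeas_reshapedCost k
  exact M.integral_stepKernel π θ x
    (hC.comp (g := fun p : ↥A × AugState S Z => ((x, p.1), p.2)) (by fun_prop))

theorem lipFamily_meanCost : LipFamily (fun θ : ↥Θ => M.meanCost π θ k) := by
  obtain ⟨C, hC⟩ := h.exists_bddMeas_actionCost k
  simpa only [← h.meanCost_eq] using h.lipFamily_policy (LipFamily.const hC)

theorem lipFamily_value : LipFamily (M.value π m k) := h.lipFamily_poisson (h.lipFamily_meanCost k)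

theorem lipFamily_avgCost {Y : Type*} [MeasurableSpace Y] :
    LipFamily (fun (θ : ↥Θ) (_ : Y) => M.avgCost π m k θ) :=
  h.lipFamily_mean (h.lipFamily_meanCost k)

theorem lipFamily_qValue : LipFamily (M.qValue π m k) := by
  obtain ⟨C, hC⟩ := h.exists_bddMeas_actionCost k
  exact ((LipFamily.const hC).sub (h.lipFamily_avgCost k)).add
    ((h.lipFamily_value k).kernel M.augTrans)

theorem lipFamily_qValue_smul_score : LipFamily (fun (θ : ↥Θ) (p : AugState S Z × ↥A) =>
    M.qValue π m k θ p • π.score Θ θ p.1 p.2) :=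
  (h.lipFamily_qValue k).smul h.lipFamily_score

theorem lipFamily_gradTerm : LipFamily (M.gradTerm π m k) :=
  h.lipFamily_policy (h.lipFamily_qValue_smul_score k)

theorem lipFamily_gradValue : LipFamily (M.gradValue π m k) :=
  h.lipFamily_poisson (h.lipFamily_gradTerm k)

theorem value_sub (θ : ↥Θ) (x : AugState S Z) :
    M.value π m k θ x - ∫ y, M.value π m k θ y ∂(M.stateKernel π θ x) =
      M.meanCost π θ k x - M.avgCost π m k θ := by
  obtain ⟨C, hC⟩ := (h.lipFamily_meanCost k).bdd
  exact (h.ergodic θ).poisson_sub (hC θ) x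

theorem gradValue_sub (θ : ↥Θ) (x : AugState S Z) :
    M.gradValue π m k θ x - ∫ y, M.gradValue π m k θ y ∂(M.stateKernel π θ x) =
      M.gradTerm π m k θ x - ∫ y, M.gradTerm π m k θ y ∂(m θ : Measure (AugState S Z)) := by
  obtain ⟨C, hC⟩ := (h.lipFamily_gradTerm k).bdd
  exact (h.ergodic θ).poisson_sub (hC θ) x

-- The policy `θ'` that acts may differ from the policy `θ` whose action value is integrated.
theorem integral_qValue (θ : ↥Θ) (θ' : Euc n) (x : AugState S Z) :
    ∫ a, M.qValue π m k θ (x, a) ∂(π.kernel θ' x) =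
      M.meanCost π θ' k x - M.avgCost π m k θ +
        ∫ y, M.value π m k θ y ∂(M.stateKernel π θ' x) := by
  obtain ⟨C, hC⟩ := h.exists_bddMeas_actionCost k
  obtain ⟨⟨D, hD⟩, -⟩ := h.lipFamily_value k
  have hcost : BddMeas (fun a => M.actionCost k (x, a)) C := hC.comp measurable_prodMk_left
  have hvalue := M.bddMeas_augTrans ((hD θ).comp (measurable_snd (α := ↥A))) x
  unfold CMDP.qValue
  rw [integral_add ((hcost.sub (.const _)).integrable _) (hvalue.integrable _),
    hcost.integral_sub_const, ← h.meanCost_eq, M.integral_stateKernel π θ' x (hD θ),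
    M.integral_stepKernel π θ' x ((hD θ).comp measurable_snd)]

theorem integral_qValue_self (θ : ↥Θ) (x : AugState S Z) :
    ∫ a, M.qValue π m k θ (x, a) ∂(π.kernel θ x) = M.value π m k θ x := by
  rw [h.integral_qValue, ← h.value_sub, sub_add_cancel]

-- The performance difference formula.
theorem avgCost_sub (θ θ' : ↥Θ) : M.avgCost π m k θ' - M.avgCost π m k θ =
    ∫ x, (∫ a, M.qValue π m k θ (x, a) ∂(π.kernel θ' x) -
      ∫ a, M.qValue π m k θ (x, a) ∂(π.kernel θ x)) ∂(m θ' : Measure (AugState S Z)) := by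
  obtain ⟨⟨C, hC⟩, -⟩ := h.lipFamily_meanCost k
  obtain ⟨⟨D, hD⟩, -⟩ := h.lipFamily_value k
  have hnext := (hD θ).kernel (M.stateKernel π θ')
  have hcost := (hC θ').sub (.const (M.avgCost π m k θ))
  simp only [h.integral_qValue_self, h.integral_qValue]
  rw [integral_sub ((hcost.add hnext).integrable _) ((hD θ).integrable _),
    integral_add (hcost.integrable _) (hnext.integrable _), (hC θ').integral_sub_const,
    (h.ergodic θ').integral_integral (hD θ), add_sub_cancel_right]
  rfl

theorem objective_eq (θ : ↥Θ) : M.objective π k θ = M.avgCost π m k θ := by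
  obtain ⟨⟨C, hC⟩, -⟩ := h.lipFamily_meanCost k
  have := M.init_prob
  have hlim := ((h.ergodic θ).tendsto_integral_bind_pow (hC θ) M.init).cesaro
  refine Tendsto.limUnder_eq ?_
  simpa only [one_div, M.iterKernel_eq, CMDP.avgCost] using hlim

theorem abs_avgCost_sub_sub_inner_le {C : ℝ} (hC : ∀ θ, BddMeas (M.qValue π m k θ) C)
    (θ θ' : ↥Θ) :
    |M.avgCost π m k θ' - M.avgCost π m k θ -
      inner ℝ (∫ x, M.gradTerm π m k θ x ∂(m θ' : Measure (AugState S Z))) ((θ' : Euc n) - θ)| ≤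
      C * (2 * (L : ℝ) ^ 2 + L') * ‖(θ' : Euc n) - θ‖ ^ 2 := by
  obtain ⟨⟨D, hD⟩, -⟩ := h.lipFamily_gradTerm k
  have hq (θ₁ : ↥Θ) : BddMeas (fun x => ∫ a, M.qValue π m k θ (x, a) ∂(π.kernel θ₁ x)) C :=
    ⟨(hC θ).meas.integral_kernel_prod_right' (κ := π.kernel θ₁), fun x =>
      ((hC θ).comp measurable_prodMk_left).norm_integral_le _⟩
  have hinner := ((hD θ).integrable (m θ' : Measure (AugState S Z))).const_inner (𝕜 := ℝ)
    ((θ' : Euc n) - θ)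
  rw [h.avgCost_sub, ← real_inner_comm, ← integral_inner ((hD θ).integrable _),
    ← integral_sub (((hq θ').sub (hq θ)).integrable _) hinner, ← Real.norm_eq_abs]
  refine BddMeas.norm_integral_le ⟨((hq θ').sub (hq θ)).meas.sub
    (stronglyMeasurable_const.inner (hD θ).meas), fun x => ?_⟩ _
  change |_ - _ - inner ℝ ((θ' : Euc n) - θ) (M.gradTerm π m k θ x)| ≤ _
  rw [real_inner_comm]
  exact h.smooth.abs_integral_kernel_sub_sub_inner_le θ.2 θ'.2 x
    ((hC θ).comp measurable_prodMk_left)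

-- The policy gradient theorem.
theorem gradObjective_eq (θ : ↥Θ) : M.gradObjective π Θ k θ =
    ∫ x, M.gradTerm π m k θ x ∂(m θ : Measure (AugState S Z)) := by
  obtain ⟨⟨C, hC⟩, -⟩ := h.lipFamily_qValue k
  obtain ⟨⟨D, hD⟩, -⟩ := h.lipFamily_gradTerm k
  refine gradientWithin_eq_of_hasGradientWithinAt (h.smooth.uniqueDiffWithinAt θ.2)
    (hasGradientWithinAt_of_quadratic (R := C * (2 * (L : ℝ) ^ 2 + L') +
      D * lam / (1 - ρ) * (2 * L)) fun θ₁ hθ₁ => ?_)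
  lift θ₁ to ↥Θ using hθ₁ with θ'
  have hmean := (h.ergodic θ).norm_integral_sub_le (h.ergodic θ') (h.tvDist_stateKernel_le θ θ')
    (hD θ)
  have hfirst := h.abs_avgCost_sub_sub_inner_le k hC θ θ'
  rw [Subtype.dist_eq, dist_eq_norm] at hmean
  rw [h.objective_eq, h.objective_eq]
  set Δ : Euc n := (θ' : Euc n) - θ
  set v := ∫ x, M.gradTerm π m k θ x ∂(m θ : Measure (AugState S Z))
  set v' := ∫ x, M.gradTerm π m k θ x ∂(m θ' : Measure (AugState S Z))
  set δ := M.avgCost π m k θ' - M.avgCost π m k θ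
  calc |δ - inner ℝ v Δ| = |(δ - inner ℝ v' Δ) + inner ℝ (v' - v) Δ| := by
        rw [inner_sub_left, sub_add_sub_cancel]
    _ ≤ |δ - inner ℝ v' Δ| + ‖v' - v‖ * ‖Δ‖ :=
        (abs_add_le _ _).trans (add_le_add_right (abs_real_inner_le_norm _ _) _)
    _ ≤ C * (2 * (L : ℝ) ^ 2 + L') * ‖Δ‖ ^ 2 + D * lam / (1 - ρ) * (2 * L * ‖Δ‖) * ‖Δ‖ := by
        gcongr
    _ = _ := by ring

theorem integral_reshapedCost_add_integral_value (θ : ↥Θ) (x : AugState S Z) :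
    ∫ p, M.reshapedCost k x p.1 p.2 ∂(M.stepKernel π θ x) +
      ∫ y, M.value π m k θ y ∂(M.stateKernel π θ x) =
      M.value π m k θ x + M.avgCost π m k θ := by
  change M.meanCost π θ k x + _ = _
  linarith [h.value_sub k θ x]

theorem integral_qValue_smul_score_add_integral_gradValue (θ : ↥Θ) (x : AugState S Z) :
    ∫ p, M.qValue π m k θ (x, p.1) • π.score Θ θ x p.1 ∂(M.stepKernel π θ x) +
      ∫ y, M.gradValue π m k θ y ∂(M.stateKernel π θ x) =
      M.gradValue π m k θ x + ∫ y, M.gradTerm π m k θ y ∂(m θ : Measure (AugState S Z)) := by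
  obtain ⟨C, hC⟩ := (h.lipFamily_qValue_smul_score k).bdd
  rw [M.integral_stepKernel_fst π θ x ((hC θ).comp measurable_prodMk_left)]
  exact sub_eq_sub_iff_add_eq_add.1 (h.gradValue_sub k θ x).symm

theorem surrogateQ_succ_eq (θ : ↥Θ) (y : ℝ) (N : ℕ) (x : AugState S Z) (a : ↥A) :
    M.surrogateQ π θ k y (N + 1) x a =
      M.qValue π m k θ (x, a) + (N + 1 : ℕ) * (M.avgCost π m k θ - y) -
        ∫ x', ∫ z, M.value π m k θ z ∂((M.stateKernel π θ ^ N) x') ∂(M.augTrans (x, a)) := by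
  obtain ⟨⟨C, hC⟩, -⟩ := h.lipFamily_meanCost k
  obtain ⟨⟨D, hD⟩, -⟩ := h.lipFamily_value k
  have hmean (t : ℕ) := (hC θ).kernel (M.stateKernel π θ ^ t)
  have hexp (t : ℕ) : M.expCost π θ k (t + 1) x a - M.avgCost π m k θ =
      ∫ x', (∫ z, M.meanCost π θ k z ∂((M.stateKernel π θ ^ t) x') - M.avgCost π m k θ)
        ∂(M.augTrans (x, a)) := by
    rw [(hmean t).integral_sub_const, CMDP.expCost, M.iterKernel_eq,
      Kernel.integral_comp ((hC θ).integrable _)]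
  have htail : ∑ t ∈ Finset.range N, (M.expCost π θ k (t + 1) x a - M.avgCost π m k θ) =
      ∫ x', M.value π m k θ x' ∂(M.augTrans (x, a)) -
        ∫ x', ∫ z, M.value π m k θ z ∂((M.stateKernel π θ ^ N) x') ∂(M.augTrans (x, a)) := by
    rw [← integral_sub ((hD θ).integrable _) (((hD θ).kernel _).integrable _)]
    simp only [hexp]
    rw [← integral_finsetSum _ fun t _ => ((hmean t).sub (.const _)).integrable _]
    exact integral_congr_ae (ae_of_all _ fun x' =>
      ((h.ergodic θ).poisson_sub_integral_pow (hC θ) x' N).symm)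
  have hhead : M.expCost π θ k 0 x a = M.actionCost k (x, a) := rfl
  rw [Finset.sum_sub_distrib, Finset.sum_const, Finset.card_range, nsmul_eq_mul] at htail
  rw [CMDP.surrogateQ, Finset.sum_sub_distrib, Finset.sum_range_succ', hhead, Finset.sum_const,
    Finset.card_range, nsmul_eq_mul, CMDP.qValue]
  push_cast
  linarith

theorem exists_abs_surrogateQ_sub_le : ∃ C, ∀ (θ : ↥Θ) (y : ℝ) (T : ℕ)
    (x : AugState S Z) (a : ↥A), |M.surrogateQ π θ k y T x a -
      (M.qValue π m k θ (x, a) + T * (M.avgCost π m k θ - y))| ≤ C * ρ ^ T := by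
  have hρ := h.ρ_pos
  obtain ⟨⟨C, hC⟩, -⟩ := h.lipFamily_meanCost k
  obtain ⟨⟨F, hF⟩, -⟩ := h.lipFamily_qValue k
  set D := C * lam / (1 - ρ) * lam
  refine ⟨max (F : ℝ) (D / ρ), fun θ y T x a => ?_⟩
  rcases T with _ | N
  · simpa [CMDP.surrogateQ] using Or.inl ((hF θ).bound (x, a))
  · obtain ⟨⟨C', hC'⟩, -⟩ := h.lipFamily_value k
    have htail := BddMeas.norm_integral_le
      ⟨((hC' θ).kernel (M.stateKernel π θ ^ N)).meas, fun x' =>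
        (h.ergodic θ).norm_integral_pow_poisson_le (hC θ) x' N⟩ (M.augTrans (x, a))
    rw [h.surrogateQ_succ_eq, sub_sub_cancel_left, abs_neg]
    calc |∫ x', ∫ z, M.value π m k θ z ∂((M.stateKernel π θ ^ N) x') ∂(M.augTrans (x, a))|
        ≤ D * ρ ^ N := htail
      _ = D / ρ * ρ ^ (N + 1) := by rw [pow_succ]; field_simp
      _ ≤ max (F : ℝ) (D / ρ) * ρ ^ (N + 1) := by gcongr; exact le_max_right _ _

end RegularModel

end Values

section JointKernel

variable {nS nZ nA K n : ℕ} {S : Set (Euc nS)} {Z : Set (Euc nZ)} {A : Set (Euc nA)}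

/-- The policies as a kernel from parameters and augmented states to actions, which makes their
joint measurability in the parameter available. -/
def Policy.jointKernel (π : Policy S Z A n) : Kernel (Euc n × AugState S Z) ↥A :=
  haveI := π.ref_sigmaFinite
  Kernel.withDensity (Kernel.const (Euc n × AugState S Z) π.ref)
    (fun p a => ENNReal.ofReal (π.dens p.1 p.2 a))

theorem Policy.jointKernel_apply (π : Policy S Z A n) (p : Euc n × AugState S Z) :
    π.jointKernel p = π.kernel p.1 p.2 := by
  have := π.ref_sigmaFinite
  have hdens : Measurable (Function.uncurry fun x a => ENNReal.ofReal (π.dens p.1 x a)) :=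
    ENNReal.measurable_ofReal.comp
      (π.dens_measurable.comp (measurable_const.prodMk measurable_id))
  have hdens_joint : Measurable (Function.uncurry fun (p : Euc n × AugState S Z) a =>
      ENNReal.ofReal (π.dens p.1 p.2 a)) :=
    ENNReal.measurable_ofReal.comp (π.dens_measurable.comp
      (f := fun q : (Euc n × AugState S Z) × ↥A => (q.1.1, q.1.2, q.2)) (by fun_prop))
  rw [jointKernel, kernel, Kernel.withDensity_apply _ hdens_joint, Kernel.withDensity_apply _ hdens,
    Kernel.const_apply, Kernel.const_apply]

instance (π : Policy S Z A n) : IsMarkovKernel π.jointKernel :=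
  ⟨fun p => by rw [π.jointKernel_apply]; infer_instance⟩

/-- One step of the decision process as a kernel from parameters and augmented states. -/
def CMDP.jointStep (M : CMDP S Z A K) (π : Policy S Z A n) :
    Kernel (Euc n × AugState S Z) (↥A × AugState S Z) :=
  π.jointKernel ⊗ₖ M.augTrans.comap
    (fun q : (Euc n × AugState S Z) × ↥A => (q.1.2, q.2)) (by fun_prop)

instance (M : CMDP S Z A K) (π : Policy S Z A n) : IsMarkovKernel (M.jointStep π) := by
  unfold CMDP.jointStep
  infer_instance

theorem CMDP.jointStep_apply (M : CMDP S Z A K) (π : Policy S Z A n)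
    (p : Euc n × AugState S Z) : M.jointStep π p = M.stepKernel π p.1 p.2 := by
  ext U hU
  rw [jointStep, stepKernel, Kernel.compProd_apply hU, Kernel.compProd_apply hU,
    π.jointKernel_apply]
  rfl

end JointKernel

section Batch

variable {E : Type*} [NormedAddCommGroup E] [NormedSpace ℝ E] {B : ℕ}

/-- Average of a sequence over the `i`-th batch of `B` consecutive time slots. -/
def batchAvg (B : ℕ) (z : ℕ → E) (i : ℕ) : E :=
  (1 / (B : ℝ)) • ∑ j ∈ Finset.range B, z (B * i + j)

theorem norm_batchAvg_le {z : ℕ → E} {c : ℝ} {i : ℕ} (hc : 0 ≤ c)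
    (hz : ∀ j < B, ‖z (B * i + j)‖ ≤ c) : ‖batchAvg B z i‖ ≤ c := by
  have hsum := norm_sum_le_of_le (Finset.range B) fun j hj => hz j (Finset.mem_range.1 hj)
  rw [Finset.sum_const, Finset.card_range, nsmul_eq_mul] at hsum
  rw [batchAvg, norm_smul, Real.norm_of_nonneg (by positivity), one_div]
  calc (B : ℝ)⁻¹ * ‖∑ j ∈ Finset.range B, z (B * i + j)‖ ≤ (B : ℝ)⁻¹ * (B * c) := by gcongr
    _ ≤ c := by
        rw [← mul_assoc]
        exact mul_le_of_le_one_left hc inv_mul_le_one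

theorem slot_lt {i j : ℕ} (hj : j < B) : B * i + j < B * (i + 1) := by
  rw [mul_add]
  omega

theorem slot_div {i j : ℕ} (hj : j < B) : (B * i + j) / B = i := by
  rw [Nat.mul_add_div (by omega), Nat.div_eq_of_lt hj, add_zero]

theorem measurable_batchAvg {Ω : Type*} {_ : MeasurableSpace Ω} [MeasurableSpace E] [BorelSpace E]
    [SecondCountableTopology E] {f : ℕ → Ω → E} {i : ℕ}
    (hf : ∀ t, B * i ≤ t → t < B * (i + 1) → Measurable (f t)) :
    Measurable fun ω => batchAvg B (fun t => f t ω) i :=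
  (Finset.measurable_fun_sum _ fun _ hj =>
    hf _ (Nat.le_add_right _ _) (slot_lt (Finset.mem_range.1 hj))).const_smul _

theorem measurable_of_forall_succ_eq {Ω : Type*} {mΩ : MeasurableSpace Ω} [MeasurableSpace E]
    [BorelSpace E] [SecondCountableTopology E] (𝓕 : Filtration ℕ mΩ) {x y : ℕ → Ω → E}
    {α β : ℕ → ℝ} (hx : Measurable[𝓕 0] (x 0)) (hy : ∀ i, Measurable[𝓕 (B * (i + 1))] (y i))
    (hsucc : ∀ i ω, x (i + 1) ω = α i • x i ω + β i • y i ω) (i : ℕ) :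
    Measurable[𝓕 (B * i)] (x i) := by
  induction i with
  | zero => simpa using hx
  | succ i ih =>
    rw [show x (i + 1) = _ from funext (hsucc i)]
    exact ((ih.mono (𝓕.mono (Nat.mul_le_mul_left B i.le_succ)) le_rfl).const_smul (α i)).add
      ((hy i).const_smul (β i))

end Batch

theorem LipFamily.exists_bddMeas_uncurry {n : ℕ} {Θ : Set (Euc n)} {X E : Type*}
    [MeasurableSpace X] [NormedAddCommGroup E] {φ : ↥Θ → X → E} (h : LipFamily φ) :
    ∃ C : ℝ≥0, BddMeas (Function.uncurry φ) C := by
  obtain ⟨C, hC⟩ := h.bdd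
  exact ⟨C, h.stronglyMeasurable_uncurry, fun p => (hC p.1).bound p.2⟩

section Run

variable {nS nZ nA K n : ℕ} {S : Set (Euc nS)} {Z : Set (Euc nZ)} {A : Set (Euc nA)}
  {M : CMDP S Z A K} {π : Policy S Z A n} {Θ : Set (Euc n)} {q : ℕ}
  {Qnet : Fin (K + 1) → Euc q → AugState S Z → ↥A → ℝ} {μ η : ℕ → ℝ} {B : ℕ}
  {Ω : Type*} [mΩ : MeasurableSpace Ω] {P : Measure Ω}

namespace Run

variable (R : Run M π Θ Qnet μ η B P)

theorem θ_mem (hΘ : Convex ℝ Θ) (hμ : ∀ i, 0 ≤ μ i) (hμ' : ∀ i, μ i ≤ 1) (i : ℕ) (ω : Ω) :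
    R.θ i ω ∈ Θ := by
  induction i with
  | zero => exact R.θ_init_mem ω
  | succ i ih =>
    rw [R.θ_succ]
    exact hΘ ih (R.θbar_mem i ω) (sub_nonneg.2 (hμ' i)) (hμ i) (sub_add_cancel _ _)

theorem norm_θ_succ_sub_le (hmem : ∀ i ω, R.θ i ω ∈ Θ) (hμ : ∀ i, 0 ≤ μ i) {r : ℝ}
    (hr : ∀ θ ∈ Θ, ∀ θ' ∈ Θ, dist θ θ' ≤ r) (i : ℕ) (ω : Ω) :
    ‖R.θ (i + 1) ω - R.θ i ω‖ ≤ μ i * r := by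
  have hstep : R.θ (i + 1) ω - R.θ i ω = μ i • (R.θbar i ω - R.θ i ω) := by
    rw [R.θ_succ]
    module
  rw [hstep, norm_smul, Real.norm_of_nonneg (hμ i), ← dist_eq_norm]
  exact mul_le_mul_of_nonneg_left (hr _ (R.θbar_mem i ω) _ (hmem i ω)) (hμ i)

theorem measurable_of_adapted {β : Type*} [MeasurableSpace β] {t : ℕ} {f : Ω → β}
    (h : Measurable[R.𝓕 t] f) : Measurable f := h.mono (R.𝓕.le t) le_rfl

theorem measurable_s_of_le {t t' : ℕ} (h : t ≤ t') : Measurable[R.𝓕 t'] (R.s t) :=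
  (R.s_measurable t).mono (R.𝓕.mono h) le_rfl

theorem measurable_θ_of_le {i t : ℕ} (h : B * i ≤ t) : Measurable[R.𝓕 t] (R.θ i) :=
  (measurable_of_forall_succ_eq R.𝓕 R.θ_init_measurable R.θbar_measurable R.θ_succ i).mono
    (R.𝓕.mono h) le_rfl

/-- The outcome of a slot: the action drawn in it and the augmented state it leads to. -/
def outcome (t : ℕ) (ω : Ω) : ↥A × AugState S Z := (R.a t ω, R.s (t + 1) ω)

theorem measurable_outcome_of_lt {t t' : ℕ} (h : t < t') : Measurable[R.𝓕 t'] (R.outcome t) :=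
  ((R.a_measurable t).mono (R.𝓕.mono h) le_rfl).prodMk (R.measurable_s_of_le h)

theorem measurable_outcome (t : ℕ) : Measurable (R.outcome t) :=
  R.measurable_of_adapted (R.measurable_outcome_of_lt t.lt_succ_self)

theorem measurable_s (t : ℕ) : Measurable (R.s t) := R.measurable_of_adapted (R.s_measurable t)

theorem measure_inter_preimage_outcome [IsFiniteMeasure P] {t : ℕ} {D : Set Ω}
    (hD : MeasurableSet[R.𝓕 t] D) {U : Set (↥A × AugState S Z)} (hU : MeasurableSet U) :
    P (D ∩ R.outcome t ⁻¹' U) =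
      ∫⁻ ω in D, M.jointStep π (R.θ (t / B) ω, R.s t ω) U ∂P := by
  have hpast : Measurable fun ω => (R.θ (t / B) ω, R.s t ω) := R.measurable_of_adapted
    ((R.measurable_θ_of_le (Nat.mul_div_le t B)).prodMk (R.s_measurable t))
  have hUm : MeasurableSet ((fun ω => (R.a t ω, R.s (t + 1) ω)) ⁻¹' U) :=
    R.measurable_outcome t hU
  have hstep : Measurable fun ω => M.jointStep π (R.θ (t / B) ω, R.s t ω) U :=
    ((M.jointStep π).measurable_coe hU).comp hpast
  have hfinite : ∫⁻ ω in D, M.jointStep π (R.θ (t / B) ω, R.s t ω) U ∂P ≠ ∞ :=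
    ne_top_of_le_ne_top (measure_ne_top P D)
      ((lintegral_mono fun _ => prob_le_one).trans_eq (setLIntegral_one D))
  have hcond : P.real (D ∩ R.outcome t ⁻¹' U) =
      ∫ ω in D, (M.stepKernel π (R.θ (t / B) ω) (R.s t ω)).real U ∂P := by
    rw [← setIntegral_congr_ae (R.𝓕.le t D hD) ((R.law t U hU).mono fun ω h _ => h),
      setIntegral_condExp (R.𝓕.le t) ((integrable_const 1).indicator hUm) hD,
      setIntegral_indicator hUm, setIntegral_const, smul_eq_mul, mul_one]
    rfl
  rw [← ENNReal.toReal_eq_toReal_iff' (measure_ne_top _ _) hfinite,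
    ← integral_toReal hstep.aemeasurable (ae_of_all _ fun _ => measure_lt_top _ _)]
  simpa only [M.jointStep_apply, measureReal_def] using hcond

theorem map_prodMk_outcome [IsProbabilityMeasure P] {𝒴 : Type*} [MeasurableSpace 𝒴] {t : ℕ}
    {Y : Ω → 𝒴} (hY : Measurable[R.𝓕 t] Y) :
    P.map (fun ω => ((Y ω, R.θ (t / B) ω, R.s t ω), R.outcome t ω)) =
      P.map (fun ω => (Y ω, R.θ (t / B) ω, R.s t ω)) ⊗ₘ
        (M.jointStep π).comap Prod.snd measurable_snd := by
  have hpast : Measurable[R.𝓕 t] fun ω => (Y ω, R.θ (t / B) ω, R.s t ω) :=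
    hY.prodMk ((R.measurable_θ_of_le (Nat.mul_div_le t B)).prodMk (R.s_measurable t))
  have hpast' := R.measurable_of_adapted hpast
  have := Measure.isProbabilityMeasure_map (μ := P) hpast'.aemeasurable
  refine Measure.ext_prod fun {V U} hV hU => ?_
  rw [Measure.map_apply (hpast'.prodMk (R.measurable_outcome t)) (hV.prod hU),
    Measure.compProd_apply_prod hV hU, setLIntegral_map hV (Kernel.measurable_coe _ hU) hpast']
  exact R.measure_inter_preimage_outcome (hpast hV) hU

theorem integral_outcome [IsProbabilityMeasure P] {𝒴 F : Type*} [MeasurableSpace 𝒴]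
    [NormedAddCommGroup F] [NormedSpace ℝ F] {t : ℕ}
    {Y : Ω → 𝒴} (hY : Measurable[R.𝓕 t] Y) {φ : 𝒴 × (↥A × AugState S Z) → F}
    (hφ : StronglyMeasurable φ) (hint : Integrable (fun ω => φ (Y ω, R.outcome t ω)) P) :
    ∫ ω, φ (Y ω, R.outcome t ω) ∂P =
      ∫ ω, ∫ p, φ (Y ω, p) ∂(M.stepKernel π (R.θ (t / B) ω) (R.s t ω)) ∂P := by
  set ψ : (𝒴 × Euc n × AugState S Z) × (↥A × AugState S Z) → F := fun r => φ (r.1.1, r.2)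
  have hψ : StronglyMeasurable ψ := hφ.comp_measurable (by fun_prop)
  have hpast : Measurable fun ω => (Y ω, R.θ (t / B) ω, R.s t ω) := R.measurable_of_adapted
    (hY.prodMk ((R.measurable_θ_of_le (Nat.mul_div_le t B)).prodMk (R.s_measurable t)))
  have hjoint := hpast.prodMk (R.measurable_outcome t)
  have := Measure.isProbabilityMeasure_map (μ := P) hpast.aemeasurable
  have hψint := (integrable_map_measure hψ.aestronglyMeasurable hjoint.aemeasurable).2 hint
  have hmap := integral_map (μ := P) hjoint.aemeasurable hψ.aestronglyMeasurable
  rw [R.map_prodMk_outcome hY] at hψint hmap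
  rw [← hmap, Measure.integral_compProd hψint, integral_map hpast.aemeasurable
    hψ.integral_kernel_prod_right'.aestronglyMeasurable]
  simp only [Kernel.comap_apply, M.jointStep_apply, ψ]

/-- The parameter at iteration `i` as a point of `Θ`. -/
def param (hmem : ∀ i ω, R.θ i ω ∈ Θ) (i : ℕ) (ω : Ω) : ↥Θ := ⟨R.θ i ω, hmem i ω⟩

variable (hmem : ∀ i ω, R.θ i ω ∈ Θ)

theorem measurable_param_of_le {i t : ℕ} (h : B * i ≤ t) : Measurable[R.𝓕 t] (R.param hmem i) :=
  (R.measurable_θ_of_le h).subtype_mk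

theorem measurable_comp_param {X E : Type*} [MeasurableSpace X] [MeasurableSpace E]
    {φ : ↥Θ → X → E} (hφ : Measurable (Function.uncurry φ)) {i t : ℕ} (h : B * i ≤ t) {g : Ω → X}
    (hg : Measurable[R.𝓕 t] g) : Measurable[R.𝓕 t] fun ω => φ (R.param hmem i ω) (g ω) :=
  hφ.comp ((R.measurable_param_of_le hmem h).prodMk hg)

theorem bddMeas_param {X E : Type*} [MeasurableSpace X] [NormedAddCommGroup E] {φ : ↥Θ → X → E}
    {C : ℝ} (h : BddMeas (Function.uncurry φ) C) (i : ℕ) {g : Ω → X} (hg : Measurable g) :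
    BddMeas (fun ω => φ (R.param hmem i ω) (g ω)) C :=
  h.comp (g := fun ω => (R.param hmem i ω, g ω))
    ((R.measurable_of_adapted (R.measurable_param_of_le hmem le_rfl)).prodMk hg)

theorem integral_inner_outcome [IsProbabilityMeasure P] {E : Type*} [NormedAddCommGroup E]
    [InnerProductSpace ℝ E] [CompleteSpace E] [MeasurableSpace E] [BorelSpace E]
    [SecondCountableTopology E] {i j : ℕ} (hj : j < B) {W : Ω → E} {w : ℝ}
    (hW : Measurable[R.𝓕 (B * i + j)] W) (hw : ∀ ω, ‖W ω‖ ≤ w)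
    {G : ↥Θ → AugState S Z × ↥A × AugState S Z → E} {C : ℝ}
    (hG : BddMeas (Function.uncurry G) C) :
    ∫ ω, inner ℝ (W ω)
        (G (R.param hmem i ω) (R.s (B * i + j) ω, R.outcome (B * i + j) ω)) ∂P =
      ∫ ω, inner ℝ (W ω) (∫ p, G (R.param hmem i ω) (R.s (B * i + j) ω, p)
        ∂(M.stepKernel π (R.θ i ω) (R.s (B * i + j) ω))) ∂P := by
  have hY := (hW.prodMk (R.measurable_param_of_le hmem (Nat.le_add_right (B * i) j))).prodMk
    (R.s_measurable (B * i + j))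
  have hφ : StronglyMeasurable fun r : ((E × ↥Θ) × AugState S Z) × ↥A × AugState S Z =>
      (inner ℝ r.1.1.1 (G r.1.1.2 (r.1.2, r.2)) : ℝ) :=
    StronglyMeasurable.inner (by fun_prop) (hG.meas.comp_measurable
      (g := fun r : ((E × ↥Θ) × AugState S Z) × ↥A × AugState S Z => (r.1.1.2, r.1.2, r.2))
      (by fun_prop))
  have hbdd := R.bddMeas_param hmem hG i
    ((R.measurable_s (B * i + j)).prodMk (R.measurable_outcome (B * i + j)))
  have hWm : StronglyMeasurable W := (R.measurable_of_adapted hW).stronglyMeasurable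
  refine (R.integral_outcome hY hφ
    ((BddMeas.inner ⟨hWm, hw⟩ hbdd).integrable P)).trans ?_
  simp only [slot_div hj]
  exact integral_congr_ae (ae_of_all _ fun ω => integral_inner ((hG.comp (g := fun p =>
    (R.param hmem i ω, R.s (B * i + j) ω, p)) (by fun_prop)).integrable _) (W ω))

end Run

end Run

section PoissonSolution

variable {nS nZ nA K n : ℕ} {S : Set (Euc nS)} {Z : Set (Euc nZ)} {A : Set (Euc nA)}
  {M : CMDP S Z A K} {π : Policy S Z A n} {Θ : Set (Euc n)}
  {E : Type*} [NormedAddCommGroup E] [NormedSpace ℝ E]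

/-- `u` solves Poisson's equation for the samples `H` of one time slot, which are functions of the
augmented state, the action and the next augmented state, and have stationary mean `F`. All three
are Lipschitz families. -/
structure PoissonSolution (M : CMDP S Z A K) (π : Policy S Z A n)
    (H : ↥Θ → AugState S Z × ↥A × AugState S Z → E) (u : ↥Θ → AugState S Z → E)
    (F : ↥Θ → E) : Prop where
  sample : LipFamily H
  value : LipFamily u
  mean : LipFamily fun θ (_ : AugState S Z) => F θ
  eq : ∀ (θ : ↥Θ) x, ∫ p, H θ (x, p) ∂(M.stepKernel π θ x) +
    ∫ y, u θ y ∂(M.stateKernel π θ x) = u θ x + F θ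

/-- The increment of Poisson's equation along a transition. It has mean zero under the policy. -/
def poissonIncrement (H : ↥Θ → AugState S Z × ↥A × AugState S Z → E)
    (u : ↥Θ → AugState S Z → E) (F : ↥Θ → E) (θ : ↥Θ) (p : AugState S Z × ↥A × AugState S Z) : E :=
  H θ p + u θ p.2.2 - (u θ p.1 + F θ)

namespace PoissonSolution

variable {H : ↥Θ → AugState S Z × ↥A × AugState S Z → E} {u : ↥Θ → AugState S Z → E} {F : ↥Θ → E}
  (h : PoissonSolution M π H u F)
include h

theorem lipFamily_poissonIncrement : LipFamily (poissonIncrement H u F) :=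
  (h.sample.add (h.value.comp (measurable_snd.comp measurable_snd))).sub
    ((h.value.comp measurable_fst).add (h.mean.comp measurable_fst))

theorem integral_poissonIncrement [CompleteSpace E] (θ : ↥Θ) (x : AugState S Z) :
    ∫ p, poissonIncrement H u F θ (x, p) ∂(M.stepKernel π θ x) = 0 := by
  obtain ⟨⟨C, hC⟩, -⟩ := h.sample
  obtain ⟨⟨D, hD⟩, -⟩ := h.value
  have hsample : BddMeas (fun p => H θ (x, p)) C := (hC θ).comp measurable_prodMk_left
  have hnext : BddMeas (fun p : ↥A × AugState S Z => u θ p.2) D := (hD θ).comp measurable_snd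
  have heq := h.eq θ x
  rw [M.integral_stateKernel π θ x (hD θ),
    ← integral_add (hsample.integrable _) (hnext.integrable _)] at heq
  exact (BddMeas.integral_sub_const (hsample.add hnext) (u θ x + F θ) _).trans
    (by rw [heq, sub_self])

end PoissonSolution

end PoissonSolution

namespace Run

variable {nS nZ nA K n : ℕ} {S : Set (Euc nS)} {Z : Set (Euc nZ)} {A : Set (Euc nA)}
  {M : CMDP S Z A K} {π : Policy S Z A n} {Θ : Set (Euc n)} {q : ℕ}
  {Qnet : Fin (K + 1) → Euc q → AugState S Z → ↥A → ℝ} {μ η : ℕ → ℝ} {B : ℕ}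
  {Ω : Type*} [mΩ : MeasurableSpace Ω] {P : Measure Ω} (R : Run M π Θ Qnet μ η B P)
  (hmem : ∀ i ω, R.θ i ω ∈ Θ)

section Batch

variable {E : Type*} [NormedAddCommGroup E] [NormedSpace ℝ E]

/-- Batch average of a function of the parameter and of the transitions of iteration `i`. -/
def batch (H : ↥Θ → AugState S Z × ↥A × AugState S Z → E) (i : ℕ) (ω : Ω) : E :=
  batchAvg B (fun t => H (R.param hmem i ω) (R.s t ω, R.outcome t ω)) i

theorem bddMeas_batch {H : ↥Θ → AugState S Z × ↥A × AugState S Z → E} {C : ℝ}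
    (hH : BddMeas (Function.uncurry H) C) (i : ℕ) : BddMeas (R.batch hmem H i) C := by
  have hslot (t : ℕ) := R.bddMeas_param hmem hH i
    ((R.measurable_s t).prodMk (R.measurable_outcome t))
  exact ⟨(Finset.stronglyMeasurable_fun_sum _ fun j _ => (hslot _).meas).const_smul _,
    fun ω => norm_batchAvg_le
    ((norm_nonneg _).trans ((hslot 0).bound ω)) fun j _ => (hslot (B * i + j)).bound ω⟩

theorem batch_sub_eq (hB : 0 < B) (H : ↥Θ → AugState S Z × ↥A × AugState S Z → E)
    (u : ↥Θ → AugState S Z → E) (F : ↥Θ → E) (i : ℕ) (ω : Ω) :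
    R.batch hmem H i ω - F (R.param hmem i ω) =
      (1 / (B : ℝ)) • u (R.param hmem i ω) (R.s (B * i) ω) -
        (1 / (B : ℝ)) • u (R.param hmem i ω) (R.s (B * (i + 1)) ω) +
      R.batch hmem (poissonIncrement H u F) i ω := by
  have hB' : (B : ℝ) ≠ 0 := Nat.cast_ne_zero.2 hB.ne'
  have htelescope := Finset.sum_range_sub (fun j => u (R.param hmem i ω) (R.s (B * i + j) ω)) B
  simp only [batch, batchAvg, poissonIncrement, outcome, Finset.sum_sub_distrib,
    Finset.sum_add_distrib, Finset.sum_const, Finset.card_range, ← Nat.cast_smul_eq_nsmul ℝ,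
    ← add_assoc, add_zero, mul_add_one] at htelescope ⊢
  rw [sub_eq_iff_eq_add] at htelescope
  rw [htelescope]
  simp only [smul_add, smul_sub, smul_smul, one_div_mul_cancel hB', one_smul]
  abel

end Batch

variable {E : Type*} [NormedAddCommGroup E] [InnerProductSpace ℝ E] [CompleteSpace E]
  [MeasurableSpace E] [BorelSpace E] [SecondCountableTopology E] [IsProbabilityMeasure P]
  {H : ↥Θ → AugState S Z × ↥A × AugState S Z → E} {u : ↥Θ → AugState S Z → E} {F : ↥Θ → E}
  (hsol : PoissonSolution M π H u F) {i : ℕ} {W : Ω → E} {w : ℝ}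
include hsol

theorem integral_inner_batch_poissonIncrement (hW : Measurable[R.𝓕 (B * i)] W)
    (hw : ∀ ω, ‖W ω‖ ≤ w) :
    ∫ ω, inner ℝ (W ω) (R.batch hmem (poissonIncrement H u F) i ω) ∂P = 0 := by
  obtain ⟨C, hC⟩ := hsol.lipFamily_poissonIncrement.exists_bddMeas_uncurry
  have hW' : BddMeas W w := ⟨(R.measurable_of_adapted hW).stronglyMeasurable, hw⟩
  have hslot (t : ℕ) := hW'.inner
    (R.bddMeas_param hmem hC i ((R.measurable_s t).prodMk (R.measurable_outcome t)))
  simp only [batch, batchAvg, inner_smul_right, inner_sum]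
  rw [integral_const_mul, integral_finsetSum _ fun j _ => (hslot _).integrable P,
    Finset.sum_eq_zero fun j hj => ?_, mul_zero]
  rw [R.integral_inner_outcome hmem (Finset.mem_range.1 hj)
    (hW.mono (R.𝓕.mono (Nat.le_add_right _ _)) le_rfl) hw hC]
  have hzero (ω : Ω) := hsol.integral_poissonIncrement (R.param hmem i ω) (R.s (B * i + j) ω)
  simp only [param] at hzero ⊢
  simp only [hzero, inner_zero_right, integral_zero]

-- The solution of Poisson's equation turns the bias of a batch average into a difference.
theorem integral_inner_batch_sub (hB : 0 < B) (hW : Measurable[R.𝓕 (B * i)] W)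
    (hw : ∀ ω, ‖W ω‖ ≤ w) :
    ∫ ω, inner ℝ (W ω) (R.batch hmem H i ω - F (R.param hmem i ω)) ∂P =
      ∫ ω, inner ℝ (W ω) ((1 / (B : ℝ)) • u (R.param hmem i ω) (R.s (B * i) ω) -
        (1 / (B : ℝ)) • u (R.param hmem i ω) (R.s (B * (i + 1)) ω)) ∂P := by
  obtain ⟨C, hC⟩ := hsol.lipFamily_poissonIncrement.exists_bddMeas_uncurry
  obtain ⟨D, hD⟩ := hsol.value.exists_bddMeas_uncurry
  have hW' : BddMeas W w := ⟨(R.measurable_of_adapted hW).stronglyMeasurable, hw⟩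
  have hvalue (t : ℕ) := BddMeas.smul (.const (1 / (B : ℝ)))
    (R.bddMeas_param hmem hD i (R.measurable_s t))
  simp only [R.batch_sub_eq hmem hB H u F, inner_add_right]
  rw [integral_add ((hW'.inner ((hvalue _).sub (hvalue _))).integrable P)
    ((hW'.inner (R.bddMeas_batch hmem hC i)).integrable P),
    R.integral_inner_batch_poissonIncrement hmem hsol hW hw, add_zero]

end Run

section TwoTimescale

/-- Step sizes of a stochastic approximation on two timescales: the parameters move with the steps
`μ`, which vanish faster than the steps `η` of their estimators. -/
structure TwoTimescale (μ η : ℕ → ℝ) : Prop where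
  μ_nonneg : ∀ i, 0 ≤ μ i
  μ_le_one : ∀ i, μ i ≤ 1
  η_pos : ∀ i, 0 < η i
  η_antitone : Antitone η
  η_tendsto : Tendsto η atTop (𝓝 0)
  ratio : Tendsto (fun i => μ i / η i) atTop (𝓝 0)
  inv : Tendsto (fun N : ℕ => 1 / (1 + (N : ℝ)) * (1 / η (N + 1))) atTop (𝓝 0)

variable {μ η : ℕ → ℝ}

theorem StepSizes.twoTimescale (h : StepSizes μ η) : TwoTimescale μ η where
  μ_nonneg i := (h.μ_pos i).le
  μ_le_one := h.μ_le_one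
  η_pos := h.η_pos
  η_antitone := h.η_antitone
  η_tendsto := h.η_tendsto
  ratio := h.ratio
  inv := by
    obtain ⟨r, -, hr, hO⟩ := h.η_inv
    have hpow : Tendsto (fun N : ℕ => (N : ℝ)⁻¹ * (N : ℝ) ^ r) atTop (𝓝 0) := by
      refine ((tendsto_rpow_neg_atTop (sub_pos.2 hr)).comp tendsto_natCast_atTop_atTop).congr' ?_
      filter_upwards [eventually_gt_atTop 0] with N hN
      rw [Function.comp_apply, ← Real.rpow_neg_one, ← Real.rpow_add (Nat.cast_pos.2 hN)]
      ring_nf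
    have hinv : Tendsto (fun N : ℕ => (N : ℝ)⁻¹ * (1 / η N)) atTop (𝓝 0) :=
      ((Asymptotics.isBigO_refl _ _).mul hO).trans_tendsto hpow
    simpa [Function.comp_def, add_comm] using hinv.comp (tendsto_add_atTop_nat 1)

/-- Contribution of step `i` to the accumulated squared error of a stochastic approximation. -/
def stepCost (μ η : ℕ → ℝ) (i : ℕ) : ℝ :=
  μ i ^ 2 / η i ^ 2 + μ i + η (i + 1) + (1 / η (i + 1) - 1 / η i)

/-- The sum of the step-size terms that bounds the accumulated squared error of a stochastic
approximation. -/
def budget (μ η : ℕ → ℝ) (N : ℕ) : ℝ := 1 / η 0 + ∑ i ∈ Finset.range (N + 1), stepCost μ η i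

theorem budget_eq (μ η : ℕ → ℝ) (N : ℕ) : budget μ η N =
    1 / η (N + 1) + ∑ i ∈ Finset.range (N + 1), (μ i ^ 2 / η i ^ 2 + μ i + η (i + 1)) := by
  simp only [budget, stepCost]
  rw [Finset.sum_add_distrib, Finset.sum_range_sub fun i => 1 / η i]
  ring

namespace TwoTimescale

variable (h : TwoTimescale μ η)
include h

theorem η_le_zero (i : ℕ) : η i ≤ η 0 := h.η_antitone i.zero_le

theorem abs_one_sub_le (i : ℕ) : |1 - η i| ≤ 1 + η 0 := by
  have hpos := h.η_pos i
  have hle := h.η_le_zero i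
  rw [abs_le]
  constructor <;> linarith

theorem inv_sub_nonneg (i : ℕ) : 0 ≤ 1 / η (i + 1) - 1 / η i :=
  sub_nonneg.2 (one_div_le_one_div_of_le (h.η_pos _) (h.η_antitone i.le_succ))

theorem η_sub_eq (i : ℕ) : η i - η (i + 1) = η (i + 1) * (η i * (1 / η (i + 1) - 1 / η i)) := by
  have hi := (h.η_pos i).ne'
  have hi' := (h.η_pos (i + 1)).ne'
  field_simp

theorem add_le_mul_stepCost {a b c d : ℝ} (ha : 0 ≤ a) (hb : 0 ≤ b) (hc : 0 ≤ c) (hd : 0 ≤ d)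
    (i : ℕ) : a * (μ i ^ 2 / η i ^ 2) + b * μ i + c * η (i + 1) + d * (1 / η (i + 1) - 1 / η i) ≤
      (a + b + c + d) * stepCost μ η i := by
  have hsq : 0 ≤ μ i ^ 2 / η i ^ 2 := by positivity
  have hμ := h.μ_nonneg i
  have hη := (h.η_pos (i + 1)).le
  have hinv := h.inv_sub_nonneg i
  rw [add_mul, add_mul, add_mul]
  unfold stepCost
  gcongr <;> linarith

theorem stepCost_nonneg (i : ℕ) : 0 ≤ stepCost μ η i := by
  simpa using h.add_le_mul_stepCost le_rfl zero_le_one le_rfl le_rfl i |>.trans' (by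
    simpa using h.μ_nonneg i)

theorem inv_le_budget (N : ℕ) : 1 / η 0 ≤ budget μ η N :=
  le_add_of_nonneg_right (Finset.sum_nonneg fun i _ => h.stepCost_nonneg i)

theorem budget_nonneg (N : ℕ) : 0 ≤ budget μ η N :=
  (one_div_nonneg.2 (h.η_pos 0).le).trans (h.inv_le_budget N)

theorem μ_tendsto : Tendsto μ atTop (𝓝 0) := by
  have hprod := h.ratio.mul h.η_tendsto
  rw [mul_zero] at hprod
  exact hprod.congr fun i => div_mul_cancel₀ _ (h.η_pos i).ne'

theorem tendsto_budget :
    Tendsto (fun N : ℕ => 1 / (1 + (N : ℝ)) * budget μ η N) atTop (𝓝 0) := by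
  have hterm : Tendsto (fun i => μ i ^ 2 / η i ^ 2 + μ i + η (i + 1)) atTop (𝓝 0) := by
    simpa [div_pow, Function.comp_def] using
      ((h.ratio.pow 2).add h.μ_tendsto).add (h.η_tendsto.comp (tendsto_add_atTop_nat 1))
  have hsum := h.inv.add (hterm.cesaro.comp (tendsto_add_atTop_nat 1))
  rw [add_zero] at hsum
  refine hsum.congr fun N => ?_
  simp only [Function.comp_apply, budget_eq, mul_add, one_div, Nat.cast_add_one,
    add_comm (N : ℝ) 1]

end TwoTimescale

end TwoTimescale

section Boundedness

variable {μ η : ℕ → ℝ}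

namespace TwoTimescale

variable (h : TwoTimescale μ η) {r : ℕ → ℝ} {b c : ℝ}
  (hr : ∀ i, r (i + 1) ≤ |1 - η (i + 1)| * r i + η i * c)
include h hr

theorem le_pow_mul_of_succ_le (hc : 0 ≤ c) (hr_nonneg : ∀ i, 0 ≤ r i) (hb : r 0 ≤ b) (i : ℕ) :
    r i + c ≤ (1 + η 0) ^ i * (b + c) := by
  induction i with
  | zero => simpa using hb
  | succ i ih =>
    calc r (i + 1) + c ≤ (1 + η 0) * r i + η 0 * c + c := by
          grw [hr i, h.abs_one_sub_le, h.η_le_zero i]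
          exact hr_nonneg i
      _ = (1 + η 0) * (r i + c) := by ring
      _ ≤ (1 + η 0) ^ (i + 1) * (b + c) := by
          rw [pow_succ', mul_assoc]
          exact mul_le_mul_of_nonneg_left ih (by linarith [h.η_pos 0])

-- Once `η ≤ 1`, a bound of the form `T - c * η i` propagates: the term `c * η i` absorbs the
-- mismatch between the two weights.
theorem add_mul_le_of_succ_le {i₀ : ℕ} (hi₀ : η i₀ ≤ 1) {T : ℝ} (hT : r i₀ + c * η i₀ ≤ T)
    (hc : 0 ≤ c) (hcT : c * (1 + η 0) ≤ T) {i : ℕ} (hi : i₀ ≤ i) : r i + c * η i ≤ T := by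
  induction i, hi using Nat.le_induction with
  | base => exact hT
  | succ i hi ih =>
    have hsmall : 0 ≤ 1 - η (i + 1) :=
      sub_nonneg.2 ((h.η_antitone (hi.trans i.le_succ)).trans hi₀)
    have hstep := hr i
    rw [abs_of_nonneg hsmall] at hstep
    have hprev := mul_le_mul_of_nonneg_left (le_sub_iff_add_le.2 ih) hsmall
    have hgap : 0 ≤ η (i + 1) * (T - c * (1 + η i)) := mul_nonneg (h.η_pos _).le
      (sub_nonneg.2 ((mul_le_mul_of_nonneg_left (by linarith [h.η_le_zero i]) hc).trans hcT))
    linarith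

end TwoTimescale

variable {E : Type*} [NormedAddCommGroup E]

theorem TwoTimescale.exists_bound [NormedSpace ℝ E] (h : TwoTimescale μ η) (b c : ℝ) :
    ∃ G, ∀ x y : ℕ → E, ‖x 0‖ ≤ b → (∀ i, ‖y i‖ ≤ c) →
      (∀ i, x (i + 1) = (1 - η (i + 1)) • x i + η i • y i) → ∀ i, ‖x i‖ ≤ G := by
  obtain ⟨i₀, hi₀⟩ := (h.η_tendsto.eventually (ge_mem_nhds zero_lt_one)).exists
  have hη := h.η_pos 0
  refine ⟨(1 + η 0) ^ i₀ * (b + c) + c * η 0, fun x y hb hy hx i => ?_⟩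
  have hc : 0 ≤ c := (norm_nonneg _).trans (hy 0)
  have hbc : c ≤ b + c := le_add_of_nonneg_left ((norm_nonneg _).trans hb)
  have hr (i : ℕ) : ‖x (i + 1)‖ ≤ |1 - η (i + 1)| * ‖x i‖ + η i * c := by
    rw [hx]
    refine (norm_add_le _ _).trans (add_le_add (norm_smul _ _).le ?_)
    rw [norm_smul, Real.norm_of_nonneg (h.η_pos i).le]
    exact mul_le_mul_of_nonneg_left (hy i) (h.η_pos i).le
  have hpow (i : ℕ) := h.le_pow_mul_of_succ_le hr hc (fun i => norm_nonneg _) hb i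
  rcases le_total i i₀ with hi | hi
  · have hmono : (1 + η 0) ^ i * (b + c) ≤ (1 + η 0) ^ i₀ * (b + c) :=
      mul_le_mul_of_nonneg_right (pow_le_pow_right₀ (by linarith) hi) (hc.trans hbc)
    linarith [hpow i, mul_nonneg hc hη.le]
  · have hone : b + c ≤ (1 + η 0) ^ i₀ * (b + c) :=
      le_mul_of_one_le_left (hc.trans hbc) (one_le_pow₀ (by linarith))
    have htail := h.add_mul_le_of_succ_le (r := fun i => ‖x i‖) hr hi₀
      (T := (1 + η 0) ^ i₀ * (b + c) + c * η 0)
      (by linarith [hpow i₀, mul_le_mul_of_nonneg_left (h.η_le_zero i₀) hc])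
      hc (by linarith) hi
    linarith [mul_nonneg hc (h.η_pos i).le]

end Boundedness

section Recursion

variable {μ η : ℕ → ℝ} {E : Type*} [NormedAddCommGroup E] [InnerProductSpace ℝ E]

/-- A stochastic approximation recursion: `x` are the estimates of the slowly moving targets `F`,
`y` are the samples, and `v i`, `v' i` are the values of a slowly moving function at the beginning
and at the end of step `i`. -/
structure Recursion (μ η : ℕ → ℝ) (G L : ℝ) (x F y v v' : ℕ → E) : Prop where
  succ : ∀ i, x (i + 1) = (1 - η (i + 1)) • x i + η i • y i
  x_le : ∀ i, ‖x i‖ ≤ G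
  F_le : ∀ i, ‖F i‖ ≤ G
  y_le : ∀ i, ‖y i‖ ≤ G
  v_le : ∀ i, ‖v i‖ ≤ G
  v'_le : ∀ i, ‖v' i‖ ≤ G
  F_lip : ∀ i, ‖F (i + 1) - F i‖ ≤ L * μ i
  v_lip : ∀ i, ‖v (i + 1) - v' i‖ ≤ L * μ i

theorem abs_mul_inner_le {a k c d : ℝ} {e w : E} (ha : |a| ≤ k) (he : ‖e‖ ≤ c) (hw : ‖w‖ ≤ d) :
    |a * inner ℝ e w| ≤ k * (c * d) := by
  rw [abs_mul]
  exact mul_le_mul ha ((abs_real_inner_le_norm e w).trans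
    (mul_le_mul he hw (norm_nonneg w) ((norm_nonneg e).trans he)))
    (abs_nonneg _) ((abs_nonneg a).trans ha)

theorem integral_mul_sub_le {Ω : Type*} [MeasurableSpace Ω] {P : Measure Ω} {a k : ℝ}
    {f g : Ω → ℝ} (ha : |a| ≤ k) (hf : Integrable f P) (hg : Integrable g P) :
    ∫ ω, 2 * (a * (f ω - g ω)) ∂P ≤ 2 * k * |∫ ω, f ω ∂P - ∫ ω, g ω ∂P| := by
  rw [integral_const_mul, integral_const_mul, integral_sub hf hg, mul_assoc]
  refine mul_le_mul_of_nonneg_left ((le_abs_self _).trans ?_) zero_le_two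
  rw [abs_mul]
  exact mul_le_mul_of_nonneg_right ha (abs_nonneg _)

theorem norm_sq_relax_le {h k : ℝ} (hk : |1 - h| ≤ k) (e ξ d : E) :
    ‖(1 - h) • e + (h • ξ + d)‖ ^ 2 ≤ (1 - h) ^ 2 * ‖e‖ ^ 2 + 2 * h * ((1 - h) * inner ℝ e ξ) +
      2 * (k * (‖e‖ * ‖d‖)) + 2 * (h ^ 2 * ‖ξ‖ ^ 2) + 2 * ‖d‖ ^ 2 := by
  have hnoise : ‖h • ξ + d‖ ^ 2 ≤ 2 * (h ^ 2 * ‖ξ‖ ^ 2) + 2 * ‖d‖ ^ 2 := by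
    have hpar := parallelogram_law_with_norm ℝ (h • ξ) d
    have hsmul : ‖h • ξ‖ ^ 2 = h ^ 2 * ‖ξ‖ ^ 2 := by
      rw [norm_smul, mul_pow, Real.norm_eq_abs, sq_abs]
    nlinarith [mul_self_nonneg ‖h • ξ - d‖]
  have hcross := (le_abs_self _).trans (abs_mul_inner_le hk (le_refl ‖e‖) (le_refl ‖d‖))
  rw [norm_add_sq_real, norm_smul, mul_pow, Real.norm_eq_abs, sq_abs, real_inner_smul_left,
    inner_add_right, real_inner_smul_right]
  linarith

namespace Recursion

/-- The part of the change of the error in step `i` that is caused by the motion of the target and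
by the difference between the two step sizes in the recursion. -/
def drift (η : ℕ → ℝ) (F y : ℕ → E) (i : ℕ) : E :=
  (η i - η (i + 1)) • y i - (F (i + 1) - F i)

variable {G L : ℝ} {x F y v v' : ℕ → E} (r : Recursion μ η G L x F y v v')
include r

theorem G_nonneg : 0 ≤ G := (norm_nonneg _).trans (r.x_le 0)

theorem norm_err_le (i : ℕ) : ‖x i - F i‖ ≤ 2 * G := by
  linarith [norm_sub_le (x i) (F i), r.x_le i, r.F_le i]

theorem norm_noise_le (i : ℕ) : ‖y i - F i‖ ≤ 2 * G := by
  linarith [norm_sub_le (y i) (F i), r.y_le i, r.F_le i]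

theorem err_succ (i : ℕ) : x (i + 1) - F (i + 1) = (1 - η (i + 1)) • (x i - F i) +
    (η (i + 1) • (y i - F i) + drift η F y i) := by
  rw [r.succ, drift]
  module

variable (h : TwoTimescale μ η)
include h

theorem norm_drift_le (i : ℕ) :
    ‖drift η F y i‖ ≤ (η i - η (i + 1)) * G + L * μ i := by
  have hη := sub_nonneg.2 (h.η_antitone i.le_succ)
  refine (norm_sub_le _ _).trans (add_le_add ?_ (r.F_lip i))
  rw [norm_smul, Real.norm_of_nonneg hη]
  exact mul_le_mul_of_nonneg_left (r.y_le i) hη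

variable (hL : 0 ≤ L)
include hL

theorem norm_drift_le_const (i : ℕ) :
    ‖drift η F y i‖ ≤ η 0 * G + L := by
  have hη : η i - η (i + 1) ≤ η 0 := by linarith [h.η_le_zero i, h.η_pos (i + 1)]
  exact (r.norm_drift_le h i).trans (add_le_add (mul_le_mul_of_nonneg_right hη r.G_nonneg)
    (mul_le_of_le_one_right hL (h.μ_le_one i)))

theorem norm_drift_le_mul (i : ℕ) :
    ‖drift η F y i‖ ≤
      η (i + 1) * (L * (μ i / η i) + (η 0 * G + L) * (1 / η (i + 1) - 1 / η i)) := by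
  have hη := (h.η_pos (i + 1)).le
  have hinv := h.inv_sub_nonneg i
  have hG := r.G_nonneg
  have hμ : μ i = η (i + 1) * (μ i / η i + μ i * (1 / η (i + 1) - 1 / η i)) := by
    field_simp [(h.η_pos i).ne', (h.η_pos (i + 1)).ne']
    ring
  calc _ ≤ (η i - η (i + 1)) * G + L * μ i := r.norm_drift_le h i
    _ = η (i + 1) * (L * (μ i / η i) + (η i * G + L * μ i) * (1 / η (i + 1) - 1 / η i)) := by
        rw [h.η_sub_eq]
        nth_rewrite 1 [hμ]
        ring
    _ ≤ _ := by
        gcongr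
        exacts [h.η_le_zero i, mul_le_of_le_one_right hL (h.μ_le_one i)]

theorem norm_drift_mul_le (i : ℕ) :
    ‖drift η F y i‖ * (L * (μ i / η i) + (η 0 * G + L) * (1 / η (i + 1) - 1 / η i)) ≤
      η 0 * L ^ 2 * (μ i / η i) ^ 2 +
        (η 0 * G + 2 * L) * (η 0 * G + L) * (1 / η (i + 1) - 1 / η i) := by
  have hinv := h.inv_sub_nonneg i
  have := (h.η_pos (i + 1)).le
  have hη0 := (h.η_pos 0).le
  have hG := r.G_nonneg
  have hμ := div_nonneg (h.μ_nonneg i) (h.η_pos i).le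
  have hratio : η (i + 1) * (μ i / η i) ≤ 1 :=
    (mul_le_mul_of_nonneg_right (h.η_antitone i.le_succ) hμ).trans
      ((mul_div_cancel₀ _ (h.η_pos i).ne').trans_le (h.μ_le_one i))
  set ρ := μ i / η i
  set κ := 1 / η (i + 1) - 1 / η i
  set D := η 0 * G + L with hD
  have : 0 ≤ D := by positivity
  calc ‖drift η F y i‖ * (L * ρ + D * κ)
      = ‖drift η F y i‖ * (L * ρ) + ‖drift η F y i‖ * (D * κ) := mul_add _ _ _
    _ ≤ η (i + 1) * (L * ρ + D * κ) * (L * ρ) + D * (D * κ) := by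
        gcongr
        exacts [r.norm_drift_le_mul h hL i, r.norm_drift_le_const h hL i]
    _ = η (i + 1) * (L ^ 2 * ρ ^ 2) + η (i + 1) * ρ * (L * D * κ) + D * (D * κ) := by ring
    _ ≤ η 0 * (L ^ 2 * ρ ^ 2) + 1 * (L * D * κ) + D * (D * κ) := by
        gcongr
        exact h.η_le_zero (i + 1)
    _ = η 0 * L ^ 2 * ρ ^ 2 + (η 0 * G + 2 * L) * D * κ := by
        rw [hD]
        ring

omit hL in
theorem sq_err_succ_le {i : ℕ} {δ : ℝ} (hδ : ‖drift η F y i‖ ≤ η (i + 1) * δ) :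
    ‖x (i + 1) - F (i + 1)‖ ^ 2 * (1 / η (i + 1)) ≤
      ‖x i - F i‖ ^ 2 * (1 / η (i + 1)) - 2 * ‖x i - F i‖ ^ 2 + 12 * G ^ 2 * η (i + 1) +
      2 * ((1 - η (i + 1)) * inner ℝ (x i - F i) (y i - F i)) +
      2 * ((1 + η 0) * (‖x i - F i‖ * δ)) + 2 * (‖drift η F y i‖ * δ) := by
  have hpos := h.η_pos (i + 1)
  have hη0 := h.η_pos 0
  have hrelax := norm_sq_relax_le (h.abs_one_sub_le (i + 1)) (x i - F i) (y i - F i)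
    (drift η F y i)
  rw [← r.err_succ i] at hrelax
  have hcross := mul_le_mul_of_nonneg_left
    (mul_le_mul_of_nonneg_left hδ (norm_nonneg (x i - F i))) (by positivity : 0 ≤ 2 * (1 + η 0))
  have hsq := mul_le_mul_of_nonneg_left hδ (norm_nonneg (drift η F y i))
  have herr := mul_le_mul_of_nonneg_left
    (pow_le_pow_left₀ (norm_nonneg _) (r.norm_err_le i) 2) (sq_nonneg (η (i + 1)))
  have hnoise := mul_le_mul_of_nonneg_left
    (pow_le_pow_left₀ (norm_nonneg _) (r.norm_noise_le i) 2) (sq_nonneg (η (i + 1)))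
  rw [mul_one_div, div_le_iff₀ hpos]
  have hcancel : ‖x i - F i‖ ^ 2 * (1 / η (i + 1)) * η (i + 1) = ‖x i - F i‖ ^ 2 := by
    rw [mul_assoc, one_div_mul_cancel hpos.ne', mul_one]
  linarith

theorem sq_err_le (i : ℕ) :
    ‖x i - F i‖ ^ 2 ≤
      (‖x i - F i‖ ^ 2 * (1 / η i) - ‖x (i + 1) - F (i + 1)‖ ^ 2 * (1 / η (i + 1))) +
      (((1 + η 0) ^ 2 + 2 * η 0) * L ^ 2 * (μ i ^ 2 / η i ^ 2) + 0 * μ i + 12 * G ^ 2 * η (i + 1) +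
        (4 * G ^ 2 + (4 * (1 + η 0) * G + 2 * (η 0 * G + 2 * L)) * (η 0 * G + L)) *
          (1 / η (i + 1) - 1 / η i)) +
      2 * ((1 - η (i + 1)) * inner ℝ (x i - F i) (y i - F i)) := by
  have hsucc := r.sq_err_succ_le h (r.norm_drift_le_mul h hL i)
  have hdrift := r.norm_drift_mul_le h hL i
  have herr := r.norm_err_le i
  have hinv := h.inv_sub_nonneg i
  have hη0 := (h.η_pos 0).le
  have hG := r.G_nonneg
  rw [← div_pow]
  set e := ‖x i - F i‖
  set ρ := μ i / η i
  set κ := 1 / η (i + 1) - 1 / η i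
  set D := η 0 * G + L
  have : 0 ≤ D := by positivity
  have hyoung : 2 * ((1 + η 0) * (e * (L * ρ + D * κ))) ≤
      e ^ 2 + (1 + η 0) ^ 2 * L ^ 2 * ρ ^ 2 + 4 * (1 + η 0) * G * D * κ := by
    have hsq := two_mul_le_add_sq e ((1 + η 0) * L * ρ)
    have hmul : e * ((1 + η 0) * D * κ) ≤ 2 * G * ((1 + η 0) * D * κ) := by gcongr
    linarith
  have hsq := mul_le_mul_of_nonneg_right (pow_le_pow_left₀ (norm_nonneg _) herr 2) hinv
  linarith

omit hL in
theorem norm_err_succ_sub_le (i : ℕ) :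
    ‖x (i + 1) - F (i + 1) - (x i - F i)‖ ≤
      2 * G * η (i + 1) + (G * η 0 ^ 2 * (1 / η (i + 1) - 1 / η i) + L * μ i) := by
  have hincr : x (i + 1) - F (i + 1) - (x i - F i) = η (i + 1) • (y i - x i) + drift η F y i := by
    rw [r.succ, drift]
    module
  have hpos := (h.η_pos (i + 1)).le
  have hinv := h.inv_sub_nonneg i
  have hG := r.G_nonneg
  have hsub : ‖y i - x i‖ ≤ 2 * G := by linarith [norm_sub_le (y i) (x i), r.y_le i, r.x_le i]
  have hη : η i - η (i + 1) ≤ η 0 ^ 2 * (1 / η (i + 1) - 1 / η i) := by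
    rw [h.η_sub_eq, ← mul_assoc, sq]
    gcongr
    exacts [(h.η_pos i).le, (h.η_pos 0).le, h.η_le_zero (i + 1), h.η_le_zero i]
  rw [hincr]
  refine (norm_add_le _ _).trans (add_le_add ?_ ((r.norm_drift_le h i).trans ?_))
  · rw [norm_smul, Real.norm_of_nonneg hpos, mul_comm]
    gcongr
  · rw [mul_comm, mul_assoc G]
    gcongr

omit hL in
-- Summation by parts: the difference at a fixed time becomes a difference in time.
theorem inner_sub_le (i : ℕ) :
    (1 - η (i + 1)) * inner ℝ (x i - F i) (v i - v' i) ≤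
      ((1 - η (i + 1)) * inner ℝ (x i - F i) (v i) -
        (1 - η (i + 1 + 1)) * inner ℝ (x (i + 1) - F (i + 1)) (v (i + 1))) +
      (0 * (μ i ^ 2 / η i ^ 2) + 3 * (1 + η 0) * G * L * μ i +
        (2 * G ^ 2 + 2 * (1 + η 0) * G ^ 2) * η (i + 1) +
        (1 + η 0) * G ^ 2 * η 0 ^ 2 * (1 / η (i + 1) - 1 / η i)) := by
  have hη : |η (i + 1) - η (i + 1 + 1)| ≤ η (i + 1) := by
    rw [abs_of_nonneg (sub_nonneg.2 (h.η_antitone (i + 1).le_succ))]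
    linarith [h.η_pos (i + 1 + 1)]
  have hstep := (le_abs_self _).trans
    (abs_mul_inner_le hη (r.norm_err_le (i + 1)) (r.v_le (i + 1)))
  have herr := (le_abs_self _).trans (abs_mul_inner_le (h.abs_one_sub_le (i + 1))
    (r.norm_err_succ_sub_le h i) (r.v_le (i + 1)))
  have hvalue := (le_abs_self _).trans
    (abs_mul_inner_le (h.abs_one_sub_le (i + 1)) (r.norm_err_le i) (r.v_lip i))
  simp only [inner_sub_left, inner_sub_right] at hstep herr hvalue ⊢
  linarith

omit r h hL in
/-- The quantity whose decrease pays for the squared error in a step of the recursion. -/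
def potential (η : ℕ → ℝ) (x F v : ℕ → E) (i : ℕ) : ℝ :=
  ‖x i - F i‖ ^ 2 * (1 / η i) + 2 * ((1 - η (i + 1)) * inner ℝ (x i - F i) (v i))

omit hL in
theorem abs_inner_potential_le (i : ℕ) :
    |2 * ((1 - η (i + 1)) * inner ℝ (x i - F i) (v i))| ≤
      4 * (1 + η 0) * G ^ 2 * η 0 * (1 / η 0) := by
  have hinner := abs_mul_inner_le (h.abs_one_sub_le (i + 1)) (r.norm_err_le i) (r.v_le i)
  rw [mul_assoc, mul_one_div_cancel (h.η_pos 0).ne', abs_mul, abs_two]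
  linarith

omit hL in
theorem potential_sub_le (i : ℕ) : potential η x F v 0 - potential η x F v i ≤
    (4 * G ^ 2 + 8 * (1 + η 0) * G ^ 2 * η 0) * (1 / η 0) := by
  have hsq : ‖x 0 - F 0‖ ^ 2 * (1 / η 0) ≤ (2 * G) ^ 2 * (1 / η 0) :=
    mul_le_mul_of_nonneg_right (pow_le_pow_left₀ (norm_nonneg _) (r.norm_err_le 0) 2)
      (one_div_nonneg.2 (h.η_pos 0).le)
  have hsq' : 0 ≤ ‖x i - F i‖ ^ 2 * (1 / η i) :=
    mul_nonneg (sq_nonneg _) (one_div_nonneg.2 (h.η_pos i).le)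
  have hinner := (abs_le.1 (r.abs_inner_potential_le h 0)).2
  have hinner' := (abs_le.1 (r.abs_inner_potential_le h i)).1
  unfold potential
  linarith

end Recursion

namespace TwoTimescale

open Recursion in
theorem exists_sq_err_le (h : TwoTimescale μ η) {G L : ℝ} (hG : 0 ≤ G) (hL : 0 ≤ L) :
    ∃ C, 0 ≤ C ∧ ∀ x F y v v' : ℕ → E, Recursion μ η G L x F y v v' → ∀ i,
      ‖x i - F i‖ ^ 2 ≤ (potential η x F v i - potential η x F v (i + 1)) + C * stepCost μ η i +
        2 * ((1 - η (i + 1)) *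
          (inner ℝ (x i - F i) (y i - F i) - inner ℝ (x i - F i) (v i - v' i))) := by
  have hη0 := (h.η_pos 0).le
  refine ⟨((1 + η 0) ^ 2 + 2 * η 0) * L ^ 2 + 6 * (1 + η 0) * G * L +
    (16 * G ^ 2 + 4 * (1 + η 0) * G ^ 2) +
    (4 * G ^ 2 + (4 * (1 + η 0) * G + 2 * (η 0 * G + 2 * L)) * (η 0 * G + L) +
      2 * (1 + η 0) * G ^ 2 * η 0 ^ 2), by positivity, fun x F y v v' r i => ?_⟩
  refine le_trans ?_ (add_le_add_left (add_le_add_right (h.add_le_mul_stepCost (by positivity)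
    (by positivity) (by positivity) (by positivity) i) _) _)
  have hsq := r.sq_err_le h hL i
  have hinner := r.inner_sub_le h i
  unfold potential
  linarith

theorem exists_sum_sq_err_le (h : TwoTimescale μ η) {G L : ℝ} (hG : 0 ≤ G) (hL : 0 ≤ L) :
    ∃ C, 0 ≤ C ∧ ∀ x F y v v' : ℕ → E, Recursion μ η G L x F y v v' → ∀ N,
      ∑ i ∈ Finset.range (N + 1), ‖x i - F i‖ ^ 2 ≤ C * budget μ η N +
        ∑ i ∈ Finset.range (N + 1), 2 * ((1 - η (i + 1)) *
          (inner ℝ (x i - F i) (y i - F i) - inner ℝ (x i - F i) (v i - v' i))) := by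
  obtain ⟨C, hC, hstep⟩ := h.exists_sq_err_le (E := E) hG hL
  have hη0 := (h.η_pos 0).le
  refine ⟨4 * G ^ 2 + 8 * (1 + η 0) * G ^ 2 * η 0 + C, by positivity, fun x F y v v' r N => ?_⟩
  refine (Finset.sum_le_sum fun i _ => hstep x F y v v' r i).trans ?_
  rw [Finset.sum_add_distrib, Finset.sum_add_distrib, Finset.sum_range_sub', ← Finset.mul_sum,
    add_mul]
  refine add_le_add_left (add_le_add ((r.potential_sub_le h _).trans ?_) ?_) _
  · exact mul_le_mul_of_nonneg_left (h.inv_le_budget N) (by positivity)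
  · exact mul_le_mul_of_nonneg_left (le_add_of_nonneg_left (one_div_nonneg.2 hη0)) hC

theorem exists_sum_integral_sq_err_le (h : TwoTimescale μ η) {G L : ℝ} (hG : 0 ≤ G) (hL : 0 ≤ L) :
    ∃ C, 0 ≤ C ∧ ∀ (Ω : Type*) [MeasurableSpace Ω] (P : Measure Ω) [IsProbabilityMeasure P]
      (x F y v v' : ℕ → Ω → E), (∀ i, StronglyMeasurable (x i)) →
      (∀ i, StronglyMeasurable (F i)) → (∀ i, StronglyMeasurable (y i)) →
      (∀ i, StronglyMeasurable (v i)) → (∀ i, StronglyMeasurable (v' i)) →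
      (∀ ω, Recursion μ η G L (x · ω) (F · ω) (y · ω) (v · ω) (v' · ω)) → ∀ N,
      ∑ i ∈ Finset.range (N + 1), ∫ ω, ‖x i ω - F i ω‖ ^ 2 ∂P ≤
        C * (budget μ η N + ∑ i ∈ Finset.range (N + 1),
          |∫ ω, inner ℝ (x i ω - F i ω) (y i ω - F i ω) ∂P -
            ∫ ω, inner ℝ (x i ω - F i ω) (v i ω - v' i ω) ∂P|) := by
  obtain ⟨C, hC, hpath⟩ := h.exists_sum_sq_err_le (E := E) hG hL
  have hη0 := h.η_pos 0
  refine ⟨C + 2 * (1 + η 0), by positivity, fun Ω _ P _ x F y v v' hx hF hy hv hv' r N => ?_⟩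
  have herr (i : ℕ) : BddMeas (fun ω => x i ω - F i ω) (2 * G) :=
    ⟨(hx i).sub (hF i), fun ω => (r ω).norm_err_le i⟩
  have hnoise (i : ℕ) : BddMeas (fun ω => y i ω - F i ω) (2 * G) :=
    ⟨(hy i).sub (hF i), fun ω => (r ω).norm_noise_le i⟩
  have hvalue (i : ℕ) : BddMeas (fun ω => v i ω - v' i ω) (G + G) :=
    BddMeas.sub ⟨hv i, fun ω => (r ω).v_le i⟩ ⟨hv' i, fun ω => (r ω).v'_le i⟩
  have hsq (i : ℕ) : Integrable (fun ω => ‖x i ω - F i ω‖ ^ 2) P := by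
    simpa only [real_inner_self_eq_norm_sq] using ((herr i).inner (herr i)).integrable P
  have hnoise_int (i : ℕ) := ((herr i).inner (hnoise i)).integrable P
  have hvalue_int (i : ℕ) := ((herr i).inner (hvalue i)).integrable P
  have hbias_int (i : ℕ) : Integrable (fun ω => 2 * ((1 - η (i + 1)) *
      (inner ℝ (x i ω - F i ω) (y i ω - F i ω) - inner ℝ (x i ω - F i ω) (v i ω - v' i ω)))) P :=
    (((hnoise_int i).sub (hvalue_int i)).const_mul _).const_mul _
  rw [← integral_finsetSum _ fun i _ => hsq i]
  have hsum := integral_mono (μ := P) (integrable_finsetSum _ fun i _ => hsq i)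
    ((integrable_const _).add (integrable_finsetSum _ fun i _ => hbias_int i))
    fun ω => hpath _ _ _ _ _ (r ω) N
  refine hsum.trans ((integral_add (integrable_const _)
    (integrable_finsetSum _ fun i _ => hbias_int i)).trans_le ?_)
  rw [integral_const, probReal_univ, one_smul, integral_finsetSum _ fun i _ => hbias_int i]
  have hbias_sum := Finset.sum_le_sum fun i (_ : i ∈ Finset.range (N + 1)) =>
    integral_mul_sub_le (h.abs_one_sub_le (i + 1)) (hnoise_int i) (hvalue_int i)
  rw [← Finset.mul_sum] at hbias_sum
  have hbudget := mul_nonneg (by positivity : 0 ≤ 2 * (1 + η 0)) (h.budget_nonneg N)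
  have habs := mul_nonneg hC (Finset.sum_nonneg fun i (_ : i ∈ Finset.range (N + 1)) =>
    abs_nonneg (∫ ω, inner ℝ (x i ω - F i ω) (y i ω - F i ω) ∂P -
      ∫ ω, inner ℝ (x i ω - F i ω) (v i ω - v' i ω) ∂P))
  linarith

end TwoTimescale

end Recursion

section Estimate

variable {nS nZ nA K n : ℕ} {S : Set (Euc nS)} {Z : Set (Euc nZ)} {A : Set (Euc nA)}
  {M : CMDP S Z A K} {π : Policy S Z A n} {Θ : Set (Euc n)} {q : ℕ}
  {Qnet : Fin (K + 1) → Euc q → AugState S Z → ↥A → ℝ} {μ η : ℕ → ℝ} {B : ℕ}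
  {Ω : Type*} [mΩ : MeasurableSpace Ω] {P : Measure Ω} {E : Type*} [NormedAddCommGroup E]
  [MeasurableSpace E]

/-- `x` are estimates formed along a run, with the step sizes `η`, from the bounded samples `y`,
where `y i` is known at the end of iteration `i`. -/
structure Run.Estimate [NormedSpace ℝ E] (R : Run M π Θ Qnet μ η B P) (b c : ℝ)
    (x y : ℕ → Ω → E) : Prop where
  init_measurable : Measurable[R.𝓕 0] (x 0)
  sample_measurable : ∀ i, Measurable[R.𝓕 (B * (i + 1))] (y i)
  init_le : ∀ ω, ‖x 0 ω‖ ≤ b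
  sample_le : ∀ i ω, ‖y i ω‖ ≤ c
  succ : ∀ i ω, x (i + 1) ω = (1 - η (i + 1)) • x i ω + η i • y i ω

theorem Run.Estimate.measurable [NormedSpace ℝ E] [BorelSpace E] [SecondCountableTopology E]
    {R : Run M π Θ Qnet μ η B P} {b c : ℝ} {x y : ℕ → Ω → E} (hest : R.Estimate b c x y) (i : ℕ) :
    Measurable[R.𝓕 (B * i)] (x i) :=
  measurable_of_forall_succ_eq R.𝓕 hest.init_measurable hest.sample_measurable hest.succ i

theorem Run.Estimate.measurable_err [NormedSpace ℝ E] [BorelSpace E] [SecondCountableTopology E]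
    {R : Run M π Θ Qnet μ η B P} {b c : ℝ} {x y : ℕ → Ω → E} (hest : R.Estimate b c x y)
    (hmem : ∀ i ω, R.θ i ω ∈ Θ) {F : ↥Θ → E}
    (hF : LipFamily fun θ (_ : AugState S Z) => F θ) (i : ℕ) :
    Measurable[R.𝓕 (B * i)] fun ω => x i ω - F (R.param hmem i ω) :=
  (hest.measurable i).sub (R.measurable_comp_param hmem hF.stronglyMeasurable_uncurry.measurable
    le_rfl (R.measurable_s_of_le (Nat.zero_le _)))

namespace PoissonSolution

variable [InnerProductSpace ℝ E] {H : ↥Θ → AugState S Z × ↥A × AugState S Z → E}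
  {u : ↥Θ → AugState S Z → E} {F : ↥Θ → E} (hsol : PoissonSolution M π H u F)
  (h : TwoTimescale μ η) (hΘ : Bornology.IsBounded Θ)
include hsol h hΘ

theorem exists_recursion (b c : ℝ) :
    ∃ G L, 0 ≤ G ∧ 0 ≤ L ∧ ∀ (Ω : Type*) [MeasurableSpace Ω] (P : Measure Ω)
      (R : Run M π Θ Qnet μ η B P) (hmem : ∀ i ω, R.θ i ω ∈ Θ) (x y : ℕ → Ω → E),
      R.Estimate b c x y → ∀ ω,
      Recursion μ η G L (x · ω) (fun i => F (R.param hmem i ω)) (y · ω)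
        (fun i => (1 / (B : ℝ)) • u (R.param hmem i ω) (R.s (B * i) ω))
        (fun i => (1 / (B : ℝ)) • u (R.param hmem i ω) (R.s (B * (i + 1)) ω)) := by
  obtain ⟨⟨Cu, hCu⟩, ⟨Lu, hLu⟩⟩ := hsol.value
  obtain ⟨⟨CF, hCF⟩, ⟨LF, hLF⟩⟩ := hsol.mean
  obtain ⟨Gx, hGx⟩ := h.exists_bound (E := E) b c
  have hB : ‖1 / (B : ℝ)‖ ≤ 1 := by
    rw [one_div, Real.norm_of_nonneg (by positivity)]
    exact Nat.cast_inv_le_one B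
  have hsmul (v : E) : ‖(1 / (B : ℝ)) • v‖ ≤ ‖v‖ := by
    rw [norm_smul]
    exact mul_le_of_le_one_left (norm_nonneg v) hB
  have := Metric.diam_nonneg (s := Θ)
  refine ⟨|Gx| + |c| + Cu + CF, (Lu + LF) * Metric.diam Θ, by positivity, by positivity,
    fun Ω _ P R hmem x y hest ω => ?_⟩
  have hstep (i : ℕ) : dist (R.param hmem (i + 1) ω) (R.param hmem i ω) ≤ μ i * Metric.diam Θ := by
    rw [Subtype.dist_eq, dist_eq_norm]
    exact R.norm_θ_succ_sub_le hmem h.μ_nonneg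
      (fun _ hθ _ hθ' => Metric.dist_le_diam_of_mem hΘ hθ hθ') i ω
  have hlip {D : ℝ≥0} (hD : D ≤ Lu + LF) (i : ℕ) :
      D * dist (R.param hmem (i + 1) ω) (R.param hmem i ω) ≤
        (Lu + LF) * Metric.diam Θ * μ i := by
    rw [mul_assoc, mul_comm (Metric.diam Θ)]
    exact mul_le_mul (by exact_mod_cast hD) (hstep i) dist_nonneg (by positivity)
  have hx (i : ℕ) := hGx (x · ω) (y · ω) (hest.init_le ω) (hest.sample_le · ω) (hest.succ · ω) i
  have hvalue (i t : ℕ) := (hsmul _).trans ((hCu (R.param hmem i ω)).bound (R.s t ω))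
  have hle : Gx ≤ |Gx| + |c| + Cu + CF ∧ c ≤ |Gx| + |c| + Cu + CF ∧
      Cu ≤ |Gx| + |c| + Cu + CF ∧ CF ≤ |Gx| + |c| + Cu + CF := by
    refine ⟨?_, ?_, ?_, ?_⟩ <;>
      linarith [le_abs_self Gx, abs_nonneg Gx, le_abs_self c, abs_nonneg c, Cu.2, CF.2]
  exact {
    succ := (hest.succ · ω)
    x_le := fun i => (hx i).trans hle.1
    F_le := fun i => ((hCF (R.param hmem i ω)).bound (R.s 0 ω)).trans hle.2.2.2
    y_le := fun i => (hest.sample_le i ω).trans hle.2.1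
    v_le := fun i => (hvalue i _).trans hle.2.2.1
    v'_le := fun i => (hvalue i _).trans hle.2.2.1
    F_lip := fun i => (LipFamily.norm_sub_le hLF _ _ (R.s 0 ω)).trans
      (hlip le_add_self i)
    v_lip := fun i => by
      rw [← smul_sub]
      exact (hsmul _).trans ((LipFamily.norm_sub_le hLu _ _ _).trans (hlip le_self_add i)) }

theorem exists_sum_integral_sq_err_le [BorelSpace E] [SecondCountableTopology E] [CompleteSpace E]
    (hB : 0 < B) (b c : ℝ) :
    ∃ C G, 0 ≤ C ∧ 0 ≤ G ∧ ∀ (Ω : Type*) [MeasurableSpace Ω] (P : Measure Ω)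
      [IsProbabilityMeasure P] (R : Run M π Θ Qnet μ η B P) (hmem : ∀ i ω, R.θ i ω ∈ Θ)
      (x y : ℕ → Ω → E), R.Estimate b c x y →
      (∀ i ω, ‖x i ω‖ ≤ G) ∧
      (∀ i, BddMeas (fun ω => x i ω - F (R.param hmem i ω)) (2 * G)) ∧
      ∀ N, ∑ i ∈ Finset.range (N + 1), ∫ ω, ‖x i ω - F (R.param hmem i ω)‖ ^ 2 ∂P ≤
        C * (budget μ η N + ∑ i ∈ Finset.range (N + 1),
          |∫ ω, inner ℝ (x i ω - F (R.param hmem i ω)) (y i ω - R.batch hmem H i ω) ∂P|) := by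
  obtain ⟨G, L, hG, hL, hrec⟩ := hsol.exists_recursion (Qnet := Qnet) (B := B) h hΘ b c
  obtain ⟨C, hC, hsum⟩ := h.exists_sum_integral_sq_err_le (E := E) hG hL
  obtain ⟨CH, hCH⟩ := hsol.sample.exists_bddMeas_uncurry
  obtain ⟨Cu, hCu⟩ := hsol.value.exists_bddMeas_uncurry
  obtain ⟨CF, hCF⟩ := hsol.mean.exists_bddMeas_uncurry
  refine ⟨C, G, hC, hG, fun Ω _ P _ R hmem x y hest => ?_⟩
  have hr := hrec Ω P R hmem x y hest
  have hWm (i : ℕ) := hest.measurable_err hmem hsol.mean i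
  have hW (i : ℕ) : BddMeas (fun ω => x i ω - F (R.param hmem i ω)) (2 * G) :=
    ⟨(R.measurable_of_adapted (hWm i)).stronglyMeasurable, fun ω => (hr ω).norm_err_le i⟩
  have hx (i : ℕ) := (R.measurable_of_adapted (hest.measurable i)).stronglyMeasurable
  have hF (i : ℕ) := R.bddMeas_param hmem hCF i (R.measurable_s 0)
  have hy (i : ℕ) := (R.measurable_of_adapted (hest.sample_measurable i)).stronglyMeasurable
  have hv (i t : ℕ) : StronglyMeasurable fun ω =>
      (1 / (B : ℝ)) • u (R.param hmem i ω) (R.s t ω) :=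
    (R.bddMeas_param hmem hCu i (R.measurable_s t)).meas.const_smul _
  have hnoise (i : ℕ) : BddMeas (fun ω => y i ω - F (R.param hmem i ω)) (c + CF) :=
    BddMeas.sub ⟨hy i, hest.sample_le i⟩ (hF i)
  have hbatch (i : ℕ) := (R.bddMeas_batch hmem hCH i).sub (hF i)
  refine ⟨fun i ω => (hr ω).x_le i, hW, fun N => (hsum Ω P x _ y _ _ hx (fun i => (hF i).meas) hy
    (fun i => hv i _) (fun i => hv i _) hr N).trans_eq ?_⟩
  congr 2
  refine Finset.sum_congr rfl fun i _ => ?_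
  rw [← R.integral_inner_batch_sub hmem hsol hB (hWm i) (hW i).bound,
    ← integral_sub (((hW i).inner (hnoise i)).integrable P)
      (((hW i).inner (hbatch i)).integrable P)]
  simp only [← inner_sub_right, sub_sub_sub_cancel_right]

end PoissonSolution

end Estimate

section Samples

variable {nS nZ nA K n : ℕ} {S : Set (Euc nS)} {Z : Set (Euc nZ)} {A : Set (Euc nA)}

/-- The reshaped cost of a transition, as a family that is constant in the parameter. -/
def CMDP.costSample (M : CMDP S Z A K) {Θ : Set (Euc n)} (k : Fin (K + 1)) (_ : ↥Θ)
    (p : AugState S Z × ↥A × AugState S Z) : ℝ :=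
  M.reshapedCost k p.1 p.2.1 p.2.2

/-- Sample of the policy gradient formed with the exact action values. -/
def CMDP.gradSample (M : CMDP S Z A K) (π : Policy S Z A n) {Θ : Set (Euc n)}
    (m : ↥Θ → ProbabilityMeasure (AugState S Z)) (k : Fin (K + 1)) (θ : ↥Θ)
    (p : AugState S Z × ↥A × AugState S Z) : Euc n :=
  M.qValue π m k θ (p.1, p.2.1) • π.score Θ θ p.1 p.2.1

variable {M : CMDP S Z A K} {π : Policy S Z A n} {Θ : Set (Euc n)}
  {m : ↥Θ → ProbabilityMeasure (AugState S Z)} {L L' : ℝ≥0} {lam ρ : ℝ}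

namespace RegularModel

variable (h : RegularModel M π Θ m L L' lam ρ) (k : Fin (K + 1))
include h

theorem poissonSolution_costSample :
    PoissonSolution M π (M.costSample k) (M.value π m k) fun θ : ↥Θ => M.objective π k θ where
  sample := by
    obtain ⟨C, hC⟩ := h.exists_bddMeas_reshapedCost k
    exact .const (hC.comp (g := fun p : AugState S Z × ↥A × AugState S Z =>
      ((p.1, p.2.1), p.2.2)) (by fun_prop))
  value := h.lipFamily_value k
  mean := by simpa only [h.objective_eq] using h.lipFamily_avgCost k
  eq := fun θ x => by
    rw [h.objective_eq]
    exact h.integral_reshapedCost_add_integral_value k θ x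

theorem poissonSolution_gradSample :
    PoissonSolution M π (M.gradSample π m k) (M.gradValue π m k)
      fun θ : ↥Θ => M.gradObjective π Θ k θ where
  sample := (h.lipFamily_qValue_smul_score k).comp
    (g := fun p : AugState S Z × ↥A × AugState S Z => (p.1, p.2.1)) (by fun_prop)
  value := h.lipFamily_gradValue k
  mean := by simpa only [h.gradObjective_eq] using h.lipFamily_mean (h.lipFamily_gradTerm k)
  eq := fun θ x => by
    rw [h.gradObjective_eq]
    exact h.integral_qValue_smul_score_add_integral_gradValue k θ x

theorem exists_abs_surrogateQ_le (T : ℕ) (G : ℝ) : ∃ D, ∀ (θ : ↥Θ) (y : ℝ), |y| ≤ G → ∀ x a,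
    |M.surrogateQ π θ k y T x a| ≤ D := by
  obtain ⟨C, hC⟩ := h.exists_abs_surrogateQ_sub_le k
  obtain ⟨⟨Cq, hq⟩, -⟩ := h.lipFamily_qValue k
  obtain ⟨⟨Cf, hf⟩, -⟩ := h.lipFamily_avgCost (Y := AugState S Z) k
  refine ⟨C * ρ ^ T + (Cq + T * (Cf + G)), fun θ y hy x a => ?_⟩
  have hbaseline : |(T : ℝ) * (M.avgCost π m k θ - y)| ≤ T * (Cf + G) := by
    rw [abs_mul, Nat.abs_cast]
    gcongr
    exact (abs_sub _ _).trans (add_le_add ((hf θ).bound x) hy)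
  refine (sub_add_cancel (M.surrogateQ π θ k y T x a) (M.qValue π m k θ (x, a) +
    T * (M.avgCost π m k θ - y))).symm ▸ (abs_add_le _ _).trans ?_
  exact add_le_add (hC θ y T x a)
    ((abs_add_le _ _).trans (add_le_add ((hq θ).bound (x, a)) hbaseline))

end RegularModel

end Samples

namespace Run

variable {nS nZ nA K n : ℕ} {S : Set (Euc nS)} {Z : Set (Euc nZ)} {A : Set (Euc nA)}
  {M : CMDP S Z A K} {π : Policy S Z A n} {Θ : Set (Euc n)} {q : ℕ}
  {Qnet : Fin (K + 1) → Euc q → AugState S Z → ↥A → ℝ} {μ η : ℕ → ℝ} {B : ℕ}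
  {Ω : Type*} [mΩ : MeasurableSpace Ω] {P : Measure Ω} (R : Run M π Θ Qnet μ η B P)

/-- Gradient sample formed with the Q-network of iteration `i` in the slot `t`. -/
def criticSample (k : Fin (K + 1)) (i t : ℕ) (ω : Ω) : Euc n :=
  Qnet k (R.w k i ω) (R.s t ω) (R.a t ω) • π.score Θ (R.θ i ω) (R.s t ω) (R.a t ω)

variable {m : ↥Θ → ProbabilityMeasure (AugState S Z)} {L L' : ℝ≥0} {lam ρ : ℝ}
  (hmem : ∀ i ω, R.θ i ω ∈ Θ)

/-- The amount, not depending on the state and the action, by which the surrogate Q-function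
differs from the differential action value on account of the error in the average cost. -/
def baseline (m : ↥Θ → ProbabilityMeasure (AugState S Z)) (k : Fin (K + 1)) (T i : ℕ)
    (ω : Ω) : ℝ :=
  T * (M.avgCost π m k (R.param hmem i ω) - R.fhat k i ω)

/-- Gap between the critic and the action value in the slot `t`, up to the baseline. -/
def criticGap (m : ↥Θ → ProbabilityMeasure (AugState S Z)) (k : Fin (K + 1)) (T i t : ℕ)
    (ω : Ω) : ℝ :=
  Qnet k (R.w k i ω) (R.s t ω) (R.a t ω) -
    (M.qValue π m k (R.param hmem i ω) (R.s t ω, R.a t ω) + R.baseline hmem m k T i ω)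

theorem criticSample_sub_gradSample (k : Fin (K + 1)) (T i t : ℕ) (ω : Ω) :
    R.criticSample k i t ω - M.gradSample π m k (R.param hmem i ω) (R.s t ω, R.outcome t ω) =
      R.criticGap hmem m k T i t ω • π.score Θ (R.θ i ω) (R.s t ω) (R.a t ω) +
        R.baseline hmem m k T i ω • π.score Θ (R.θ i ω) (R.s t ω) (R.a t ω) := by
  rw [← add_smul, criticGap, sub_add_eq_sub_sub, sub_add_cancel, sub_smul]
  rfl

variable (k : Fin (K + 1)) {b G : ℝ} (hb : R.BoundedBy b)

section Critic

variable (hQnet : ∀ k, Measurable fun p : Euc q × AugState S Z × ↥A => Qnet k p.1 p.2.1 p.2.2)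
include hQnet

theorem measurable_critic_of_lt {i t t' : ℕ} (hi : B * (i + 1) ≤ t') (ht : t < t') :
    Measurable[R.𝓕 t'] fun ω => Qnet k (R.w k i ω) (R.s t ω) (R.a t ω) :=
  (hQnet k).comp (((R.w_measurable k i).mono (R.𝓕.mono hi) le_rfl).prodMk
    ((R.measurable_s_of_le ht.le).prodMk ((R.a_measurable t).mono (R.𝓕.mono ht) le_rfl)))

include hb in
theorem bddMeas_critic (i t : ℕ) :
    BddMeas (fun ω => Qnet k (R.w k i ω) (R.s t ω) (R.a t ω)) b where
  meas := (R.measurable_of_adapted (R.measurable_critic_of_lt k hQnet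
    (le_max_left (B * (i + 1)) (t + 1))
    (t.lt_succ_self.trans_le (le_max_right _ _)))).stronglyMeasurable
  bound ω := hb.critic k i ω _ _

end Critic

include hb in
theorem estimate_fhat {c : ℝ} (hc : BddMeas (Function.uncurry (M.costSample (Θ := Θ) k)) c) :
    R.Estimate b c (R.fhat k) (R.batch hmem (M.costSample k)) where
  init_measurable := R.fhat_init_measurable k
  sample_measurable i := measurable_batchAvg fun _ _ ht =>
    R.measurable_comp_param hmem hc.meas.measurable (Nat.mul_le_mul_left B i.le_succ)
      ((R.measurable_s_of_le ht.le).prodMk (R.measurable_outcome_of_lt ht))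
  init_le := hb.fhat_init k
  sample_le i := (R.bddMeas_batch hmem hc i).bound
  succ := R.fhat_succ k

variable (h : RegularModel M π Θ m L L' lam ρ)
include hmem h

theorem measurable_score_of_lt {i t t' : ℕ} (hi : B * i ≤ t') (ht : t < t') :
    Measurable[R.𝓕 t'] fun ω => π.score Θ (R.θ i ω) (R.s t ω) (R.a t ω) :=
  R.measurable_comp_param hmem h.lipFamily_score.stronglyMeasurable_uncurry.measurable hi
    ((R.measurable_s_of_le ht.le).prodMk ((R.a_measurable t).mono (R.𝓕.mono ht) le_rfl))

theorem bddMeas_score (i t : ℕ) :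
    BddMeas (fun ω => π.score Θ (R.θ i ω) (R.s t ω) (R.a t ω)) L where
  meas := (R.measurable_of_adapted (R.measurable_score_of_lt hmem h
    (le_max_left (B * i) (t + 1)) (t.lt_succ_self.trans_le (le_max_right _ _)))).stronglyMeasurable
  bound ω := (h.smooth.bddMeas_score (hmem i ω)).bound (R.s t ω, R.a t ω)

include hb

theorem measurable_baseline (T i : ℕ) : Measurable[R.𝓕 (B * i)] (R.baseline hmem m k T i) := by
  obtain ⟨c, hc⟩ := (h.poissonSolution_costSample k).sample.exists_bddMeas_uncurry
  have havg := R.measurable_comp_param hmem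
    (h.lipFamily_avgCost k).stronglyMeasurable_uncurry.measurable (le_refl (B * i))
    (R.measurable_s_of_le (Nat.zero_le _))
  exact (havg.sub ((R.estimate_fhat hmem k hb hc).measurable i)).const_mul _

theorem exists_bddMeas_baseline {i : ℕ} (hG : ∀ ω, |R.fhat k i ω| ≤ G) (T : ℕ) :
    ∃ C, BddMeas (R.baseline hmem m k T i) C := by
  obtain ⟨⟨C, hC⟩, -⟩ := h.lipFamily_avgCost (Y := AugState S Z) k
  refine ⟨T * (C + G), (R.measurable_of_adapted
    (R.measurable_baseline hmem k hb h T i)).stronglyMeasurable, fun ω => ?_⟩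
  rw [baseline, norm_mul, Real.norm_natCast]
  gcongr
  exact norm_sub_le_of_le ((hC (R.param hmem i ω)).bound (R.s 0 ω)) (hG ω)

theorem criticErr_ne_top [IsFiniteMeasure P] {i : ℕ} (hG : ∀ ω, |R.fhat k i ω| ≤ G) (T : ℕ) :
    R.criticErr k T i ≠ ∞ := by
  obtain ⟨D, hD⟩ := h.exists_abs_surrogateQ_le k T G
  refine ne_top_of_le_ne_top (b := ∫⁻ _, ENNReal.ofReal (b + D) ∂P)
    (by simpa using ENNReal.mul_ne_top ENNReal.ofReal_ne_top (measure_ne_top P _))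
    (lintegral_mono fun ω => iSup₂_le fun x a => ENNReal.ofReal_le_ofReal ?_)
  exact (abs_sub _ _).trans (add_le_add (hb.critic k i ω x a)
    (hD (R.param hmem i ω) _ (hG ω) x a))

-- The baseline is known before the actions are drawn, and the score has mean zero.
theorem integral_inner_baseline_smul_score [IsProbabilityMeasure P] {i j : ℕ} (hj : j < B)
    (hG : ∀ ω, |R.fhat k i ω| ≤ G) (T : ℕ) {W : Ω → Euc n} {w : ℝ}
    (hW : Measurable[R.𝓕 (B * i)] W) (hw : ∀ ω, ‖W ω‖ ≤ w) :
    ∫ ω, inner ℝ (W ω) (R.baseline hmem m k T i ω •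
      π.score Θ (R.θ i ω) (R.s (B * i + j) ω) (R.a (B * i + j) ω)) ∂P = 0 := by
  obtain ⟨D, hD⟩ := R.exists_bddMeas_baseline hmem k hb h hG T
  obtain ⟨C, hC⟩ := (h.lipFamily_score.comp
    (g := fun p : AugState S Z × ↥A × AugState S Z => (p.1, p.2.1))
    (by fun_prop)).exists_bddMeas_uncurry
  have hV : Measurable[R.𝓕 (B * i + j)] fun ω => R.baseline hmem m k T i ω • W ω :=
    ((R.measurable_baseline hmem k hb h T i).smul hW).mono (R.𝓕.mono (Nat.le_add_right _ _))
      le_rfl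
  have hVbound := (hD.smul ⟨(R.measurable_of_adapted hW).stronglyMeasurable, hw⟩).bound
  have hmean (ω : Ω) : ∫ p, π.score Θ (R.param hmem i ω) (R.s (B * i + j) ω) p.1
      ∂(M.stepKernel π (R.θ i ω) (R.s (B * i + j) ω)) = 0 := by
    have hscore := (h.smooth.bddMeas_score (hmem i ω)).comp
      (measurable_prodMk_left (x := R.s (B * i + j) ω))
    exact (M.integral_stepKernel_fst π _ _ hscore).trans (h.smooth.integral_score (hmem i ω) _)
  have houtcome := R.integral_inner_outcome hmem hj hV hVbound hC
  simp only [hmean, inner_zero_right, integral_zero, real_inner_smul_left] at houtcome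
  simp only [real_inner_smul_right]
  exact houtcome

section Gap

variable (hQnet : ∀ k, Measurable fun p : Euc q × AugState S Z × ↥A => Qnet k p.1 p.2.1 p.2.2)
  {i : ℕ} (hG : ∀ ω, |R.fhat k i ω| ≤ G) (T : ℕ)
include hQnet

theorem bddMeas_criticSample (t : ℕ) : BddMeas (R.criticSample k i t) (b * L) :=
  (R.bddMeas_critic k hb hQnet i t).smul (R.bddMeas_score hmem h i t)

theorem estimate_ghat : R.Estimate b (b * L) (R.ghat k)
    fun i ω => batchAvg B (fun t => R.criticSample k i t ω) i where
  init_measurable := R.ghat_init_measurable k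
  sample_measurable i := measurable_batchAvg fun _ _ ht =>
    (R.measurable_critic_of_lt k hQnet le_rfl ht).smul
      (R.measurable_score_of_lt hmem h (Nat.mul_le_mul_left B i.le_succ) ht)
  init_le := hb.ghat_init k
  sample_le i ω := by
    have hsample (t : ℕ) := (R.bddMeas_criticSample hmem k hb h hQnet (i := i) t).bound ω
    exact norm_batchAvg_le ((norm_nonneg _).trans (hsample 0)) fun _ _ => hsample _
  succ := R.ghat_succ k

include hG

theorem exists_bddMeas_criticGap (t : ℕ) : ∃ C, BddMeas (R.criticGap hmem m k T i t) C := by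
  obtain ⟨C, hC⟩ := (h.lipFamily_qValue k).exists_bddMeas_uncurry
  obtain ⟨D, hD⟩ := R.exists_bddMeas_baseline hmem k hb h hG T
  exact ⟨_, (R.bddMeas_critic k hb hQnet i t).sub ((R.bddMeas_param hmem hC i
    ((R.measurable_s t).prodMk (R.measurable_of_adapted (R.a_measurable t)))).add hD)⟩

variable [IsProbabilityMeasure P] {C : ℝ} (hC : ∀ (θ : ↥Θ) (y : ℝ) (T : ℕ) (x : AugState S Z)
  (a : ↥A), |M.surrogateQ π θ k y T x a -
    (M.qValue π m k θ (x, a) + T * (M.avgCost π m k θ - y))| ≤ C * ρ ^ T)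
include hC

theorem integral_abs_criticGap_le (t : ℕ) :
    ∫ ω, |R.criticGap hmem m k T i t ω| ∂P ≤ (R.criticErr k T i).toReal + C * ρ ^ T := by
  obtain ⟨D, hD⟩ := R.exists_bddMeas_criticGap hmem k hb h hQnet hG T t
  obtain ⟨ω₀⟩ : Nonempty Ω := P.nonempty_of_neZero
  have hfin := R.criticErr_ne_top hmem k hb h hG T
  have herr : 0 ≤ C * ρ ^ T :=
    (abs_nonneg _).trans (hC (R.param hmem 0 ω₀) 0 T (R.s 0 ω₀) (R.a 0 ω₀))
  have hpoint (ω : Ω) : ENNReal.ofReal |R.criticGap hmem m k T i t ω| ≤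
      (⨆ (x : AugState S Z) (a : ↥A), ENNReal.ofReal
        |Qnet k (R.w k i ω) x a - M.surrogateQ π (R.θ i ω) k (R.fhat k i ω) T x a|) +
        ENNReal.ofReal (C * ρ ^ T) := by
    refine le_trans ?_ (add_le_add_left (le_iSup₂ (R.s t ω) (R.a t ω)) _)
    rw [← ENNReal.ofReal_add (abs_nonneg _) herr]
    exact ENNReal.ofReal_le_ofReal ((abs_sub_le _ _ _).trans
      (add_le_add_right (hC (R.param hmem i ω) _ T _ _) _))
  rw [integral_eq_lintegral_of_nonneg_ae (ae_of_all _ fun _ => abs_nonneg _)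
    hD.meas.measurable.abs.aestronglyMeasurable, ← ENNReal.toReal_ofReal herr,
    ← ENNReal.toReal_add hfin ENNReal.ofReal_ne_top]
  refine ENNReal.toReal_mono (ENNReal.add_ne_top.2 ⟨hfin, ENNReal.ofReal_ne_top⟩)
    ((lintegral_mono hpoint).trans_eq ?_)
  rw [lintegral_add_right _ measurable_const, lintegral_const, measure_univ, mul_one, criticErr]

variable {W : Ω → Euc n} {w : ℝ} (hW : Measurable[R.𝓕 (B * i)] W) (hw : ∀ ω, ‖W ω‖ ≤ w)
include hW hw

theorem abs_integral_inner_criticSample_sub_le {j : ℕ} (hj : j < B) :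
    |∫ ω, inner ℝ (W ω) (R.criticSample k i (B * i + j) ω - M.gradSample π m k
      (R.param hmem i ω) (R.s (B * i + j) ω, R.outcome (B * i + j) ω)) ∂P| ≤
      w * L * ((R.criticErr k T i).toReal + C * ρ ^ T) := by
  obtain ⟨D, hD⟩ := R.exists_bddMeas_criticGap hmem k hb h hQnet hG T (B * i + j)
  obtain ⟨F, hF⟩ := R.exists_bddMeas_baseline hmem k hb h hG T
  obtain ⟨ω₀⟩ : Nonempty Ω := P.nonempty_of_neZero
  have hw_nonneg : 0 ≤ w := (norm_nonneg _).trans (hw ω₀)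
  have hW' : BddMeas W w := ⟨(R.measurable_of_adapted hW).stronglyMeasurable, hw⟩
  have hscore := R.bddMeas_score hmem h i (B * i + j)
  have hgap := R.integral_abs_criticGap_le hmem k hb h hQnet hG T hC (B * i + j)
  have hpoint (ω : Ω) : ‖(inner ℝ (W ω) (R.criticGap hmem m k T i (B * i + j) ω •
      π.score Θ (R.θ i ω) (R.s (B * i + j) ω) (R.a (B * i + j) ω)) : ℝ)‖ ≤
      w * L * |R.criticGap hmem m k T i (B * i + j) ω| := by
    rw [real_inner_smul_right, norm_mul, mul_comm, Real.norm_eq_abs (R.criticGap ..)]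
    gcongr
    exact (norm_inner_le_norm _ _).trans
      (mul_le_mul (hw ω) (hscore.bound ω) (norm_nonneg _) hw_nonneg)
  simp only [R.criticSample_sub_gradSample hmem k T, inner_add_right]
  rw [integral_add ((hW'.inner (hD.smul hscore)).integrable P)
    ((hW'.inner (hF.smul hscore)).integrable P),
    R.integral_inner_baseline_smul_score hmem k hb h hj hG T hW hw, add_zero, ← Real.norm_eq_abs]
  refine (norm_integral_le_of_norm_le (((hD.integrable P).abs).const_mul _)
    (ae_of_all _ hpoint)).trans ?_
  rw [integral_const_mul]
  gcongr

theorem abs_integral_inner_batchAvg_criticSample_sub_le :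
    |∫ ω, inner ℝ (W ω) (batchAvg B (fun t => R.criticSample k i t ω) i -
      R.batch hmem (M.gradSample π m k) i ω) ∂P| ≤
      w * L * ((R.criticErr k T i).toReal + C * ρ ^ T) := by
  obtain ⟨D, hD⟩ := (h.poissonSolution_gradSample k).sample.exists_bddMeas_uncurry
  obtain ⟨ω₀⟩ : Nonempty Ω := P.nonempty_of_neZero
  have hW' : BddMeas W w := ⟨(R.measurable_of_adapted hW).stronglyMeasurable, hw⟩
  have hslot (t : ℕ) := hW'.inner ((R.bddMeas_criticSample hmem k hb h hQnet (i := i) t).sub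
    (R.bddMeas_param hmem hD i ((R.measurable_s t).prodMk (R.measurable_outcome t))))
  have hnonneg : 0 ≤ w * L * ((R.criticErr k T i).toReal + C * ρ ^ T) :=
    mul_nonneg (mul_nonneg ((norm_nonneg _).trans (hw ω₀)) L.2)
      ((integral_nonneg fun _ => abs_nonneg _).trans
        (R.integral_abs_criticGap_le hmem k hb h hQnet hG T hC 0))
  have havg := norm_batchAvg_le (z := fun t => ∫ ω, inner ℝ (W ω) (R.criticSample k i t ω -
    M.gradSample π m k (R.param hmem i ω) (R.s t ω, R.outcome t ω)) ∂P) hnonneg fun _ hj =>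
      R.abs_integral_inner_criticSample_sub_le hmem k hb h hQnet hG T hC hW hw hj
  refine Eq.trans_le ?_ havg
  rw [← Real.norm_eq_abs]
  congr 1
  simp only [batch, batchAvg, ← smul_sub, ← Finset.sum_sub_distrib, inner_smul_right, inner_sum]
  rw [integral_const_mul, integral_finsetSum _ fun j _ => (hslot _).integrable P, smul_eq_mul]

end Gap

end Run

namespace TwoTimescale

variable {μ η : ℕ → ℝ} (h : TwoTimescale μ η)
include h

theorem sum_le_budget (N : ℕ) : ∑ i ∈ Finset.range (N + 1), η (i + 1) ≤ budget μ η N := by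
  rw [budget_eq]
  refine le_add_of_nonneg_of_le (one_div_nonneg.2 (h.η_pos _).le)
    (Finset.sum_le_sum fun i _ => le_add_of_nonneg_left ?_)
  have hμ := h.μ_nonneg i
  positivity

theorem budget_add_sum_le {w e : ℝ} (hw : 0 ≤ w) (he : 0 ≤ e) {r : ℕ → ℝ} (hr : ∀ i, 0 ≤ r i)
    (N : ℕ) : budget μ η N + ∑ i ∈ Finset.range (N + 1), w * (r i + e * η (i + 1)) ≤
      (1 + w * (1 + e)) * (budget μ η N + ∑ i ∈ Finset.range (N + 1), r i) := by
  have hsum : 0 ≤ ∑ i ∈ Finset.range (N + 1), r i := Finset.sum_nonneg fun i _ => hr i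
  have hbudget := h.budget_nonneg N
  rw [← Finset.mul_sum, Finset.sum_add_distrib, ← Finset.mul_sum]
  grw [h.sum_le_budget N]
  rw [add_mul, one_mul, mul_assoc w, add_mul, one_mul]
  gcongr
  · exact le_add_of_nonneg_right hsum
  · exact le_add_of_nonneg_left hbudget
  · exact le_add_of_nonneg_right hsum

end TwoTimescale

namespace RegularModel

variable {nS nZ nA K n : ℕ} {S : Set (Euc nS)} {Z : Set (Euc nZ)} {A : Set (Euc nA)}
  {M : CMDP S Z A K} {π : Policy S Z A n} {Θ : Set (Euc n)}
  {m : ↥Θ → ProbabilityMeasure (AugState S Z)} {L L' : ℝ≥0} {lam ρ : ℝ} {q : ℕ}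
  {Qnet : Fin (K + 1) → Euc q → AugState S Z → ↥A → ℝ} {μ η : ℕ → ℝ} {B : ℕ}
  (h : RegularModel M π Θ m L L' lam ρ) (hs : TwoTimescale μ η) (hB : 0 < B) (k : Fin (K + 1))
include h hs hB

theorem exists_sum_integral_sqErrF_le (b : ℝ) :
    ∃ C G, 0 ≤ C ∧ ∀ (Ω : Type*) [MeasurableSpace Ω] (P : Measure Ω)
      [IsProbabilityMeasure P] (R : Run M π Θ Qnet μ η B P), R.BoundedBy b →
      (∀ i ω, |R.fhat k i ω| ≤ G) ∧ (∀ i, Integrable (R.sqErrF k i) P) ∧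
      ∀ N, ∑ i ∈ Finset.range (N + 1), ∫ ω, R.sqErrF k i ω ∂P ≤ C * budget μ η N := by
  have hsol := h.poissonSolution_costSample k
  obtain ⟨c, hc⟩ := hsol.sample.exists_bddMeas_uncurry
  obtain ⟨C, G, hC, -, hest⟩ := hsol.exists_sum_integral_sq_err_le (Qnet := Qnet) hs h.isBounded
    hB b c
  refine ⟨C, G, hC, fun Ω _ P _ R hb => ?_⟩
  have hmem := R.θ_mem h.smooth.convex hs.μ_nonneg hs.μ_le_one
  obtain ⟨hbound, hbdd, hsum⟩ := hest Ω P R hmem _ _ (R.estimate_fhat hmem k hb hc)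
  have hsq (i : ℕ) (ω : Ω) :
      R.sqErrF k i ω = ‖R.fhat k i ω - M.objective π k (R.param hmem i ω)‖ ^ 2 := by
    rw [Real.norm_eq_abs, sq_abs]
    rfl
  refine ⟨hbound, fun i => ?_, fun N => ?_⟩
  · simpa only [funext (hsq i), real_inner_self_eq_norm_sq] using
      ((hbdd i).inner (hbdd i)).integrable P
  · simpa only [hsq, sub_self, inner_zero_right, integral_zero, abs_zero, Finset.sum_const_zero,
      add_zero] using hsum N

theorem exists_sum_integral_sqErrG_le
    (hQnet : ∀ k, Measurable fun p : Euc q × AugState S Z × ↥A => Qnet k p.1 p.2.1 p.2.2)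
    {T : ℕ → ℕ} {c : ℝ} (hT : ∀ i, ρ ^ T i ≤ c * η (i + 1)) (b G : ℝ) :
    ∃ C, 0 ≤ C ∧ ∀ (Ω : Type*) [MeasurableSpace Ω] (P : Measure Ω) [IsProbabilityMeasure P]
      (R : Run M π Θ Qnet μ η B P), R.BoundedBy b → (∀ i ω, |R.fhat k i ω| ≤ G) →
      (∀ i, Integrable (R.sqErrG k i) P) ∧
      ∀ N, ∑ i ∈ Finset.range (N + 1), ∫ ω, R.sqErrG k i ω ∂P ≤
        C * (budget μ η N + ∑ i ∈ Finset.range (N + 1), (R.criticErr k (T i) i).toReal) := by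
  have hsol := h.poissonSolution_gradSample k
  obtain ⟨Cs, hCs⟩ := h.exists_abs_surrogateQ_sub_le k
  obtain ⟨C, D, hC, hD, hest⟩ := hsol.exists_sum_integral_sq_err_le (Qnet := Qnet) hs h.isBounded
    hB b (b * L)
  refine ⟨C * (1 + 2 * D * L * (1 + |Cs| * |c|)), by positivity, fun Ω _ P _ R hb hG => ?_⟩
  have hmem := R.θ_mem h.smooth.convex hs.μ_nonneg hs.μ_le_one
  have hghat := R.estimate_ghat hmem k hb h hQnet
  obtain ⟨-, hbdd, hsum⟩ := hest Ω P R hmem _ _ hghat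
  have hsq (i : ℕ) (ω : Ω) :
      R.sqErrG k i ω = ‖R.ghat k i ω - M.gradObjective π Θ k (R.param hmem i ω)‖ ^ 2 := rfl
  refine ⟨fun i => ?_, fun N => ?_⟩
  · simpa only [funext (hsq i), real_inner_self_eq_norm_sq] using
      ((hbdd i).inner (hbdd i)).integrable P
  have hhorizon (i : ℕ) : Cs * ρ ^ T i ≤ |Cs| * |c| * η (i + 1) := by
    rw [mul_assoc]
    exact mul_le_mul (le_abs_self Cs) ((hT i).trans
      (mul_le_mul_of_nonneg_right (le_abs_self c) (hs.η_pos _).le)) (pow_pos h.ρ_pos _).le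
      (abs_nonneg Cs)
  have hbias (i : ℕ) : |∫ ω, inner ℝ (R.ghat k i ω - M.gradObjective π Θ k (R.param hmem i ω))
      (batchAvg B (fun t => R.criticSample k i t ω) i - R.batch hmem (M.gradSample π m k) i ω) ∂P|
      ≤ 2 * D * L * ((R.criticErr k (T i) i).toReal + |Cs| * |c| * η (i + 1)) := by
    refine (R.abs_integral_inner_batchAvg_criticSample_sub_le hmem k hb h hQnet (hG i) (T i) hCs
      (hghat.measurable_err hmem hsol.mean i) (hbdd i).bound).trans ?_
    grw [hhorizon i]
  calc _ ≤ C * (budget μ η N + ∑ i ∈ Finset.range (N + 1),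
        2 * D * L * ((R.criticErr k (T i) i).toReal + |Cs| * |c| * η (i + 1))) :=
      (hsum N).trans (by gcongr with i _; exact hbias i)
    _ ≤ C * ((1 + 2 * D * L * (1 + |Cs| * |c|)) *
        (budget μ η N + ∑ i ∈ Finset.range (N + 1), (R.criticErr k (T i) i).toReal)) := by
      gcongr
      exact hs.budget_add_sum_le (by positivity) (by positivity) (fun _ => ENNReal.toReal_nonneg) N
    _ = _ := (mul_assoc ..).symm

end RegularModel

section Rate

variable {μ η : ℕ → ℝ}

/-- The step-size terms of iteration `j` in a convergence rate, with weights `l` and `c`. -/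
def rateTerm (μ η : ℕ → ℝ) (l c : ℝ) (j : ℕ) : ℝ :=
  μ j * l + μ j ^ 2 / η (j + 1) ^ 2 + μ j ^ 2 / η (j + 1) + η (j + 1) * c

namespace TwoTimescale

variable (h : TwoTimescale μ η) {l c : ℝ}
include h

theorem rateTerm_nonneg (hl : 0 ≤ l) (hc : 0 ≤ c) (j : ℕ) : 0 ≤ rateTerm μ η l c j := by
  have hη := h.η_pos (j + 1)
  have hμ := h.μ_nonneg j
  unfold rateTerm
  positivity

theorem sq_div_le_rateTerm (j : ℕ) :
    μ j ^ 2 / η j ^ 2 + μ j * l + η (j + 1) * c ≤ rateTerm μ η l c j := by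
  have hη := h.η_pos (j + 1)
  have hsq : μ j ^ 2 / η j ^ 2 ≤ μ j ^ 2 / η (j + 1) ^ 2 := by
    gcongr
    exact h.η_antitone j.le_succ
  have hextra : 0 ≤ μ j ^ 2 / η (j + 1) := by positivity
  unfold rateTerm
  linarith

theorem budget_le_of_one_le (hl : 1 ≤ l) (hc : 1 ≤ c) (N : ℕ) :
    budget μ η N ≤ 1 / η (N + 1) + ∑ j ∈ Finset.range (N + 1), rateTerm μ η l c j := by
  rw [budget_eq]
  gcongr with j
  exact le_trans (add_le_add (add_le_add_right (le_mul_of_one_le_right (h.μ_nonneg j) hl) _)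
    (le_mul_of_one_le_right (h.η_pos _).le hc)) (h.sq_div_le_rateTerm j)

theorem budget_le_add_mul (hl : 0 ≤ l) (hc : 0 ≤ c) (N : ℕ) : budget μ η N ≤
    1 / η (N + 1) + ∑ j ∈ Finset.range (N + 1), rateTerm μ η l c j + (N + 1) * (1 + η 0) := by
  have hterm (j : ℕ) :
      μ j ^ 2 / η j ^ 2 + μ j + η (j + 1) ≤ rateTerm μ η l c j + (1 + η 0) := by
    have hμ := mul_nonneg (h.μ_nonneg j) hl
    have hη := mul_nonneg (h.η_pos (j + 1)).le hc
    linarith [h.sq_div_le_rateTerm (l := l) (c := c) j, h.μ_le_one j, h.η_le_zero (j + 1)]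
  rw [budget_eq, add_assoc]
  gcongr
  refine (Finset.sum_le_sum fun j _ => hterm j).trans_eq ?_
  rw [Finset.sum_add_distrib, Finset.sum_const, Finset.card_range, nsmul_eq_mul, Nat.cast_add_one]

-- For `N ≤ 2` the logarithm may be smaller than `1`, and even vanish; the leading term
-- `1 / η (N + 1)` then dominates the boundedly many terms of the budget.
theorem budget_le {N : ℕ} (hc : min 1 (Real.log N) ≤ c) :
    budget μ η N ≤ (1 + 3 * (1 + η 0) * η 0) * (1 / η (N + 1) +
      ∑ j ∈ Finset.range (N + 1), rateTerm μ η (Real.log N ^ 2) c j) := by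
  have hlog : 0 ≤ Real.log N := Real.log_natCast_nonneg N
  have hc_nonneg : 0 ≤ c := (le_min zero_le_one hlog).trans hc
  have hη₀ := h.η_pos 0
  have hη := h.η_pos (N + 1)
  have hsum : 0 ≤ ∑ j ∈ Finset.range (N + 1), rateTerm μ η (Real.log N ^ 2) c j :=
    Finset.sum_nonneg fun j _ => h.rateTerm_nonneg (sq_nonneg _) hc_nonneg j
  rw [add_mul, one_mul]
  obtain hN' | hN' := le_or_gt 3 N
  · have hlog_ge : 1 ≤ Real.log N := by
      rw [Real.le_log_iff_exp_le (by positivity)]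
      exact Real.exp_one_lt_three.le.trans (by exact_mod_cast hN')
    rw [min_eq_left hlog_ge] at hc
    exact (h.budget_le_of_one_le (one_le_pow₀ hlog_ge) hc N).trans
      (le_add_of_nonneg_right (by positivity))
  · have hcount : (N : ℝ) + 1 ≤ 3 := by exact_mod_cast hN'
    have hinv : 1 ≤ η 0 * (1 / η (N + 1)) := by
      rw [mul_one_div, one_le_div hη]
      exact h.η_le_zero (N + 1)
    refine (h.budget_le_add_mul (sq_nonneg _) hc_nonneg N).trans (add_le_add_right ?_ _)
    calc ((N : ℝ) + 1) * (1 + η 0) ≤ 3 * (1 + η 0) * (η 0 * (1 / η (N + 1))) := by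
          grw [hcount, ← hinv, mul_one]
      _ ≤ 3 * (1 + η 0) * η 0 * (1 / η (N + 1) + _) := by
          rw [← mul_assoc]
          gcongr
          exact le_add_of_nonneg_right hsum

theorem exists_mul_budget_le : ∃ s, 1 ≤ s ∧ ∀ (D : ℝ), 0 ≤ D → ∀ (N : ℕ) (c : ℝ),
    min 1 (Real.log N) ≤ c → D * (1 / (1 + (N : ℝ)) * budget μ η N) ≤
      D * s * (1 / ((1 + (N : ℝ)) * η (N + 1))) + D * s * (1 / (1 + (N : ℝ)) *
        ∑ j ∈ Finset.range (N + 1), rateTerm μ η (Real.log N ^ 2) c j) := by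
  have hη := h.η_pos 0
  refine ⟨1 + 3 * (1 + η 0) * η 0, le_add_of_nonneg_right (by positivity),
    fun D hD N c hc => ?_⟩
  grw [h.budget_le hc]
  rw [← mul_add, ← one_div_mul_one_div, ← mul_add, mul_left_comm (1 / _), ← mul_assoc D]

end TwoTimescale

end Rate

namespace Run

variable {nS nZ nA K n : ℕ} {S : Set (Euc nS)} {Z : Set (Euc nZ)} {A : Set (Euc nA)}
  {M : CMDP S Z A K} {π : Policy S Z A n} {Θ : Set (Euc n)} {q : ℕ}
  {Qnet : Fin (K + 1) → Euc q → AugState S Z → ↥A → ℝ} {μ η : ℕ → ℝ} {B : ℕ}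
  {Ω : Type*} [mΩ : MeasurableSpace Ω] {P : Measure Ω} (R : Run M π Θ Qnet μ η B P)

theorem epsF_nonneg (k : Fin (K + 1)) (i : ℕ) : 0 ≤ R.epsF k i :=
  mul_nonneg (by positivity)
    (Finset.sum_nonneg fun _ _ => integral_nonneg fun _ => sq_nonneg _)

theorem epsQ_nonneg (k : Fin (K + 1)) (T : ℕ → ℕ) (i : ℕ) : 0 ≤ R.epsQ k T i :=
  mul_nonneg (by positivity) (Finset.sum_nonneg fun _ _ => ENNReal.toReal_nonneg)

end Run

namespace RegularModel

variable {nS nZ nA K n : ℕ} {S : Set (Euc nS)} {Z : Set (Euc nZ)} {A : Set (Euc nA)}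
  {M : CMDP S Z A K} {π : Policy S Z A n} {Θ : Set (Euc n)}
  {m : ↥Θ → ProbabilityMeasure (AugState S Z)} {L L' : ℝ≥0} {lam ρ : ℝ} {q : ℕ}
  {Qnet : Fin (K + 1) → Euc q → AugState S Z → ↥A → ℝ} {μ η : ℕ → ℝ} {B : ℕ}

theorem exists_eps_le (h : RegularModel M π Θ m L L' lam ρ) (hs : TwoTimescale μ η) (hB : 0 < B)
    (hQnet : ∀ k, Measurable fun p : Euc q × AugState S Z × ↥A => Qnet k p.1 p.2.1 p.2.2)
    {T : ℕ → ℕ} {c : ℝ} (hT : ∀ i, ρ ^ T i ≤ c * η (i + 1)) (b : ℝ) :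
    ∃ D, 0 < D ∧ ∀ (Ω : Type*) [MeasurableSpace Ω] (P : Measure Ω) [IsProbabilityMeasure P]
      (R : Run M π Θ Qnet μ η B P), R.BoundedBy b → ∀ k,
      (∀ i, Integrable (R.sqErrF k i) P) ∧ (∀ i, Integrable (R.sqErrG k i) P) ∧
      (∀ i, R.criticErr k (T i) i ≠ ∞) ∧
      ∀ N : ℕ, R.epsF k N ≤ D * (1 / (1 + (N : ℝ)) * budget μ η N) ∧
        R.epsG k N ≤ D * (1 / (1 + (N : ℝ)) * budget μ η N) + D * R.epsQ k T N := by
  choose C₁ G hC₁ hF using fun k => h.exists_sum_integral_sqErrF_le (Qnet := Qnet) hs hB k b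
  choose C₂ hC₂ hG using fun k => h.exists_sum_integral_sqErrG_le hs hB k hQnet hT b (G k)
  obtain ⟨D, hD⟩ := Finite.exists_le fun k => C₁ k + C₂ k
  have hD_nonneg : 0 ≤ D := (add_nonneg (hC₁ 0) (hC₂ 0)).trans (hD 0)
  refine ⟨D + 1, by positivity, fun Ω _ P _ R hb k => ?_⟩
  obtain ⟨hbound, hFint, hFsum⟩ := hF k Ω P R hb
  obtain ⟨hGint, hGsum⟩ := hG k Ω P R hb hbound
  have hmem := R.θ_mem h.smooth.convex hs.μ_nonneg hs.μ_le_one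
  refine ⟨hFint, hGint, fun i => R.criticErr_ne_top hmem k hb h (hbound i) (T i), fun N => ?_⟩
  have hbudget := hs.budget_nonneg N
  have : 0 ≤ ∑ i ∈ Finset.range (N + 1), (R.criticErr k (T i) i).toReal :=
    Finset.sum_nonneg fun i _ => ENNReal.toReal_nonneg
  rw [← mul_add, Run.epsF, Run.epsG, Run.epsQ, ← mul_add, mul_left_comm (D + 1),
    mul_left_comm (D + 1)]
  have hC : C₁ k ≤ D + 1 ∧ C₂ k ≤ D + 1 := by
    constructor <;> linarith [hC₁ k, hC₂ k, hD k]
  grw [hFsum N, hGsum N, hC.1, hC.2]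
  exact ⟨le_rfl, le_rfl⟩

end RegularModel

end CACRL

end

open CACRL in
theorem lemma1_general
    {nS nZ nA K n q : ℕ} {S : Set (Euc nS)} {Z : Set (Euc nZ)} {A : Set (Euc nA)}
    {M : CMDP S Z A K} {π : Policy S Z A n} {Θ : Set (Euc n)}
    {m : ↥Θ → ProbabilityMeasure (AugState S Z)} {L L' : ℝ≥0} {lam ρ : ℝ}
    (hmodel : RegularModel M π Θ m L L' lam ρ) {μ η : ℕ → ℝ} (hstep : TwoTimescale μ η)
    {B : ℕ} (hB : 0 < B) {Qnet : Fin (K + 1) → Euc q → AugState S Z → ↥A → ℝ}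
    (hQnet : ∀ k, Measurable fun p : Euc q × AugState S Z × ↥A => Qnet k p.1 p.2.1 p.2.2)
    {T : ℕ → ℕ} {c : ℝ} (hT : ∀ i, ρ ^ T i ≤ c * η (i + 1)) (b : ℝ) :
    ∃ C : ℝ, 0 < C ∧
      ∀ (Ω : Type*) [MeasurableSpace Ω] (P : Measure Ω) [IsProbabilityMeasure P]
        (R : Run M π Θ Qnet μ η B P), R.BoundedBy b → ∀ k : Fin (K + 1),
        (∀ i, Integrable (R.sqErrF k i) P) ∧ (∀ i, Integrable (R.sqErrG k i) P) ∧
        (∀ i, R.criticErr k (T i) i ≠ ∞) ∧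
        (∀ i : ℕ, 1 ≤ i → R.epsF k i ≤
          C * (1 / ((1 + (i : ℝ)) * η (i + 1))) +
          C * ((1 / (1 + (i : ℝ))) * ∑ j ∈ Finset.range (i + 1),
            (μ j * Real.log i ^ 2 + μ j ^ 2 / η (j + 1) ^ 2 + μ j ^ 2 / η (j + 1)
              + η (j + 1) * Real.log i))) ∧
        (∀ i : ℕ, 1 ≤ i → R.epsG k i ≤
          C * (1 / ((1 + (i : ℝ)) * η (i + 1))) +
          C * ((1 / (1 + (i : ℝ))) * ∑ j ∈ Finset.range (i + 1),
            (μ j * Real.log i ^ 2 + μ j ^ 2 / η (j + 1) ^ 2 + μ j ^ 2 / η (j + 1)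
              + η (j + 1))) +
          C * R.epsQ k T i + Real.sqrt (R.epsF k i)) ∧
        Tendsto (fun i => R.epsF k i) atTop (𝓝 0) ∧
        (∀ ε : ℝ, 0 < ε → ∀ᶠ i in atTop, R.epsG k i ≤ C * R.epsQ k T i + ε) := by
  obtain ⟨D, hD, heps⟩ := hmodel.exists_eps_le (Qnet := Qnet) hstep hB hQnet hT b
  obtain ⟨s, hs, hrate⟩ := hstep.exists_mul_budget_le
  refine ⟨D * s, mul_pos hD (zero_lt_one.trans_le hs), fun Ω _ P _ R hb k => ?_⟩
  obtain ⟨hF, hG, hQ, hle⟩ := heps Ω P R hb k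
  have hcritic (i : ℕ) : D * R.epsQ k T i ≤ D * s * R.epsQ k T i :=
    mul_le_mul_of_nonneg_right (le_mul_of_one_le_right hD.le hs) (R.epsQ_nonneg k T i)
  have hlim : Tendsto (fun N : ℕ => D * (1 / (1 + (N : ℝ)) * budget μ η N)) atTop (𝓝 0) := by
    simpa only [mul_zero] using hstep.tendsto_budget.const_mul D
  refine ⟨hF, hG, hQ, fun i _ => ?_, fun i _ => ?_, ?_, fun ε hε => ?_⟩
  · exact (hle i).1.trans (hrate D hD.le i _ (min_le_right _ _))
  · have hbound := hrate D hD.le i 1 (min_le_left _ _)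
    simp only [rateTerm, mul_one] at hbound
    exact ((hle i).2.trans (add_le_add hbound (hcritic i))).trans
      (le_add_of_nonneg_right (Real.sqrt_nonneg _))
  · exact squeeze_zero (R.epsF_nonneg k) (fun i => (hle i).1) hlim
  · filter_upwards [hlim.eventually (ge_mem_nhds hε)] with i hi
    linarith [(hle i).2, hcritic i]

theorem lemma1
    {nS nZ nA K n q : ℕ}
    {S : Set (CACRL.Euc nS)} {Z : Set (CACRL.Euc nZ)} {A : Set (CACRL.Euc nA)}
    (M : CACRL.CMDP S Z A K) (π : CACRL.Policy S Z A n) (Θ : Set (CACRL.Euc n)) (lam ρ : ℝ)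
    (hprob : CACRL.ProblemAssumptions M π Θ lam ρ)
    (μ η : ℕ → ℝ) (hstep : CACRL.StepSizes μ η)
    (B : ℕ) (hB : 0 < B)
    (Qnet : Fin (K + 1) → CACRL.Euc q → CACRL.AugState S Z → ↥A → ℝ)
    (hQnet : ∀ k, Measurable fun p : CACRL.Euc q × CACRL.AugState S Z × ↥A =>
      Qnet k p.1 p.2.1 p.2.2)
    (T : ℕ → ℕ) (c : ℝ) (hT : ∀ i, ρ ^ T i ≤ c * η (i + 1))
    (b : ℝ) :
    ∃ C : ℝ, 0 < C ∧
      ∀ (Ω : Type*) [MeasurableSpace Ω] (P : Measure Ω) [IsProbabilityMeasure P]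
        (R : CACRL.Run M π Θ Qnet μ η B P), R.BoundedBy b → ∀ k : Fin (K + 1),
        -- all the expectations involved are finite
        (∀ i, Integrable (R.sqErrF k i) P) ∧ (∀ i, Integrable (R.sqErrG k i) P) ∧
        (∀ i, R.criticErr k (T i) i ≠ ∞) ∧
        -- finite-iteration bounds
        (∀ i : ℕ, 1 ≤ i → R.epsF k i ≤
          C * (1 / ((1 + (i : ℝ)) * η (i + 1))) +
          C * ((1 / (1 + (i : ℝ))) * ∑ j ∈ Finset.range (i + 1),
            (μ j * Real.log i ^ 2 + μ j ^ 2 / η (j + 1) ^ 2 + μ j ^ 2 / η (j + 1)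
              + η (j + 1) * Real.log i))) ∧
        (∀ i : ℕ, 1 ≤ i → R.epsG k i ≤
          C * (1 / ((1 + (i : ℝ)) * η (i + 1))) +
          C * ((1 / (1 + (i : ℝ))) * ∑ j ∈ Finset.range (i + 1),
            (μ j * Real.log i ^ 2 + μ j ^ 2 / η (j + 1) ^ 2 + μ j ^ 2 / η (j + 1)
              + η (j + 1))) +
          C * R.epsQ k T i + Real.sqrt (R.epsF k i)) ∧
        -- asymptotics
        Tendsto (fun i => R.epsF k i) atTop (𝓝 0) ∧
        (∀ ε : ℝ, 0 < ε → ∀ᶠ i in atTop, R.epsG k i ≤ C * R.epsQ k T i + ε) := by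
  obtain ⟨m, L, L', hmodel⟩ := hprob.exists_regularModel
  exact lemma1_general hmodel hstep.twoTimescale hB hQnet hT b
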